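/- Fix $d\ge 1$. Cubes in $\mathbb{R}^d$ have sides parallel to the axes, $\ell(Q)$ is the side length of $Q$, $3Q$ is the concentric cube with side length $3\ell(Q)$, and $\mathscr{D}(Q)$ is the family of all cubes obtained from $Q$ by repeated dyadic subdivision ($Q$ included). For $s>0$ write $s=m+\delta$ with $m\in\{0,1,2,\dots\}$ and $\delta\in(0,1]$. A bounded linear operator $T\colon L^2(\mathbb{R}^d)\to L^2(\mathbb{R}^d)$ (real-valued functions) is an $s$-smooth Calderón–Zygmund operator if there is a kernel $K\colon \{(x,y)\in\mathbb{R}^d\times\mathbb{R}^d: x\ne y\}\to\mathbb{R}$, with $K(x,\cdot)$ of class $C^m$ on $\mathbb{R}^d\setminus\{x\}$ for every $x$, such that for all $f\in L^\infty_c(\mathbb{R}^d)$ (bounded, with compact support) and a.e. $x\notin \operatorname{supp} f$ $$Tf(x)=\int_{\mathbb{R}^d}K(x,y)f(y)\,dy,$$ and a constant $C_K>0$ such that for all $x\neq y$ and all $h$ with $|h|\le\frac12|x-y|$ $$|\partial_y^\alpha K(x,y)|\le \frac{C_K}{|x-y|^{d+|\alpha|}},\qquad |\partial_y^\alpha K(x,y)-\partial_y^\alpha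 K(x+h,y)|\le \frac{C_K|h|^\delta}{|x-y|^{d+|\alpha|+\delta}}\qquad(|\alpha|\le m),$$ $$|\partial_y^\alpha K(x,y)-\partial_y^\alpha K(x,y+h)|\le \frac{C_K|h|^\delta}{|x-y|^{d+s}}\qquad(|\alpha|=m).$$ For a cube $R$, let $\mathcal{F}_s(R)$ be the class of all $\varphi\in C^m(\mathbb{R}^d;\mathbb{R})$ supported in $R$ with $|\partial^\alpha\varphi(y)|\le \ell(R)^{-|\alpha|}$ for $|\alpha|\le m$ and $|\partial^\alpha\varphi(y)-\partial^\alpha\varphi(y')|\le |y-y'|^\delta\,\ell(R)^{-s}$ for $|\alpha|=m$, for all $y,y'\in\mathbb{R}^d$. For a cube $Q$ let $$\mathcal{M}^s_{Q}f(x)=\sup_{R\subseteq Q,\ R\ni x}\ \sup_{\varphi\in\mathcal{F}_s(R)}\frac1{|R|}\left|\int_R f(y)\varphi(y)\,dy\right|$$ (the first supremum is over cubes $R$), and for $0<r<1$ and a measurable $g\ge0$ let $$\mathsf{P}_Q^r(g)=\inf\{\lambda\in\mathbb{R}:\ |\{x\in Q: g(x)>\lambda\}|\le r|Q|\}.$$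 A family $\mathcal{S}$ of cubes is $\frac12$-sparse if there are pairwise disjoint measurable sets $E_Q\subseteq Q$, $Q\in\mathcal{S}$, with $|E_Q|\ge\frac12|Q|$. **Theorem.** There is $r\in(0,1)$ depending only on $d$ such that the following holds. Let $s>0$ and let $T$ be an $s$-smooth Calderón–Zygmund operator on $\mathbb{R}^d$. There is a constant $C$, depending only on $d$, $s$ and $T$, such that for every cube $Q_0\subseteq\mathbb{R}^d$ and every $f\in L^\infty_c(\mathbb{R}^d)$ supported on $Q_0$ there is a $\frac12$-sparse family $\mathcal{S}\subseteq\mathscr{D}(Q_0)$ with $$|Tf(x)|\le C\sum_{Q\in\mathcal{S}}\mathsf{P}_Q^{r}\big(\mathcal{M}^s_{3Q}f\big)\,\mathbf{1}_Q(x)\qquad\text{for a.e. }x\in Q_0.$$ -/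

import Mathlib

open MeasureTheory
open scoped ENNReal NNReal

noncomputable section

namespace CancellativeSparse

/-- Euclidean space `ℝ^d` with the Euclidean norm and Lebesgue measure `volume`. -/
abbrev Space (d : ℕ) : Type := EuclideanSpace ℝ (Fin d)

/-! ### Cubes -/

/-- A cube with sides parallel to the axes, given by its lower corner and its side length. -/
structure Cube (d : ℕ) where
  /-- the lower corner -/
  corner : Space d
  /-- the side length `ℓ(Q)` -/
  side : ℝ
  side_pos : 0 < side

/-- The point set of a cube (half-open, so that dyadic subcubes of one generation form a
partition). -/
def Cube.toSet {d : ℕ} (Q : Cube d) : Set (Space d) :=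
  {x | ∀ i, Q.corner i ≤ x i ∧ x i < Q.corner i + Q.side}

/-- `3Q`: the cube with the same center and three times the side length. -/
def Cube.triple {d : ℕ} (Q : Cube d) : Cube d where
  corner := WithLp.toLp 2 (fun i => Q.corner i - Q.side)
  side := 3 * Q.side
  side_pos := mul_pos (by norm_num) Q.side_pos

/-- The dyadic cubes `𝒟(Q₀)`: all cubes obtained from `Q₀` by repeatedly halving the sides
(`Q₀` itself is generation `k = 0`). -/
def dyadicCubes {d : ℕ} (Q₀ : Cube d) : Set (Cube d) :=
  {Q | ∃ k : ℕ, Q.side = Q₀.side / 2 ^ k ∧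
    ∃ j : Fin d → ℕ, ∀ i, j i < 2 ^ k ∧ Q.corner i = Q₀.corner i + (j i : ℝ) * Q.side}

/-- A family of cubes is `η`-sparse if every `Q` in it has a measurable subset `E Q` of measure at
least `η |Q|` and these subsets are pairwise disjoint. -/
def IsSparse {d : ℕ} (η : ℝ) (S : Set (Cube d)) : Prop :=
  ∃ E : Cube d → Set (Space d),
    (∀ Q ∈ S, MeasurableSet (E Q) ∧ E Q ⊆ Q.toSet ∧
      ENNReal.ofReal η * volume Q.toSet ≤ volume (E Q)) ∧
    S.PairwiseDisjoint E

/-! ### Smoothness of order `s = m + δ` -/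

/-- For `s > 0`, the integer `m ∈ {0, 1, 2, …}` in `s = m + δ`, `δ ∈ (0, 1]`. -/
def intPart (s : ℝ) : ℕ := ⌈s⌉₊ - 1

/-- For `s > 0`, the number `δ ∈ (0, 1]` in `s = m + δ`. -/
def holderPart (s : ℝ) : ℝ := s - intPart s

theorem holderPart_mem {s : ℝ} (hs : 0 < s) :
    (intPart s : ℝ) + holderPart s = s ∧ 0 < holderPart s ∧ holderPart s ≤ 1 := by
  have h1 : 1 ≤ ⌈s⌉₊ := Nat.one_le_iff_ne_zero.mpr (Nat.ceil_pos.mpr hs).ne'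
  have h2 : ((⌈s⌉₊ - 1 : ℕ) : ℝ) = (⌈s⌉₊ : ℝ) - 1 := by push_cast [h1]; ring
  have h3 := Nat.le_ceil s
  have h4 := Nat.ceil_lt_add_one hs.le
  unfold holderPart intPart
  rw [h2]
  exact ⟨by ring, by linarith, by linarith⟩

/-- The partial derivative `∂_{i 0} ⋯ ∂_{i (n-1)} g (y)` of order `n` (used only where `g` is `n`
times continuously differentiable near `y`). The operators `∂^α` with `|α| = n` are exactly those
given by the tuples `i : Fin n → Fin d`. -/
def partialDeriv {d n : ℕ} (i : Fin n → Fin d) (g : Space d → ℝ) (y : Space d) : ℝ :=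
  iteratedFDeriv ℝ n g y (fun j => EuclideanSpace.single (i j) (1 : ℝ))

/-- `φ ∈ 𝓕_s(Q)` for `s > 0`: an `s`-smooth, `L^∞`-normalized bump function localized in `Q`.
(Such a `φ` is continuous, so that vanishing outside the half-open cube is the same as having its
closed support in the closed cube.) -/
structure IsBump {d : ℕ} (s : ℝ) (Q : Cube d) (φ : Space d → ℝ) : Prop where
  contDiff : ContDiff ℝ (intPart s) φ
  support_subset : Function.support φ ⊆ Q.toSet
  bound : ∀ n ≤ intPart s, ∀ (i : Fin n → Fin d) (y : Space d),
    |partialDeriv i φ y| ≤ 1 / Q.side ^ n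
  holder : ∀ (i : Fin (intPart s) → Fin d) (y y' : Space d),
    |partialDeriv i φ y - partialDeriv i φ y'| ≤ ‖y - y'‖ ^ holderPart s / Q.side ^ s

/-- The local smooth maximal operator `ℳ^s_{Q₀} f (x)`: the supremum of
`|R|⁻¹ |∫_R f φ|` over all cubes `R ⊆ Q₀` that contain `x` and all `φ ∈ 𝓕_s(R)`. -/
def smoothMaximal {d : ℕ} (s : ℝ) (Q₀ : Cube d) (f : Space d → ℝ) (x : Space d) : ℝ≥0∞ :=
  ⨆ (R : Cube d) (_ : R.toSet ⊆ Q₀.toSet) (_ : x ∈ R.toSet)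
    (φ : Space d → ℝ) (_ : IsBump s R φ),
    ‖∫ y in R.toSet, f y * φ y‖ₑ / volume R.toSet

/-- The percentile `P_Ω^r(g) = inf {t : |{x ∈ Ω : g x > t}| ≤ r |Ω|}` of a nonnegative function
`g`, for `0 < r < 1` and `0 < |Ω| < ∞`. (As `g ≥ 0` and `r < 1`, no negative `t` is in the set, so
the infimum over real `t` is the one over `t ≥ 0`.) -/
def percentile {d : ℕ} (r : ℝ) (Ω : Set (Space d)) (g : Space d → ℝ≥0∞) : ℝ≥0∞ :=
  sInf {t | volume {x | x ∈ Ω ∧ t < g x} ≤ ENNReal.ofReal r * volume Ω}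

/-! ### Calderón–Zygmund operators -/

/-- `f ∈ L^∞_c(ℝ^d)`: essentially bounded with compact support. -/
structure IsLinftyC {d : ℕ} (f : Space d → ℝ) : Prop where
  memLp_top : MemLp f ∞ (volume : Measure (Space d))
  hasCompactSupport : HasCompactSupport f

theorem IsLinftyC.memLp_two {d : ℕ} {f : Space d → ℝ} (hf : IsLinftyC f) :
    MemLp f 2 (volume : Measure (Space d)) :=
  hf.memLp_top.mono_exponent_of_measure_support_ne_top
    (s := tsupport f) (fun _ hx => image_eq_zero_of_notMem_tsupport hx)
    hf.hasCompactSupport.measure_lt_top.ne le_top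

/-- `L²(ℝ^d)`, real-valued. -/
abbrev L2 (d : ℕ) : Type := Lp ℝ 2 (volume : Measure (Space d))

/-- `K` is a kernel, defined off the diagonal, with the size and smoothness estimates of order
`s = m + δ` with constant `C`. The values of `K` on the diagonal play no role. -/
structure IsSmoothKernel {d : ℕ} (s : ℝ) (K : Space d → Space d → ℝ) (C : ℝ) : Prop where
  contDiffOn : ∀ x, ContDiffOn ℝ (intPart s) (K x) {x}ᶜ
  size : ∀ n ≤ intPart s, ∀ (i : Fin n → Fin d) (x y : Space d), x ≠ y →
    |partialDeriv i (K x) y| ≤ C / ‖x - y‖ ^ (d + n)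
  holder_left : ∀ n ≤ intPart s, ∀ (i : Fin n → Fin d) (x y h : Space d), x ≠ y →
    ‖h‖ ≤ ‖x - y‖ / 2 →
    |partialDeriv i (K x) y - partialDeriv i (K (x + h)) y| ≤
      C * ‖h‖ ^ holderPart s / ‖x - y‖ ^ ((d : ℝ) + n + holderPart s)
  holder_right : ∀ (i : Fin (intPart s) → Fin d) (x y h : Space d), x ≠ y →
    ‖h‖ ≤ ‖x - y‖ / 2 →
    |partialDeriv i (K x) y - partialDeriv i (K x) (y + h)| ≤
      C * ‖h‖ ^ holderPart s / ‖x - y‖ ^ ((d : ℝ) + s)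

/-- The bounded linear operator `T` on `L²(ℝ^d)` is an `s`-smooth Calderón–Zygmund operator: it is
given off the support of `f ∈ L^∞_c` by integration against an `s`-smooth kernel. -/
def IsSmoothCZO {d : ℕ} (s : ℝ) (T : L2 d →L[ℝ] L2 d) : Prop :=
  ∃ (K : Space d → Space d → ℝ) (C : ℝ), 0 < C ∧ IsSmoothKernel s K C ∧
    ∀ (f : Space d → ℝ) (hf : IsLinftyC f),
      ∀ᵐ x ∂(volume : Measure (Space d)), x ∉ tsupport f →
        T (hf.memLp_two.toLp f) x = ∫ y, K x y * f y

end CancellativeSparse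

end

open CancellativeSparse

/-!
The sparse family is built by a stopping-time argument. Let `ψ_Q` be a smooth cutoff that is `1` on
`2Q` and supported in `3Q`, and let `μ` be the percentile of the smooth maximal function `M` of `3Q`.
Outside an exceptional set `B` that fills only a small proportion of `Q`, one has
`|T (f ψ_Q)| ≲ μ`. The maximal dyadic cubes `P ⊆ Q` of which `B` fills too large a part have total
measure at most `|Q| / 2` and cover `B` up to a null set; because of their maximality they still
contain many points outside `B`, and on them `|T (f ψ_Q)| ≲ μ + |T (f ψ_P)|`
(`Cube.exists_exceptional_set`). Iterating on these cubes gives the sparse bound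
(`exists_sparse_of_exceptional_sets`).

Both estimates rest on one decomposition (`Cube.exists_decomposition`). Let `F ⊆ Q` be a set on which
`M ≤ μ`. The complement of `F` carries a smooth Whitney partition of unity; it is obtained without
choosing Whitney cubes, as a telescoping sum of products of bumps of consecutive dyadic grids. On
every Whitney piece, replacing `f ψ` by a constant with the same integral leaves a cancellative
piece `b_j`. The averages are `O(μ)`, since every piece is a smooth bump in a cube that contains a
point of `F`, and `|f| ≲ μ` almost everywhere on the closure of `F` by Lebesgue differentiation
along bumps. Thus `f ψ` is a function `G` with `|G| ≲ μ`, plus the `b_j`. The maximal function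
controls `f` only when it is tested against smooth functions, so the size of `T b_j` is estimated
by noticing that `y ↦ K x y - K x y_j`, times the bump of the piece, is itself a smooth bump, whose
height is `(ℓ_j / |x - y_j|)^δ |x - y_j|^(-d)`. The sum of these contributions is `μ` times a
Marcinkiewicz function, whose integral is `O(|Q|)`.

For the first estimate take `ψ = ψ_Q`, and bound `T G` in `L²` and the Marcinkiewicz function in
`L¹`. For the second, decompose `f ψ` with `ψ = ψ_Q (1 - ψ_P)`. The support of `ψ` stays away from
`P`, so that for all `x ∈ P` the Marcinkiewicz function may be evaluated at one fixed point of
`P \ B`, and `T G` oscillates by `O(μ)` on `P` because of the regularity of the kernel in `x`.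
Comparison with a point of `P` at which `T (f ψ_Q)` and `T (f ψ_P)` are both `O(μ)` finishes the
estimate. Differences `K x y - K x' y` are thus never tested against `f` directly: the hypotheses
give no joint gain in `|x - x'|` for the Hölder seminorm in `y` of the derivatives of order `m`.
-/

/-! ### Quantitative smoothness at a given scale -/

namespace CancellativeSparse

/-- `φ` is `C^m` on `U`, and its derivatives up to order `m`, as well as their `δ`-Hölder seminorms,
have the size on `U` that a function of height `A` varying at the length scale `L` has. -/
structure SmoothAtScale {d : ℕ} (m : ℕ) (δ L A : ℝ) (U : Set (Space d)) (φ : Space d → ℝ) :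
    Prop where
  contDiffOn : ContDiffOn ℝ m φ U
  bound : ∀ n ≤ m, ∀ y ∈ U, ‖iteratedFDeriv ℝ n φ y‖ ≤ A / L ^ n
  holder : ∀ n ≤ m, ∀ y ∈ U, ∀ y' ∈ U,
    ‖iteratedFDeriv ℝ n φ y - iteratedFDeriv ℝ n φ y'‖ ≤ A / L ^ n * (‖y - y'‖ / L) ^ δ

variable {d m : ℕ} {δ L A B : ℝ} {U V : Set (Space d)} {φ ψ : Space d → ℝ}

theorem norm_iteratedFDeriv_mul_le_of_isOpen {f g : Space d → ℝ} (hV : IsOpen V)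
    (hf : ContDiffOn ℝ m f V) (hg : ContDiffOn ℝ m g V) {y : Space d} (hy : y ∈ V) {n : ℕ}
    (hn : n ≤ m) {A B t : ℝ} (hA : 0 ≤ A) (hL : 0 < L) (ht : 0 ≤ t)
    (h1 : ∀ i ≤ m, ‖iteratedFDeriv ℝ i f y‖ ≤ A / L ^ i * t)
    (h2 : ∀ i ≤ m, ‖iteratedFDeriv ℝ i g y‖ ≤ B / L ^ i) :
    ‖iteratedFDeriv ℝ n (fun z => f z * g z) y‖ ≤ 2 ^ n * A * B / L ^ n * t := by
  have key := norm_iteratedFDerivWithin_mul_le hf hg hV.uniqueDiffOn hy (n := n)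
    (by exact_mod_cast hn)
  rw [iteratedFDerivWithin_of_isOpen n hV hy] at key
  refine key.trans ?_
  have : ∀ i ∈ Finset.range (n + 1), (n.choose i : ℝ) * ‖iteratedFDerivWithin ℝ i f V y‖ *
      ‖iteratedFDerivWithin ℝ (n - i) g V y‖ ≤ (n.choose i : ℝ) * (A * B / L ^ n * t) := by
    intro i hi
    have hi' : i ≤ n := Nat.lt_succ_iff.mp (Finset.mem_range.mp hi)
    rw [iteratedFDerivWithin_of_isOpen i hV hy, iteratedFDerivWithin_of_isOpen (n - i) hV hy,
      mul_assoc]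
    refine mul_le_mul_of_nonneg_left ?_ (Nat.cast_nonneg _)
    have e : A * B / L ^ n * t = (A / L ^ i * t) * (B / L ^ (n - i)) := by
      have : L ^ n = L ^ i * L ^ (n - i) := by rw [← pow_add]; congr 1; omega
      rw [this]; field_simp
    rw [e]
    exact mul_le_mul (h1 i (hi'.trans hn)) (h2 (n - i) ((Nat.sub_le _ _).trans hn))
      (norm_nonneg _) (by positivity)
  refine (Finset.sum_le_sum this).trans (le_of_eq ?_)
  rw [← Finset.sum_mul, ← Nat.cast_sum, Nat.sum_range_choose]
  push_cast; ring

namespace SmoothAtScale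

theorem nonneg_of_mem (h : SmoothAtScale m δ L A U φ) {y : Space d} (hy : y ∈ U) : 0 ≤ A := by
  have := (norm_nonneg _).trans (h.bound 0 (Nat.zero_le _) y hy)
  simpa using this

theorem abs_le (h : SmoothAtScale m δ L A U φ) {y : Space d} (hy : y ∈ U) : |φ y| ≤ A := by
  have := h.bound 0 (Nat.zero_le _) y hy
  simpa [norm_iteratedFDeriv_zero] using this

theorem mono_set (h : SmoothAtScale m δ L A U φ) (hVU : V ⊆ U) : SmoothAtScale m δ L A V φ :=
  ⟨h.contDiffOn.mono hVU, fun n hn y hy => h.bound n hn y (hVU hy),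
    fun n hn y hy y' hy' => h.holder n hn y (hVU hy) y' (hVU hy')⟩

theorem mono_const (h : SmoothAtScale m δ L A U φ) (hAB : A ≤ B) (hL : 0 < L) :
    SmoothAtScale m δ L B U φ := by
  refine ⟨h.contDiffOn, fun n hn y hy => (h.bound n hn y hy).trans (by gcongr),
    fun n hn y hy y' hy' => (h.holder n hn y hy y' hy').trans (by gcongr)⟩

theorem mono_scale (h : SmoothAtScale m δ L A U φ) {L' : ℝ} (hL' : 0 < L') (hLL : L' ≤ L)
    (hδ : 0 ≤ δ) : SmoothAtScale m δ L' A U φ := by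
  refine ⟨h.contDiffOn, fun n hn y hy => (h.bound n hn y hy).trans ?_,
    fun n hn y hy y' hy' => (h.holder n hn y hy y' hy').trans ?_⟩
  · have := h.nonneg_of_mem hy
    gcongr
  · have := h.nonneg_of_mem hy
    have hL : 0 < L := hL'.trans_le hLL
    gcongr

/-- A function that is smooth at the scale `L` is smooth at a comparable larger scale. -/
theorem enlarge_scale (h : SmoothAtScale m δ L A U φ) {L' c : ℝ} (hL' : 0 < L')
    (hc : 1 ≤ c) (hLL : L' ≤ c * L) (hδ : 0 ≤ δ) (hδ1 : δ ≤ 1) :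
    SmoothAtScale m δ L' (A * c ^ (m + 1)) U φ := by
  have hc0 : 0 < c := by linarith
  have hle : L' / c ≤ L := by rw [div_le_iff₀ hc0]; linarith
  have h' := h.mono_scale (by positivity : 0 < L' / c) hle hδ
  have hb : ∀ n ≤ m, 0 ≤ A → A / (L' / c) ^ n ≤ A * c ^ m / L' ^ n := by
    intro n hn hA
    rw [div_pow, div_div_eq_mul_div]
    have : c ^ n ≤ c ^ m := pow_le_pow_right₀ hc hn
    gcongr
  refine ⟨h.contDiffOn, fun n hn y hy => (h'.bound n hn y hy).trans ?_,
    fun n hn y hy y' hy' => (h'.holder n hn y hy y' hy').trans ?_⟩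
  · have hA := h.nonneg_of_mem hy
    refine (hb n hn hA).trans ?_
    have : c ^ m ≤ c ^ (m + 1) := pow_le_pow_right₀ hc (Nat.le_succ m)
    gcongr
  · have hA := h.nonneg_of_mem hy
    have e : (‖y - y'‖ / (L' / c)) ^ δ ≤ c * (‖y - y'‖ / L') ^ δ := by
      rw [div_div_eq_mul_div, mul_div_right_comm, Real.mul_rpow (by positivity) hc0.le, mul_comm]
      have : c ^ δ ≤ c := by
        calc c ^ δ ≤ c ^ (1 : ℝ) := Real.rpow_le_rpow_of_exponent_le hc hδ1
          _ = c := Real.rpow_one c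
      gcongr
    calc _ ≤ (A * c ^ m / L' ^ n) * (c * (‖y - y'‖ / L') ^ δ) := by
          have e1 := hb n hn hA
          exact mul_le_mul e1 e (by positivity) (by positivity)
      _ = _ := by ring

theorem mul (hU : IsOpen U) (hL : 0 < L) (h : SmoothAtScale m δ L A U φ)
    (h' : SmoothAtScale m δ L B U ψ) :
    SmoothAtScale m δ L (2 ^ (m + 1) * A * B) U (fun y => φ y * ψ y) := by
  refine ⟨h.contDiffOn.mul h'.contDiffOn, fun n hn y hy => ?_, fun n hn y hy y' hy' => ?_⟩
  · have hA := h.nonneg_of_mem hy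
    have hB := h'.nonneg_of_mem hy
    refine (norm_iteratedFDeriv_mul_le_of_isOpen (t := 1) hU h.contDiffOn h'.contDiffOn hy hn hA
      hL zero_le_one
      (fun i hi => by simpa using h.bound i hi y hy) (fun i hi => h'.bound i hi y hy)).trans ?_
    have : (2 : ℝ) ^ n ≤ 2 ^ (m + 1) := pow_le_pow_right₀ (by norm_num) (by omega)
    rw [mul_one]
    gcongr
  · have hA := h.nonneg_of_mem hy
    have hB := h'.nonneg_of_mem hy
    set k : Space d := y' - y with hk
    have hyk : y + k = y' := by simp [hk]
    -- the difference of the product at `y` and `y' = y + k` is the derivative at `y` of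
    -- `(φ - φ(· + k)) ψ + φ(· + k) (ψ - ψ(· + k))`
    set W : Set (Space d) := U ∩ (fun z => z + k) ⁻¹' U with hW
    have hWo : IsOpen W := hU.inter (hU.preimage (by fun_prop))
    have hyW : y ∈ W := ⟨hy, by simpa [hyk] using hy'⟩
    have hsh : ContDiff ℝ m (fun z : Space d => z + k) := by fun_prop
    have hφk : ContDiffOn ℝ m (fun z => φ (z + k)) W :=
      h.contDiffOn.comp hsh.contDiffOn (fun z hz => hz.2)
    have hψk : ContDiffOn ℝ m (fun z => ψ (z + k)) W :=
      h'.contDiffOn.comp hsh.contDiffOn (fun z hz => hz.2)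
    have hφ : ContDiffOn ℝ m φ W := h.contDiffOn.mono (fun z hz => hz.1)
    have hψ : ContDiffOn ℝ m ψ W := h'.contDiffOn.mono (fun z hz => hz.1)
    have at_ : ∀ {g : Space d → ℝ} {i : ℕ}, i ≤ m → ContDiffOn ℝ m g W → ContDiffAt ℝ i g y :=
      fun {g i} hi hg => (hg.contDiffAt (hWo.mem_nhds hyW)).of_le (by exact_mod_cast hi)
    set t := (‖y - y'‖ / L) ^ δ with ht
    have ht0 : 0 ≤ t := by positivity
    have d1 : ∀ i ≤ m, ‖iteratedFDeriv ℝ i (fun z => φ z - φ (z + k)) y‖ ≤ A / L ^ i * t := by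
      intro i hi
      rw [fun_iteratedFDeriv_sub_apply (at_ hi hφ) (at_ hi hφk), iteratedFDeriv_comp_add_right, hyk]
      exact h.holder i hi y hy y' hy'
    have d2 : ∀ i ≤ m, ‖iteratedFDeriv ℝ i (fun z => ψ z - ψ (z + k)) y‖ ≤ B / L ^ i * t := by
      intro i hi
      rw [fun_iteratedFDeriv_sub_apply (at_ hi hψ) (at_ hi hψk), iteratedFDeriv_comp_add_right, hyk]
      exact h'.holder i hi y hy y' hy'
    have d3 : ∀ i ≤ m, ‖iteratedFDeriv ℝ i (fun z => φ (z + k)) y‖ ≤ A / L ^ i := by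
      intro i hi
      rw [iteratedFDeriv_comp_add_right, hyk]
      exact h.bound i hi y' hy'
    have e1 := norm_iteratedFDeriv_mul_le_of_isOpen hWo (hφ.sub hφk) hψ hyW hn hA hL ht0 d1
      (fun i hi => h'.bound i hi y hy)
    have e2 := norm_iteratedFDeriv_mul_le_of_isOpen hWo (hψ.sub hψk) hφk hyW hn hB hL ht0 d2 d3
    have key : iteratedFDeriv ℝ n (fun z => φ z * ψ z) y -
        iteratedFDeriv ℝ n (fun z => φ z * ψ z) y' =
        iteratedFDeriv ℝ n (fun z => (φ z - φ (z + k)) * ψ z) y +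
        iteratedFDeriv ℝ n (fun z => (ψ z - ψ (z + k)) * φ (z + k)) y := by
      have s1 : iteratedFDeriv ℝ n (fun z => φ z * ψ z) y' =
          iteratedFDeriv ℝ n (fun z => φ (z + k) * ψ (z + k)) y := by
        rw [iteratedFDeriv_comp_add_right n k (f := fun z => φ z * ψ z), hyk]
      rw [s1, ← fun_iteratedFDeriv_sub_apply (at_ hn (hφ.mul hψ)) (at_ hn (hφk.mul hψk)),
        ← fun_iteratedFDeriv_add_apply (at_ hn ((hφ.sub hφk).mul hψ))
          (at_ hn ((hψ.sub hψk).mul hφk))]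
      congr 1
      ext z; ring
    rw [key]
    refine (norm_add_le _ _).trans ((add_le_add e1 e2).trans ?_)
    have : (2 : ℝ) ^ n ≤ 2 ^ m := pow_le_pow_right₀ (by norm_num) hn
    calc _ = 2 * 2 ^ n * A * B / L ^ n * t := by ring
      _ ≤ 2 * 2 ^ m * A * B / L ^ n * t := by gcongr
      _ = _ := by ring

theorem const_smul (hU : IsOpen U) (c : ℝ) (h : SmoothAtScale m δ L A U φ) :
    SmoothAtScale m δ L (|c| * A) U (fun y => c * φ y) := by
  have key : ∀ n ≤ m, ∀ y ∈ U, iteratedFDeriv ℝ n (fun y => c * φ y) y =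
      c • iteratedFDeriv ℝ n φ y := by
    intro n hn y hy
    have := iteratedFDeriv_const_smul_apply (i := n) (a := c)
      ((h.contDiffOn.contDiffAt (hU.mem_nhds hy)).of_le (by exact_mod_cast hn))
    exact this
  refine ⟨contDiffOn_const.mul h.contDiffOn, fun n hn y hy => ?_, fun n hn y hy y' hy' => ?_⟩
  · rw [key n hn y hy, norm_smul, Real.norm_eq_abs, mul_div_assoc]
    exact mul_le_mul_of_nonneg_left (h.bound n hn y hy) (abs_nonneg c)
  · rw [key n hn y hy, key n hn y' hy', ← smul_sub, norm_smul, Real.norm_eq_abs, mul_div_assoc,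
      mul_assoc]
    exact mul_le_mul_of_nonneg_left (h.holder n hn y hy y' hy') (abs_nonneg c)

/-- On a convex open set the Hölder condition is needed for the top derivative only: the
lower ones are controlled by the mean value theorem. -/
theorem of_convex (hU : IsOpen U) (hc : Convex ℝ U) (hL : 0 < L) (hδ : 0 ≤ δ) (hδ1 : δ ≤ 1)
    (h0 : ContDiffOn ℝ m φ U)
    (h1 : ∀ n ≤ m, ∀ y ∈ U, ‖iteratedFDeriv ℝ n φ y‖ ≤ A / L ^ n)
    (h2 : ∀ y ∈ U, ∀ y' ∈ U,
      ‖iteratedFDeriv ℝ m φ y - iteratedFDeriv ℝ m φ y'‖ ≤ A / L ^ m * (‖y - y'‖ / L) ^ δ) :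
    SmoothAtScale m δ L (2 * A) U φ := by
  have hA : ∀ y ∈ U, 0 ≤ A := fun y hy => by
    simpa using (norm_nonneg _).trans (h1 0 (Nat.zero_le _) y hy)
  refine ⟨h0, fun n hn y hy => (h1 n hn y hy).trans ?_, fun n hn y hy y' hy' => ?_⟩
  · have := hA y hy
    gcongr; linarith
  · have hA' := hA y hy
    rcases hn.lt_or_eq with hlt | rfl
    · rcases le_or_gt 1 (‖y - y'‖ / L) with hbig | hsmall
      · have e : 1 ≤ (‖y - y'‖ / L) ^ δ := Real.one_le_rpow hbig hδ
        calc _ ≤ A / L ^ n + A / L ^ n :=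
              (norm_sub_le _ _).trans (add_le_add (h1 n hn y hy) (h1 n hn y' hy'))
          _ = 2 * A / L ^ n * 1 := by ring
          _ ≤ _ := by gcongr
      · have hd : ∀ x ∈ U, DifferentiableAt ℝ (iteratedFDeriv ℝ n φ) x := fun x hx =>
          (h0.contDiffAt (hU.mem_nhds hx)).differentiableAt_iteratedFDeriv (by exact_mod_cast hlt)
        have hb : ∀ x ∈ U, ‖fderiv ℝ (iteratedFDeriv ℝ n φ) x‖ ≤ A / L ^ (n + 1) := fun x hx => by
          rw [norm_fderiv_iteratedFDeriv]; exact h1 (n + 1) hlt x hx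
        have mv := hc.norm_image_sub_le_of_norm_fderiv_le hd hb hy' hy
        refine mv.trans ?_
        have e : ‖y - y'‖ / L ≤ (‖y - y'‖ / L) ^ δ := by
          have := Real.rpow_le_rpow_of_exponent_ge' (by positivity) hsmall.le hδ hδ1
          simpa using this
        calc A / L ^ (n + 1) * ‖y - y'‖ = A / L ^ n * (‖y - y'‖ / L) := by
              rw [pow_succ]; field_simp
          _ ≤ 2 * A / L ^ n * (‖y - y'‖ / L) := by gcongr; linarith
          _ ≤ _ := by gcongr
    · refine (h2 y hy y' hy').trans ?_
      gcongr; linarith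

/-- Extension by zero: if the support of `φ` stays at distance at least `L` from the complement of
`U`, then smoothness at scale `L` on `U` is smoothness at scale `L` everywhere. -/
theorem of_tsupport (hU : IsOpen U) (hL : 0 < L) (hδ : 0 ≤ δ) (h : SmoothAtScale m δ L A U φ)
    (hA : 0 ≤ A) (hs : ∀ y ∈ tsupport φ, Metric.ball y L ⊆ U) :
    SmoothAtScale m δ L A Set.univ φ := by
  have hsU : tsupport φ ⊆ U := fun y hy => hs y hy (Metric.mem_ball_self hL)
  have hz : ∀ n, ∀ y ∉ tsupport φ, iteratedFDeriv ℝ n φ y = 0 := fun n y hy => by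
    by_contra hne
    exact hy (support_iteratedFDeriv_subset n hne)
  have main : ∀ n ≤ m, ∀ y ∈ tsupport φ, ∀ y', ‖iteratedFDeriv ℝ n φ y -
      iteratedFDeriv ℝ n φ y'‖ ≤ A / L ^ n * (‖y - y'‖ / L) ^ δ := by
    intro n hn y hy y'
    by_cases hy' : y' ∈ U
    · exact h.holder n hn y (hsU hy) y' hy'
    · have far : L ≤ ‖y - y'‖ := by
        by_contra! hlt
        exact hy' (hs y hy (by rwa [Metric.mem_ball, dist_comm, dist_eq_norm]))
      rw [hz n y' (fun hh => hy' (hsU hh)), sub_zero]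
      have e : 1 ≤ (‖y - y'‖ / L) ^ δ := Real.one_le_rpow (by rwa [le_div_iff₀ hL, one_mul]) hδ
      calc _ ≤ A / L ^ n * 1 := by rw [mul_one]; exact h.bound n hn y (hsU hy)
        _ ≤ _ := by gcongr
  refine ⟨contDiffOn_univ.mpr (contDiff_iff_contDiffAt.mpr fun y => ?_), fun n hn y _ => ?_,
    fun n hn y _ y' _ => ?_⟩
  · by_cases hy : y ∈ tsupport φ
    · exact h.contDiffOn.contDiffAt (hU.mem_nhds (hsU hy))
    · have : φ =ᶠ[nhds y] fun _ => 0 := notMem_tsupport_iff_eventuallyEq.mp hy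
      exact contDiffAt_const.congr_of_eventuallyEq this
  · by_cases hy : y ∈ tsupport φ
    · exact h.bound n hn y (hsU hy)
    · rw [hz n y hy, norm_zero]; positivity
  · by_cases hy : y ∈ tsupport φ
    · exact main n hn y hy y'
    · by_cases hy' : y' ∈ tsupport φ
      · rw [norm_sub_rev, norm_sub_rev y]; exact main n hn y' hy' y
      · rw [hz n y hy, hz n y' hy', sub_zero, norm_zero]; positivity

/-- Rescaling a function that is smooth at scale `1`. -/
theorem comp_affine (h : SmoothAtScale m δ 1 A Set.univ φ) (hL : 0 < L) (c : Space d) :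
    SmoothAtScale m δ L A Set.univ (fun y => φ (L⁻¹ • (y - c))) := by
  have hφ : ContDiff ℝ m φ := contDiffOn_univ.mp h.contDiffOn
  have key : ∀ n ≤ m, ∀ y, iteratedFDeriv ℝ n (fun y => φ (L⁻¹ • (y - c))) y =
      (L⁻¹) ^ n • iteratedFDeriv ℝ n φ (L⁻¹ • (y - c)) := by
    intro n hn y
    rw [iteratedFDeriv_comp_sub n c (f := fun y => φ (L⁻¹ • y)),
      iteratedFDeriv_comp_const_smul _ (hφ.of_le (by exact_mod_cast hn))]
  have e : ∀ n, ‖(L⁻¹ : ℝ) ^ n‖ = 1 / L ^ n := fun n => by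
    rw [Real.norm_of_nonneg (by positivity), inv_pow, one_div]
  refine ⟨?_, fun n hn y _ => ?_, fun n hn y _ y' _ => ?_⟩
  · rw [contDiffOn_univ]; exact hφ.comp (by fun_prop)
  · rw [key n hn, norm_smul, e]
    have := h.bound n hn (L⁻¹ • (y - c)) (Set.mem_univ _)
    simp only [one_pow, div_one] at this
    calc _ ≤ 1 / L ^ n * A := by gcongr
      _ = _ := by ring
  · rw [key n hn, key n hn, ← smul_sub, norm_smul, e]
    have := h.holder n hn (L⁻¹ • (y - c)) (Set.mem_univ _) (L⁻¹ • (y' - c)) (Set.mem_univ _)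
    rw [← smul_sub, norm_smul, Real.norm_of_nonneg (by positivity : (0:ℝ) ≤ L⁻¹)] at this
    simp only [one_pow, div_one, sub_sub_sub_cancel_right] at this
    calc _ ≤ 1 / L ^ n * (A * (L⁻¹ * ‖y - y'‖) ^ δ) := by gcongr
      _ = _ := by rw [inv_mul_eq_div]; ring

end SmoothAtScale

/-- A compactly supported smooth function is smooth at scale `1` with some height. -/
theorem exists_smoothAtScale_one (hδ : 0 ≤ δ) (hδ1 : δ ≤ 1) (hφ : ContDiff ℝ (m + 1 : ℕ) φ)
    (hs : HasCompactSupport φ) : ∃ A : ℝ, 1 ≤ A ∧ SmoothAtScale m δ 1 A Set.univ φ := by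
  have hb : ∀ n ≤ m + 1, ∃ C : ℝ, ∀ y, ‖iteratedFDeriv ℝ n φ y‖ ≤ C := fun n hn =>
    (hs.iteratedFDeriv (𝕜 := ℝ) n).exists_bound_of_continuous
      (hφ.continuous_iteratedFDeriv (by exact_mod_cast hn))
  choose! C hC using hb
  set A : ℝ := 1 + ∑ n ∈ Finset.range (m + 2), |C n| with hA
  have hCA : ∀ n ≤ m + 1, C n ≤ A := fun n hn => by
    have := Finset.single_le_sum (f := fun n => |C n|) (fun i _ => abs_nonneg _)
      (Finset.mem_range.mpr (by omega : n < m + 2))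
    have := le_abs_self (C n)
    simp only [hA]; linarith
  have hA1 : 1 ≤ A := by
    have : 0 ≤ ∑ n ∈ Finset.range (m + 2), |C n| := Finset.sum_nonneg fun i _ => abs_nonneg _
    linarith
  refine ⟨2 * (2 * A), by linarith, SmoothAtScale.of_convex isOpen_univ convex_univ one_pos hδ hδ1
    (hφ.of_le (by norm_cast; omega)).contDiffOn (fun n hn y _ => ?_) (fun y _ y' _ => ?_)⟩
  · simpa using ((hC n (by omega) y).trans (hCA n (by omega))).trans (by linarith)
  · simp only [one_pow, div_one]
    rcases le_or_gt 1 ‖y - y'‖ with hbig | hsmall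
    · have e : 1 ≤ ‖y - y'‖ ^ δ := Real.one_le_rpow hbig hδ
      calc _ ≤ A + A := (norm_sub_le _ _).trans (add_le_add
              ((hC m (by omega) y).trans (hCA m (by omega)))
              ((hC m (by omega) y').trans (hCA m (by omega))))
        _ = 2 * A * 1 := by ring
        _ ≤ _ := by gcongr
    · have hd : ∀ x ∈ Set.univ, DifferentiableAt ℝ (iteratedFDeriv ℝ m φ) x := fun x hx =>
        hφ.contDiffAt.differentiableAt_iteratedFDeriv (by exact_mod_cast Nat.lt_succ_self m)
      have hb : ∀ x ∈ Set.univ, ‖fderiv ℝ (iteratedFDeriv ℝ m φ) x‖ ≤ A := fun x hx => by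
        rw [norm_fderiv_iteratedFDeriv]
        exact (hC (m + 1) le_rfl x).trans (hCA (m + 1) le_rfl)
      have mv := convex_univ.norm_image_sub_le_of_norm_fderiv_le hd hb (Set.mem_univ y')
        (Set.mem_univ y)
      refine mv.trans ?_
      have e : ‖y - y'‖ ≤ ‖y - y'‖ ^ δ := by
        have := Real.rpow_le_rpow_of_exponent_ge' (norm_nonneg _) hsmall.le hδ hδ1
        simpa using this
      calc A * ‖y - y'‖ ≤ A * ‖y - y'‖ ^ δ := by gcongr
        _ ≤ _ := by gcongr; linarith

end CancellativeSparse

/-! ### Kernel estimates -/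

namespace CancellativeSparse

/-- A multilinear form is bounded by its values on tuples of basis vectors. -/
theorem norm_multilinear_le_of_basis {d n : ℕ}
    (f : ContinuousMultilinearMap ℝ (fun _ : Fin n => Space d) ℝ) {C : ℝ}
    (h : ∀ i : Fin n → Fin d, |f (fun j => EuclideanSpace.single (i j) (1 : ℝ))| ≤ C)
    (hC : 0 ≤ C) : ‖f‖ ≤ d ^ n * C := by
  refine ContinuousMultilinearMap.opNorm_le_bound (by positivity) fun v => ?_
  have hv : v = fun j => ∑ i : Fin d, (v j i) • EuclideanSpace.single i (1 : ℝ) := by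
    ext j k
    simp [Finset.sum_apply, Pi.single_apply]
  have e : f v = ∑ r : Fin n → Fin d,
      (∏ j, v j (r j)) * f (fun j => EuclideanSpace.single (r j) (1 : ℝ)) := by
    conv_lhs => rw [hv]
    rw [ContinuousMultilinearMap.map_sum]
    refine Finset.sum_congr rfl fun r _ => ?_
    rw [ContinuousMultilinearMap.map_smul_univ, smul_eq_mul]
  rw [e]
  calc ‖_‖ ≤ ∑ r : Fin n → Fin d, (∏ j, ‖v j‖) * C := by
        refine norm_sum_le_of_le _ fun r _ => ?_
        rw [norm_mul, norm_prod]
        refine mul_le_mul (Finset.prod_le_prod (fun _ _ => norm_nonneg _) fun j _ => ?_) (h r)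
          (norm_nonneg _) (by positivity)
        exact EuclideanSpace.norm_eq (v j) ▸ by
          rw [Real.norm_eq_abs, ← Real.sqrt_sq_eq_abs]
          refine Real.sqrt_le_sqrt ?_
          have := Finset.single_le_sum (f := fun i => ‖v j i‖ ^ 2) (fun i _ => by positivity)
            (Finset.mem_univ (r j))
          simpa using this
    _ = d ^ n * C * ∏ j, ‖v j‖ := by
        simp [Finset.sum_const, Finset.card_univ]; ring

/-- The profile of decay, at the distance `‖x - y‖`, of the action of a kernel on a cancellative
function living at the scale `t` near `y`. -/
noncomputable def decay {d : ℕ} (δ t : ℝ) (x y : Space d) : ℝ := (t / (t + ‖x - y‖)) ^ ((d : ℝ) + δ)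

theorem decay_nonneg {d : ℕ} {δ t : ℝ} (ht : 0 ≤ t) (x y : Space d) : 0 ≤ decay δ t x y := by
  unfold decay; positivity

theorem decay_le_mul_decay {d : ℕ} {δ t t' c : ℝ} {x y x' y' : Space d} (ht : 0 < t)
    (ht' : 0 < t') (hδ : 0 ≤ δ) (hδ1 : δ ≤ 1) (hc : 1 ≤ c)
    (h : t * (t' + ‖x' - y'‖) ≤ c * (t' * (t + ‖x - y‖))) :
    decay δ t x y ≤ c ^ (d + 1) * decay δ t' x' y' := by
  unfold decay
  have e : t / (t + ‖x - y‖) ≤ c * (t' / (t' + ‖x' - y'‖)) := by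
    rw [← mul_div_assoc, div_le_div_iff₀ (by positivity) (by positivity)]
    linarith
  calc _ ≤ (c * (t' / (t' + ‖x' - y'‖))) ^ ((d : ℝ) + δ) := by gcongr
    _ = c ^ ((d : ℝ) + δ) * (t' / (t' + ‖x' - y'‖)) ^ ((d : ℝ) + δ) := by
        rw [Real.mul_rpow (by linarith) (by positivity)]
    _ ≤ c ^ (((d + 1 : ℕ)) : ℝ) * (t' / (t' + ‖x' - y'‖)) ^ ((d : ℝ) + δ) := by
        gcongr
        push_cast; linarith
    _ = _ := by rw [Real.rpow_natCast]

namespace IsSmoothKernel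

variable {d : ℕ} {s C : ℝ} {K : Space d → Space d → ℝ}

theorem abs_le (hK : IsSmoothKernel s K C) {x y : Space d} (h : x ≠ y) :
    |K x y| ≤ C / ‖x - y‖ ^ d := by
  have := hK.size 0 (Nat.zero_le _) Fin.elim0 x y h
  simpa [partialDeriv] using this

theorem norm_iteratedFDeriv_le (hC : 0 ≤ C) (hK : IsSmoothKernel s K C) {n : ℕ}
    (hn : n ≤ intPart s) {x y : Space d} (h : x ≠ y) :
    ‖iteratedFDeriv ℝ n (K x) y‖ ≤ d ^ n * (C / ‖x - y‖ ^ (d + n)) :=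
  norm_multilinear_le_of_basis _ (fun i => hK.size n hn i x y h) (by positivity)

theorem norm_iteratedFDeriv_sub_le (hC : 0 ≤ C) (hK : IsSmoothKernel s K C) {x y y' : Space d}
    (h : x ≠ y) (hy : ‖y' - y‖ ≤ ‖x - y‖ / 2) :
    ‖iteratedFDeriv ℝ (intPart s) (K x) y - iteratedFDeriv ℝ (intPart s) (K x) y'‖ ≤
      d ^ intPart s * (C * ‖y' - y‖ ^ holderPart s / ‖x - y‖ ^ ((d : ℝ) + s)) := by
  refine norm_multilinear_le_of_basis _ (fun i => ?_) (by positivity)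
  have := hK.holder_right i x y (y' - y) h hy
  rwa [add_sub_cancel] at this

/-- Away from the diagonal, subtracting the value of the kernel at the center of a ball gains
the factor `(l / ‖x - y₀‖) ^ δ` in all the bounds at scale `l`. -/
theorem smoothAtScale_sub (hs : 0 < s) (hd : 0 < d) (hC : 0 ≤ C) (hK : IsSmoothKernel s K C)
    {x y₀ : Space d} {l : ℝ} (hl : 0 < l) (h : 19 * d * l ≤ ‖x - y₀‖) :
    SmoothAtScale (intPart s) (holderPart s) l
      (2 * (C * (2 * d) ^ (d + intPart s + 2) *
        ((l / ‖x - y₀‖) ^ holderPart s / ‖x - y₀‖ ^ d)))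
      (Metric.ball y₀ (2 * d * l)) (fun y => K x y - K x y₀) := by
  obtain ⟨hms, hδ, hδ1⟩ := holderPart_mem hs
  set m := intPart s
  set δ := holderPart s
  set r := ‖x - y₀‖ with hr
  have hd1 : (1 : ℝ) ≤ d := by exact_mod_cast hd
  have hdl : l ≤ d * l := by nlinarith
  have hr0 : 0 < r := by nlinarith
  have hlr : l / r ≤ 1 := by rw [div_le_one hr0]; nlinarith
  set U := Metric.ball y₀ (2 * d * l) with hU
  have hUo : IsOpen U := Metric.isOpen_ball
  have hUc : Convex ℝ U := convex_ball _ _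
  have hdist : ∀ y ∈ U, r / 2 ≤ ‖x - y‖ ∧ 17 * d * l ≤ ‖x - y‖ := by
    intro y hy
    rw [hU, Metric.mem_ball, dist_eq_norm] at hy
    have : r ≤ ‖x - y‖ + ‖y - y₀‖ := by
      rw [hr]; simpa using norm_add_le (x - y) (y - y₀)
    constructor <;> nlinarith
  have hne : ∀ y ∈ U, x ≠ y := by
    rintro y hy rfl
    have := (hdist _ hy).1
    simp only [sub_self, norm_zero] at this
    linarith
  have hKs : ContDiffOn ℝ m (K x) U :=
    (hK.contDiffOn x).mono fun y hy => (hne y hy).symm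
  have hD : ∀ n ≤ m, ∀ y ∈ U, iteratedFDeriv ℝ n (fun y => K x y - K x y₀) y =
      iteratedFDeriv ℝ n (K x) y - iteratedFDeriv ℝ n (fun _ => K x y₀) y := by
    intro n hn y hy
    exact fun_iteratedFDeriv_sub_apply
      ((hKs.contDiffAt (hUo.mem_nhds hy)).of_le (by exact_mod_cast hn)) contDiffAt_const
  have h2d : (1 : ℝ) ≤ 2 * d := by linarith
  set D : ℝ := (2 * d) ^ (d + m + 2) with hDdef
  have hbase : ∀ n ≤ m, ∀ y ∈ U, ‖iteratedFDeriv ℝ n (K x) y‖ ≤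
      C * (2 * d) ^ (d + n) * ((l / r) ^ n / r ^ d) / l ^ n := by
    intro n hn y hy
    refine (hK.norm_iteratedFDeriv_le hC hn (hne y hy)).trans ?_
    calc _ ≤ (d : ℝ) ^ n * (C / (r / 2) ^ (d + n)) := by
          gcongr; exact (hdist y hy).1
      _ = C * (2 ^ (d + n) * d ^ n) * ((l / r) ^ n / r ^ d) / l ^ n := by
          rw [div_pow, div_pow]; field_simp; ring
      _ ≤ _ := by
          rw [mul_pow]
          gcongr
          omega
  refine SmoothAtScale.of_convex hUo hUc hl hδ.le hδ1 (hKs.sub contDiffOn_const) ?_ ?_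
  · intro n hn y hy
    rcases Nat.eq_zero_or_pos n with rfl | hpos
    · rw [norm_iteratedFDeriv_zero, pow_zero, div_one, Real.norm_eq_abs]
      have hyl : ‖y - y₀‖ ≤ 2 * d * l := by
        rw [hU, Metric.mem_ball, dist_eq_norm] at hy; exact hy.le
      rcases Nat.eq_zero_or_pos m with hm0 | hm1
      · have hs0 : s = δ := by rw [← hms, hm0]; simp
        have := hK.norm_iteratedFDeriv_sub_le hC (x := x) (y := y₀) (y' := y)
          (hne y₀ (Metric.mem_ball_self (by positivity))) (by nlinarith)
        change ‖iteratedFDeriv ℝ m (K x) y₀ - iteratedFDeriv ℝ m (K x) y‖ ≤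
          (d : ℝ) ^ m * (C * ‖y - y₀‖ ^ δ / r ^ ((d : ℝ) + s)) at this
        have e0 : |K x y - K x y₀| ≤
            ‖iteratedFDeriv ℝ m (K x) y₀ - iteratedFDeriv ℝ m (K x) y‖ := by
          have := (iteratedFDeriv ℝ m (K x) y₀ - iteratedFDeriv ℝ m (K x) y).le_opNorm
            (fun _ => 0)
          rw [hm0] at this ⊢
          simpa [abs_sub_comm] using this
        refine (e0.trans this).trans ?_
        rw [hm0, pow_zero, one_mul, hs0, Real.rpow_add hr0, Real.rpow_natCast,
          Real.div_rpow hl.le hr0.le]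
        calc C * ‖y - y₀‖ ^ δ / (r ^ d * r ^ δ) ≤ C * (2 * d * l) ^ δ / (r ^ d * r ^ δ) := by
              gcongr
          _ = C * (2 * d) ^ δ * (l ^ δ / r ^ δ / r ^ d) := by
              rw [Real.mul_rpow (by positivity) hl.le]; field_simp
          _ ≤ C * D * (l ^ δ / r ^ δ / r ^ d) := by
              gcongr
              calc (2 * d : ℝ) ^ δ ≤ (2 * d : ℝ) ^ ((d + m + 2 : ℕ) : ℝ) :=
                    Real.rpow_le_rpow_of_exponent_le h2d (by push_cast; linarith)
                _ = D := Real.rpow_natCast _ _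
      · have mv := hUc.norm_image_sub_le_of_norm_fderiv_le (f := K x) (𝕜 := ℝ) (x := y₀) (y := y)
          (C := C * (2 * d) ^ (d + 1) * ((l / r) ^ 1 / r ^ d) / l ^ 1)
          (fun z hz => (hKs.contDiffAt (hUo.mem_nhds hz)).differentiableAt
            (by exact_mod_cast hm1.ne'))
          (fun z hz => by
            rw [← norm_iteratedFDeriv_one]
            exact hbase 1 hm1 z hz)
          (Metric.mem_ball_self (by positivity)) hy
        refine mv.trans ?_
        have e1 : l / r ≤ (l / r) ^ δ := by
          have := Real.rpow_le_rpow_of_exponent_ge' (by positivity) hlr hδ.le hδ1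
          simpa using this
        calc _ ≤ C * (2 * d) ^ (d + 1) * ((l / r) ^ 1 / r ^ d) / l ^ 1 * (2 * d * l) := by gcongr
          _ = C * (2 * d) ^ (d + 2) * (l / r / r ^ d) := by rw [pow_succ _ (d + 1)]; field_simp
          _ ≤ C * D * ((l / r) ^ δ / r ^ d) := by
            gcongr
            exact pow_le_pow_right₀ h2d (by omega)
    · have hz : iteratedFDeriv ℝ n (fun _ : Space d => K x y₀) y = 0 := by
        rw [iteratedFDeriv_const_of_ne hpos.ne']; rfl
      rw [hD n hn y hy, hz, sub_zero]
      refine (hbase n hn y hy).trans ?_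
      have e1 : (l / r) ^ n ≤ (l / r) ^ δ := by
        rw [← Real.rpow_natCast]
        refine Real.rpow_le_rpow_of_exponent_ge' (by positivity) hlr hδ.le ?_
        exact hδ1.trans (by exact_mod_cast hpos)
      gcongr
      exact pow_le_pow_right₀ h2d (by omega)
  · intro y hy y' hy'
    have hc : iteratedFDeriv ℝ m (fun _ : Space d => K x y₀) y =
        iteratedFDeriv ℝ m (fun _ : Space d => K x y₀) y' := by
      rcases Nat.eq_zero_or_pos m with hm0 | hm1
      · rw [hm0]; ext v; simp
      · rw [iteratedFDeriv_const_of_ne hm1.ne']; rfl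
    rw [hD m le_rfl y hy, hD m le_rfl y' hy', hc, sub_sub_sub_cancel_right]
    have hyy : ‖y' - y‖ ≤ ‖x - y‖ / 2 := by
      have a1 : ‖y' - y₀‖ < 2 * d * l := by rw [← dist_eq_norm]; exact hy'
      have a2 : ‖y - y₀‖ < 2 * d * l := by rw [← dist_eq_norm]; exact hy
      have a3 : ‖y' - y‖ ≤ ‖y' - y₀‖ + ‖y - y₀‖ := by
        simpa using norm_sub_le (y' - y₀) (y - y₀)
      have := (hdist y hy).2
      linarith
    refine (hK.norm_iteratedFDeriv_sub_le hC (hne y hy) hyy).trans ?_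
    change (d : ℝ) ^ m * (C * ‖y' - y‖ ^ δ / ‖x - y‖ ^ ((d : ℝ) + s)) ≤ _
    have e2 : (r / 2) ^ ((d : ℝ) + s) ≤ ‖x - y‖ ^ ((d : ℝ) + s) := by
      gcongr; exact (hdist y hy).1
    have e3 : r ^ ((d : ℝ) + s) / 2 ^ (d + m + 1) ≤ (r / 2) ^ ((d : ℝ) + s) := by
      rw [Real.div_rpow hr0.le (by norm_num)]
      gcongr
      rw [← Real.rpow_natCast]
      refine Real.rpow_le_rpow_of_exponent_le (by norm_num) ?_
      push_cast; linarith
    have e4 : r ^ ((d : ℝ) + s) = r ^ d * r ^ m * r ^ δ := by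
      rw [← hms, Real.rpow_add hr0, Real.rpow_add hr0, Real.rpow_natCast, Real.rpow_natCast]; ring
    rw [norm_sub_rev y y']
    calc _ ≤ (d : ℝ) ^ m * (C * ‖y' - y‖ ^ δ / (r ^ ((d : ℝ) + s) / 2 ^ (d + m + 1))) := by
          have := e3.trans e2
          gcongr
      _ = C * (2 ^ (d + m + 1) * d ^ m) * ((l / r) ^ δ / r ^ d) * (1 / r ^ m)
            * (‖y' - y‖ / l) ^ δ := by
          rw [e4, Real.div_rpow hl.le hr0.le, Real.div_rpow (norm_nonneg _) hl.le]
          field_simp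
      _ ≤ C * D * ((l / r) ^ δ / r ^ d) * (1 / l ^ m) * (‖y' - y‖ / l) ^ δ := by
          have : l ≤ r := (div_le_one hr0).mp hlr
          gcongr
          rw [hDdef, mul_pow]
          gcongr
          · norm_num
          · omega
          · omega
      _ = _ := by ring

/-- Continuity of the kernel in the first variable, in a form that also covers points at a
distance comparable with the displacement. -/
theorem abs_sub_left_le (hs : 0 < s) (hC : 0 ≤ C) (hK : IsSmoothKernel s K C)
    {x x' y : Space d} {t c : ℝ} (ht : 0 < t) (hc : 1 ≤ c) (hxx : ‖x' - x‖ ≤ t)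
    (hx : t ≤ c * ‖x - y‖) (hx' : t ≤ c * ‖x' - y‖) :
    |K x y - K x' y| ≤ 2 * C * c ^ d * 3 ^ (d + 1) / t ^ d * decay (holderPart s) t x y := by
  obtain ⟨hms, hδ, hδ1⟩ := holderPart_mem hs
  set δ := holderPart s
  have hr0 : 0 < ‖x - y‖ := by by_contra! h; nlinarith [norm_nonneg (x - y)]
  have hr0' : 0 < ‖x' - y‖ := by by_contra! h; nlinarith [norm_nonneg (x' - y)]
  have hne : x ≠ y := by rintro rfl; simp at hr0
  have hne' : x' ≠ y := by rintro rfl; simp at hr0'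
  have hc0 : (0 : ℝ) < c := by linarith
  rcases le_or_gt (2 * t) ‖x - y‖ with hfar | hnear
  · have := hK.holder_left 0 (Nat.zero_le _) Fin.elim0 x y (x' - x) hne (by linarith)
    simp only [partialDeriv, iteratedFDeriv_zero_apply, add_sub_cancel, Nat.cast_zero,
      add_zero] at this
    have hdec : (t / ‖x - y‖) ^ ((d : ℝ) + δ) ≤ 3 ^ (d + 1) * decay δ t x y := by
      unfold decay
      calc _ ≤ (3 * (t / (t + ‖x - y‖))) ^ ((d : ℝ) + δ) := by
            gcongr
            rw [← mul_div_assoc, div_le_div_iff₀ hr0 (by positivity)]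
            nlinarith
        _ = 3 ^ ((d : ℝ) + δ) * (t / (t + ‖x - y‖)) ^ ((d : ℝ) + δ) := by
            rw [Real.mul_rpow (by norm_num) (by positivity)]
        _ ≤ 3 ^ (((d + 1 : ℕ)) : ℝ) * (t / (t + ‖x - y‖)) ^ ((d : ℝ) + δ) := by
            gcongr
            · norm_num
            · push_cast; linarith
        _ = _ := by rw [Real.rpow_natCast]
    have hcd : 1 ≤ c ^ d := one_le_pow₀ hc
    calc _ ≤ C * ‖x' - x‖ ^ δ / ‖x - y‖ ^ ((d : ℝ) + δ) := this
      _ ≤ C * t ^ δ / ‖x - y‖ ^ ((d : ℝ) + δ) := by gcongr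
      _ = C / t ^ d * (t / ‖x - y‖) ^ ((d : ℝ) + δ) := by
          rw [Real.div_rpow ht.le hr0.le, Real.rpow_add ht, Real.rpow_natCast]; field_simp
      _ ≤ C / t ^ d * (3 ^ (d + 1) * decay δ t x y) := by gcongr
      _ = 1 * C * 1 * 3 ^ (d + 1) / t ^ d * decay δ t x y := by ring
      _ ≤ _ := by
          have := decay_nonneg (δ := δ) ht.le x y
          gcongr; norm_num
  · have b1 : |K x y| ≤ C * c ^ d / t ^ d := by
      refine (hK.abs_le hne).trans ?_
      rw [mul_div_assoc, ← div_pow, div_eq_mul_inv, ← inv_pow]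
      gcongr
      rw [inv_eq_one_div, div_le_div_iff₀ hr0 ht]; linarith
    have b2 : |K x' y| ≤ C * c ^ d / t ^ d := by
      refine (hK.abs_le hne').trans ?_
      rw [mul_div_assoc, ← div_pow, div_eq_mul_inv, ← inv_pow]
      gcongr
      rw [inv_eq_one_div, div_le_div_iff₀ hr0' ht]; linarith
    have hdec : 1 ≤ 3 ^ (d + 1) * decay δ t x y := by
      unfold decay
      calc (1 : ℝ) ≤ (3 * (t / (t + ‖x - y‖))) ^ ((d : ℝ) + δ) := by
            refine Real.one_le_rpow ?_ (by positivity)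
            rw [← mul_div_assoc, le_div_iff₀ (by positivity)]; linarith
        _ = 3 ^ ((d : ℝ) + δ) * (t / (t + ‖x - y‖)) ^ ((d : ℝ) + δ) := by
            rw [Real.mul_rpow (by norm_num) (by positivity)]
        _ ≤ 3 ^ (((d + 1 : ℕ)) : ℝ) * (t / (t + ‖x - y‖)) ^ ((d : ℝ) + δ) := by
            gcongr
            · norm_num
            · push_cast; linarith
        _ = _ := by rw [Real.rpow_natCast]
    calc _ ≤ |K x y| + |K x' y| := abs_sub _ _
      _ ≤ 2 * C * c ^ d / t ^ d * 1 := by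
          rw [mul_one]
          calc _ ≤ C * c ^ d / t ^ d + C * c ^ d / t ^ d := add_le_add b1 b2
            _ = _ := by ring
      _ ≤ 2 * C * c ^ d / t ^ d * (3 ^ (d + 1) * decay δ t x y) := by gcongr
      _ = _ := by ring

end IsSmoothKernel

end CancellativeSparse

/-! ### Geometry of cubes -/

namespace CancellativeSparse

variable {d : ℕ}

theorem abs_apply_le_norm (x : Space d) (i : Fin d) : |x i| ≤ ‖x‖ := by
  simpa using PiLp.norm_apply_le x i

theorem norm_le_of_abs_apply_le {x : Space d} {a : ℝ} (ha : 0 ≤ a) (h : ∀ i, |x i| ≤ a) :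
    ‖x‖ ≤ d * a := by
  rw [EuclideanSpace.norm_eq]
  have h1 : ∑ i, ‖x i‖ ^ 2 ≤ (d * a) ^ 2 := by
    calc ∑ i, ‖x i‖ ^ 2 ≤ ∑ _i : Fin d, a ^ 2 := by
          refine Finset.sum_le_sum fun i _ => ?_
          have := h i
          rw [Real.norm_eq_abs]; gcongr
      _ = d * a ^ 2 := by simp
      _ ≤ _ := by
          rcases Nat.eq_zero_or_pos d with rfl | hd
          · simp
          · have : (1 : ℝ) ≤ d := by exact_mod_cast hd
            have h2 : (d : ℝ) ≤ d ^ 2 := by nlinarith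
            rw [mul_pow]; gcongr
  calc _ ≤ √((d * a) ^ 2) := Real.sqrt_le_sqrt h1
    _ = _ := Real.sqrt_sq (by positivity)

namespace Cube

variable (Q : Cube d)

theorem toSet_eq_preimage : Q.toSet = (WithLp.ofLp : Space d → (Fin d → ℝ)) ⁻¹'
    (Set.univ.pi fun i => Set.Ico (Q.corner i) (Q.corner i + Q.side)) := by
  ext x; simp [Cube.toSet]

theorem measurableSet_toSet : MeasurableSet Q.toSet := by
  rw [toSet_eq_preimage]
  exact (PiLp.volume_preserving_ofLp (Fin d)).measurable
    (MeasurableSet.univ_pi fun i => measurableSet_Ico)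

theorem volume_toSet : volume Q.toSet = ENNReal.ofReal (Q.side ^ d) := by
  rw [toSet_eq_preimage, (PiLp.volume_preserving_ofLp (Fin d)).measure_preimage
    (MeasurableSet.univ_pi fun i => measurableSet_Ico).nullMeasurableSet, Real.volume_pi_Ico]
  simp [ENNReal.ofReal_pow Q.side_pos.le]

theorem volume_toSet_ne_zero : volume Q.toSet ≠ 0 := by
  rw [volume_toSet]
  have := Q.side_pos
  simp only [ne_eq, ENNReal.ofReal_eq_zero, not_le]; positivity

theorem volume_toSet_ne_top : volume Q.toSet ≠ ∞ := by
  rw [volume_toSet]; exact ENNReal.ofReal_ne_top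

variable {Q}

theorem norm_sub_le {x y : Space d} (hx : x ∈ Q.toSet) (hy : y ∈ Q.toSet) :
    ‖x - y‖ ≤ d * Q.side := by
  refine norm_le_of_abs_apply_le Q.side_pos.le fun i => ?_
  have h1 := hx i
  have h2 := hy i
  rw [PiLp.sub_apply, abs_le]
  constructor <;> linarith

theorem mem_triple {y : Space d} : y ∈ Q.triple.toSet ↔
    ∀ i, Q.corner i - Q.side ≤ y i ∧ y i < Q.corner i + 2 * Q.side := by
  simp only [Cube.toSet, Cube.triple, Set.mem_ofPred_eq]
  refine forall_congr' fun i => and_congr_right fun _ => ?_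
  constructor <;> intro h <;> linarith

theorem mem_triple_of_norm_sub_lt {z y : Space d} (hz : z ∈ Q.toSet) (h : ‖y - z‖ < Q.side) :
    y ∈ Q.triple.toSet := by
  rw [mem_triple]
  intro i
  have h1 := (abs_apply_le_norm (y - z) i).trans_lt h
  rw [PiLp.sub_apply, abs_lt] at h1
  have h2 := hz i
  constructor <;> linarith

theorem toSet_subset_triple : Q.toSet ⊆ Q.triple.toSet := fun z hz =>
  mem_triple_of_norm_sub_lt hz (by simpa using Q.side_pos)

/-- Inside a cube `W`, the part of `W` at distance at most `t` from a point of `W` is contained in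
a subcube of `W` of side at most `4t`. -/
theorem exists_subcube (W : Cube d) {z : Space d} (hz : z ∈ W.toSet) {t : ℝ} (ht : 0 < t) :
    ∃ R : Cube d, R.toSet ⊆ W.toSet ∧ z ∈ R.toSet ∧ R.side ≤ 4 * t ∧
      ∀ y ∈ W.toSet, ‖y - z‖ ≤ t → y ∈ R.toSet := by
  rcases le_or_gt W.side (4 * t) with hbig | hsmall
  · exact ⟨W, subset_rfl, hz, hbig, fun y hy _ => hy⟩
  · -- translate the cube of side `4t` centered at `z` into `W`
    set c : Space d := WithLp.toLp 2
      (fun i => max (W.corner i) (min (z i - 2 * t) (W.corner i + W.side - 4 * t))) with hc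
    have hci : ∀ i, c i = max (W.corner i) (min (z i - 2 * t) (W.corner i + W.side - 4 * t)) :=
      fun i => rfl
    have key : ∀ y ∈ W.toSet, ‖y - z‖ ≤ t → ∀ i, c i ≤ y i ∧ y i < c i + 4 * t := by
      intro y hy hyz i
      have h1 := (abs_apply_le_norm (y - z) i).trans hyz
      rw [PiLp.sub_apply, abs_le] at h1
      have h2 := hy i
      have h3 := hz i
      rw [hci]
      rcases max_cases (W.corner i) (min (z i - 2 * t) (W.corner i + W.side - 4 * t)) with h4 | h4 <;>
      rcases min_cases (z i - 2 * t) (W.corner i + W.side - 4 * t) with h5 | h5 <;>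
      constructor <;> linarith
    refine ⟨⟨c, 4 * t, by linarith⟩, fun y hy i => ?_, key z hz (by simpa using ht.le), le_rfl, key⟩
    have h1 : c i ≤ y i ∧ y i < c i + 4 * t := hy i
    rw [hci] at h1
    rcases max_cases (W.corner i) (min (z i - 2 * t) (W.corner i + W.side - 4 * t)) with h4 | h4 <;>
    rcases min_cases (z i - 2 * t) (W.corner i + W.side - 4 * t) with h5 | h5 <;>
    constructor <;> linarith

end Cube

/-! ### Testing against smooth bumps -/

theorem IsBump.of_smoothAtScale {s : ℝ} (hs : 0 < s) {R : Cube d} {φ : Space d → ℝ}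
    (h : SmoothAtScale (intPart s) (holderPart s) R.side 1 Set.univ φ)
    (hsupp : Function.support φ ⊆ R.toSet) : IsBump s R φ := by
  have hn : ∀ (n : ℕ) (f : ContinuousMultilinearMap ℝ (fun _ : Fin n => Space d) ℝ)
      (i : Fin n → Fin d), |f (fun j => EuclideanSpace.single (i j) (1 : ℝ))| ≤ ‖f‖ := by
    intro n f i
    have := f.le_opNorm (fun j => EuclideanSpace.single (i j) (1 : ℝ))
    simpa using this
  refine ⟨contDiffOn_univ.mp h.contDiffOn, hsupp, fun n hnm i y => ?_, fun i y y' => ?_⟩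
  · exact (hn n _ i).trans (h.bound n hnm y (Set.mem_univ _))
  · have e := h.holder (intPart s) le_rfl y (Set.mem_univ _) y' (Set.mem_univ _)
    have e2 : R.side ^ s = R.side ^ intPart s * R.side ^ holderPart s := by
      conv_lhs => rw [← (holderPart_mem hs).1]
      rw [Real.rpow_add R.side_pos, Real.rpow_natCast]
    rw [Real.div_rpow (norm_nonneg _) R.side_pos.le, div_mul_div_comm, one_mul, ← e2] at e
    exact (hn _ (iteratedFDeriv ℝ (intPart s) φ y - iteratedFDeriv ℝ (intPart s) φ y') i).trans e

/-- At a point where the maximal function is at most `μ`, functions that are smooth at the scale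
`l` and supported at a distance `≲ l` have an integral against `f` of size at most `≲ l ^ d μ`. -/
theorem abs_integral_mul_le_of_smoothMaximal_le {s : ℝ} (hs : 0 < s) {W : Cube d}
    {f φ : Space d → ℝ} {z : Space d} {μ : ℝ≥0} (hz : z ∈ W.toSet)
    (hM : smoothMaximal s W f z ≤ μ) {l A b : ℝ} (hl : 0 < l) (hA : 0 < A) (hb : 1 ≤ b)
    (hφ : SmoothAtScale (intPart s) (holderPart s) l A Set.univ φ)
    (hsW : Function.support φ ⊆ W.toSet) (hsz : ∀ y, φ y ≠ 0 → ‖y - z‖ ≤ b * l) :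
    |∫ y, f y * φ y| ≤ A * (4 * b) ^ (intPart s + 1 + d) * l ^ d * μ := by
  obtain ⟨hms, hδ, hδ1⟩ := holderPart_mem hs
  set m := intPart s
  set δ := holderPart s
  obtain ⟨R, hRW, hzR, hRs, hR⟩ := W.exists_subcube hz (t := b * l) (by positivity)
  set A' := A * (4 * b) ^ (m + 1) with hA'
  have hA'0 : 0 < A' := by positivity
  have h1 : SmoothAtScale m δ R.side A' Set.univ φ :=
    hφ.enlarge_scale R.side_pos (by linarith) (by linarith) hδ.le hδ1
  have h2 : SmoothAtScale m δ R.side 1 Set.univ (fun y => A'⁻¹ * φ y) := by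
    have := h1.const_smul isOpen_univ A'⁻¹
    rwa [abs_of_pos (by positivity), inv_mul_cancel₀ hA'0.ne'] at this
  have hsR : Function.support φ ⊆ R.toSet := fun y hy => hR y (hsW hy) (hsz y hy)
  have hbump : IsBump s R (fun y => A'⁻¹ * φ y) := IsBump.of_smoothAtScale hs h2 fun y hy => hsR (right_ne_zero_of_mul hy)
  have h3 : ‖∫ y in R.toSet, f y * (A'⁻¹ * φ y)‖ₑ / volume R.toSet ≤ μ := by
    refine le_trans ?_ hM
    unfold smoothMaximal
    exact le_iSup_of_le R (le_iSup_of_le hRW (le_iSup_of_le hzR (le_iSup_of_le _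
      (le_iSup_of_le hbump le_rfl))))
  have h4 : ∫ y in R.toSet, f y * (A'⁻¹ * φ y) = A'⁻¹ * ∫ y, f y * φ y := by
    rw [setIntegral_eq_integral_of_forall_compl_eq_zero, ← integral_const_mul]
    · congr 1; ext y; ring
    · intro y hy
      have : φ y = 0 := by by_contra hne; exact hy (hsR hne)
      simp [this]
  rw [h4, ENNReal.div_le_iff R.volume_toSet_ne_zero R.volume_toSet_ne_top, R.volume_toSet,
    Real.enorm_eq_ofReal_abs, ← ENNReal.ofReal_coe_nnreal,
    ← ENNReal.ofReal_mul μ.coe_nonneg, ENNReal.ofReal_le_ofReal_iff (by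
      have := R.side_pos; positivity), abs_mul, abs_of_pos (by positivity : 0 < A'⁻¹),
    inv_mul_le_iff₀ hA'0] at h3
  have hside : R.side ^ d ≤ (4 * b * l) ^ d := by
    have := R.side_pos
    gcongr; linarith
  calc _ ≤ A' * (μ * R.side ^ d) := h3
    _ ≤ A' * (μ * (4 * b * l) ^ d) := by gcongr
    _ = _ := by rw [hA', mul_pow (4 * b) l, pow_add (4 * b) (m + 1) d]; ring

/-- Lebesgue differentiation: `|f| ≲ μ` almost everywhere on the closure of a set where the
maximal function is at most `μ`. -/
theorem exists_forall_ae_abs_le_of_smoothMaximal_le (d : ℕ) {s : ℝ} (hs : 0 < s) :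
    ∃ C : ℝ, 0 < C ∧ ∀ (Q : Cube d) (f : Space d → ℝ) (_ : LocallyIntegrable f volume) (μ : ℝ≥0)
      (F : Set (Space d)) (_ : F ⊆ Q.toSet)
      (_ : ∀ z ∈ F, smoothMaximal s Q.triple f z ≤ μ),
      ∀ᵐ x ∂(volume : Measure (Space d)), x ∈ closure F → |f x| ≤ C * μ := by
  obtain ⟨hms, hδ, hδ1⟩ := holderPart_mem hs
  set Φ : ContDiffBump (0 : Space d) := ⟨1 / 2, 1, by norm_num, by norm_num⟩ with hΦ
  obtain ⟨A, hA1, hA⟩ := exists_smoothAtScale_one (m := intPart s) hδ.le hδ1 (φ := Φ)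
    Φ.contDiff Φ.hasCompactSupport
  have hI : 0 < ∫ y, Φ y := Φ.integral_pos
  set I := ∫ y, Φ y with hIdef
  refine ⟨A * (4 * 2) ^ (intPart s + 1 + d) / I, by positivity, fun Q f hf μ F hFQ hM => ?_⟩
  filter_upwards [IsUnifLocDoublingMeasure.ae_tendsto_average_norm_sub volume hf 1] with x hx hxF
  have hlim := hx (fun _ : ℝ => x) (fun t => t) (l := nhdsWithin 0 (Set.Ioi 0))
    Filter.tendsto_id (by
      filter_upwards [self_mem_nhdsWithin] with t ht
      exact Metric.mem_closedBall_self (by simpa using (le_of_lt ht)))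
  set V := volume.real (Metric.ball (0 : Space d) 1) with hV
  have hlim2 : Filter.Tendsto (fun t : ℝ => A * (4 * 2) ^ (intPart s + 1 + d) * μ + A * V *
      ⨍ y in Metric.closedBall x t, ‖f y - f x‖) (nhdsWithin 0 (Set.Ioi 0))
      (nhds (A * (4 * 2) ^ (intPart s + 1 + d) * μ + A * V * 0)) :=
    (hlim.const_mul _).const_add _
  rw [mul_zero, add_zero] at hlim2
  have hmain : I * |f x| ≤ A * (4 * 2) ^ (intPart s + 1 + d) * μ := by
    refine ge_of_tendsto hlim2 ?_
    filter_upwards [Ioo_mem_nhdsGT (show (0 : ℝ) < Q.side / 4 by have := Q.side_pos; linarith)]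
      with t ht
    obtain ⟨ht0, htQ⟩ := ht
    obtain ⟨z, hzF, hzx⟩ := Metric.mem_closure_iff.mp hxF t ht0
    rw [dist_eq_norm] at hzx
    set φ : Space d → ℝ := fun y => Φ (t⁻¹ • (y - x)) with hφ
    have hφs : SmoothAtScale (intPart s) (holderPart s) t A Set.univ φ := hA.comp_affine ht0 x
    have hsupp : ∀ y, φ y ≠ 0 → ‖y - x‖ ≤ t := by
      intro y hy
      have : t⁻¹ • (y - x) ∈ Function.support Φ := hy
      rw [Φ.support_eq, mem_ball_zero_iff, norm_smul, Real.norm_of_nonneg (by positivity),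
        inv_mul_lt_iff₀ ht0] at this
      have h1 : Φ.rOut = 1 := rfl
      rw [h1] at this
      linarith
    have hsz : ∀ y, φ y ≠ 0 → ‖y - z‖ ≤ 2 * t := fun y hy => by
      have := norm_add_le (y - x) (x - z)
      rw [sub_add_sub_cancel] at this
      linarith [hsupp y hy]
    have p1 := abs_integral_mul_le_of_smoothMaximal_le hs (Q.toSet_subset_triple (hFQ hzF))
      (hM z hzF) ht0 (by linarith) (by norm_num : (1 : ℝ) ≤ 2) hφs
      (fun y hy => Cube.mem_triple_of_norm_sub_lt (hFQ hzF)
        ((hsz y hy).trans_lt (by have := Q.side_pos; linarith))) hsz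
    have hφI : ∫ y, φ y = t ^ d * I := by
      rw [hφ, integral_sub_right_eq_self (fun y => Φ (t⁻¹ • y)) x,
        Measure.integral_comp_inv_smul_of_nonneg _ _ ht0.le]
      simp [hIdef]
    have hφc : Continuous φ := Φ.continuous.comp (by fun_prop)
    have hφcs : HasCompactSupport φ := by
      refine HasCompactSupport.of_support_subset_isCompact (isCompact_closedBall x t) fun y hy => ?_
      rw [Metric.mem_closedBall, dist_eq_norm]; exact hsupp y hy
    have i1 : Integrable (fun y => f y * φ y) := by
      have := hf.integrable_smul_right_of_hasCompactSupport hφc hφcs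
      simpa [mul_comm] using this
    have i2 : Integrable φ := hφc.integrable_of_hasCompactSupport hφcs
    have i3 : IntegrableOn (fun y => ‖f y - f x‖) (Metric.closedBall x t) := by
      refine Integrable.norm ((hf.integrableOn_isCompact (isCompact_closedBall x t)).sub ?_)
      exact integrableOn_const (isCompact_closedBall x t).measure_lt_top.ne
    have p2 : |(∫ y, f y * φ y) - f x * ∫ y, φ y| ≤
        A * (∫ y in Metric.closedBall x t, ‖f y - f x‖) := by
      have hz : ∀ y ∉ Metric.closedBall x t, f y * φ y - f x * φ y = 0 := by
        intro y hy
        have : φ y = 0 := by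
          by_contra hne
          exact hy (by rw [Metric.mem_closedBall, dist_eq_norm]; exact hsupp y hne)
        simp [this]
      rw [← integral_const_mul, ← integral_sub i1 (i2.const_mul _), ← integral_const_mul,
        ← setIntegral_eq_integral_of_forall_compl_eq_zero hz, ← Real.norm_eq_abs]
      refine norm_integral_le_of_norm_le (i3.const_mul A) (Filter.Eventually.of_forall fun y => ?_)
      have := hφs.abs_le (Set.mem_univ y)
      rw [← sub_mul, norm_mul, mul_comm]
      exact mul_le_mul_of_nonneg_right this (norm_nonneg _)
    have p3 : ∫ y in Metric.closedBall x t, ‖f y - f x‖ =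
        t ^ d * V * ⨍ y in Metric.closedBall x t, ‖f y - f x‖ := by
      have hvol : volume.real (Metric.closedBall x t) = t ^ d * V := by
        rw [Measure.addHaar_real_closedBall volume x ht0.le]; simp [hV]
      have hne : volume.real (Metric.closedBall x t) ≠ 0 := by
        rw [Measure.real, ne_eq, ENNReal.toReal_eq_zero_iff, not_or]
        exact ⟨(Metric.measure_closedBall_pos volume x ht0).ne',
          (isCompact_closedBall x t).measure_lt_top.ne⟩
      rw [setAverage_eq, ← hvol, smul_eq_mul, mul_inv_cancel_left₀ hne]
    rw [hφI] at p2
    rw [p3] at p2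
    have htd : 0 < t ^ d := by positivity
    have p4 : |f x| * (t ^ d * I) ≤ A * (4 * 2) ^ (intPart s + 1 + d) * t ^ d * μ +
        A * (t ^ d * V * ⨍ y in Metric.closedBall x t, ‖f y - f x‖) := by
      have e : |f x * (t ^ d * I)| = |f x| * (t ^ d * I) := by
        rw [abs_mul, abs_of_pos (by positivity : 0 < t ^ d * I)]
      rw [← e]
      have := abs_sub_abs_le_abs_sub (f x * (t ^ d * I)) (∫ y, f y * φ y)
      rw [abs_sub_comm] at this
      linarith
    refine le_of_mul_le_mul_left ?_ htd
    calc t ^ d * (I * |f x|) = |f x| * (t ^ d * I) := by ring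
      _ ≤ _ := p4
      _ = _ := by ring
  rw [div_mul_eq_mul_div, le_div_iff₀ hI]
  linarith

end CancellativeSparse

/-! ### Cutoff functions and the grid partitions of unity -/

namespace CancellativeSparse

variable {d : ℕ}

/-- A smooth bump on `ℝ`, equal to `1` on `[-1/2, 3/2]` and supported in `(-3/4, 7/4)`. -/
noncomputable def plateau : ContDiffBump (1 / 2 : ℝ) := ⟨1, 5 / 4, by norm_num, by norm_num⟩

/-- The tensor product of `plateau`. -/
noncomputable def unitCutoff (y : Space d) : ℝ := ∏ i, plateau (y i)

/-- The smooth cutoff adapted to `Q`: equal to `1` on the double of `Q` and supported in the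
interior of `3Q`. -/
noncomputable def Cube.cutoff (Q : Cube d) (y : Space d) : ℝ :=
  unitCutoff (Q.side⁻¹ • (y - Q.corner))

/-- The one-dimensional profile of the partition of unity: nonnegative, supported in `[0, 2]`,
and with integer translates summing to `1`. -/
noncomputable def tent (t : ℝ) : ℝ := Real.smoothTransition t - Real.smoothTransition (t - 1)

/-- The tensor product of `tent`. -/
noncomputable def unitTent (y : Space d) : ℝ := ∏ i, tent (y i)

theorem plateau_ne_zero {t : ℝ} (h : plateau t ≠ 0) : -3 / 4 < t ∧ t < 7 / 4 := by
  have : t ∈ Function.support plateau := h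
  rw [plateau.support_eq, Metric.mem_ball, Real.dist_eq, abs_lt] at this
  have h1 : plateau.rOut = 5 / 4 := rfl
  rw [h1] at this
  constructor <;> linarith

theorem plateau_eq_one {t : ℝ} (h : -1 / 2 ≤ t) (h' : t ≤ 3 / 2) : plateau t = 1 := by
  refine plateau.one_of_mem_closedBall ?_
  have h1 : plateau.rIn = 1 := rfl
  rw [Metric.mem_closedBall, Real.dist_eq, abs_le, h1]
  constructor <;> linarith

theorem tent_nonneg (t : ℝ) : 0 ≤ tent t :=
  sub_nonneg.mpr (Real.smoothTransition.monotone (by linarith))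

theorem tent_ne_zero {t : ℝ} (h : tent t ≠ 0) : 0 < t ∧ t < 2 := by
  by_contra hcon
  rw [not_and_or, not_lt, not_lt] at hcon
  refine h ?_
  unfold tent
  rcases hcon with h1 | h1
  · rw [Real.smoothTransition.zero_of_nonpos h1,
      Real.smoothTransition.zero_of_nonpos (by linarith), sub_self]
  · rw [Real.smoothTransition.one_of_one_le (by linarith),
      Real.smoothTransition.one_of_one_le (by linarith), sub_self]

theorem sum_tent {N : ℕ} {t : ℝ} (h1 : 1 ≤ t) (hN : t ≤ N) :
    ∑ n ∈ Finset.range N, tent (t - n) = 1 := by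
  have e : ∀ n ∈ Finset.range N, tent (t - n) = (fun n : ℕ => Real.smoothTransition (t - n)) n -
      (fun n : ℕ => Real.smoothTransition (t - n)) (n + 1) := by
    intro n _
    simp only [tent, Nat.cast_add, Nat.cast_one, sub_sub]
  rw [Finset.sum_congr rfl e, Finset.sum_range_sub']
  simp only [Nat.cast_zero, sub_zero]
  rw [Real.smoothTransition.one_of_one_le h1, Real.smoothTransition.zero_of_nonpos (by linarith),
    sub_zero]

theorem contDiff_unitCutoff {n : ℕ} : ContDiff ℝ n (unitCutoff (d := d)) :=
  contDiff_prod fun i _ => plateau.contDiff.comp (by fun_prop)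

theorem contDiff_unitTent {n : ℕ} : ContDiff ℝ n (unitTent (d := d)) := by
  refine contDiff_prod fun i _ => ?_
  have : ContDiff ℝ n tent :=
    Real.smoothTransition.contDiff.sub (Real.smoothTransition.contDiff.comp (by fun_prop))
  exact this.comp (by fun_prop)

theorem unitCutoff_ne_zero {y : Space d} (h : unitCutoff y ≠ 0) (i : Fin d) :
    -3 / 4 < y i ∧ y i < 7 / 4 :=
  plateau_ne_zero (Finset.prod_ne_zero_iff.mp h i (Finset.mem_univ i))

theorem unitTent_ne_zero {y : Space d} (h : unitTent y ≠ 0) (i : Fin d) : 0 < y i ∧ y i < 2 :=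
  tent_ne_zero (Finset.prod_ne_zero_iff.mp h i (Finset.mem_univ i))

theorem hasCompactSupport_of_forall_abs_le {φ : Space d → ℝ} {a : ℝ} (ha : 0 ≤ a)
    (h : ∀ y, φ y ≠ 0 → ∀ i, |y i| ≤ a) : HasCompactSupport φ := by
  refine HasCompactSupport.of_support_subset_isCompact
    (isCompact_closedBall (0 : Space d) (d * a)) fun y hy => ?_
  rw [Metric.mem_closedBall, dist_zero_right]
  exact norm_le_of_abs_apply_le ha (h y hy)

/-- The unit profiles are smooth at scale `1`, with a common height. -/
theorem exists_smoothAtScale_profiles (d m : ℕ) {δ : ℝ} (hδ : 0 ≤ δ) (hδ1 : δ ≤ 1) :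
    ∃ A : ℝ, 1 ≤ A ∧ SmoothAtScale m δ 1 A Set.univ (unitCutoff (d := d)) ∧
      SmoothAtScale m δ 1 A Set.univ (unitTent (d := d)) ∧
      SmoothAtScale m δ 1 A Set.univ (fun _ : Space d => (1 : ℝ)) := by
  obtain ⟨A, hA, h1⟩ := exists_smoothAtScale_one (m := m) hδ hδ1 (contDiff_unitCutoff (d := d))
    (hasCompactSupport_of_forall_abs_le (a := 2) (by norm_num) fun y hy i => by
      have := unitCutoff_ne_zero hy i
      rw [abs_le]; constructor <;> linarith)
  obtain ⟨B, hB, h2⟩ := exists_smoothAtScale_one (m := m) hδ hδ1 (contDiff_unitTent (d := d))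
    (hasCompactSupport_of_forall_abs_le (a := 2) (by norm_num) fun y hy i => by
      have := unitTent_ne_zero hy i
      rw [abs_le]; constructor <;> linarith)
  refine ⟨A + B, by linarith, h1.mono_const (by linarith) one_pos,
    h2.mono_const (by linarith) one_pos, contDiffOn_const, fun n _ y _ => ?_, fun n _ y _ y' _ => ?_⟩
  · rcases Nat.eq_zero_or_pos n with rfl | hn
    · simp; linarith
    · rw [iteratedFDeriv_const_of_ne hn.ne']; simp; linarith
  · have : iteratedFDeriv ℝ n (fun _ : Space d => (1 : ℝ)) y =
        iteratedFDeriv ℝ n (fun _ : Space d => (1 : ℝ)) y' := by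
      rcases Nat.eq_zero_or_pos n with rfl | hn
      · ext v; simp
      · rw [iteratedFDeriv_const_of_ne hn.ne']; rfl
    rw [this, sub_self, norm_zero]
    positivity

theorem Cube.cutoff_ne_zero {Q : Cube d} {y : Space d} (h : Q.cutoff y ≠ 0) (i : Fin d) :
    Q.corner i - 3 / 4 * Q.side < y i ∧ y i < Q.corner i + 7 / 4 * Q.side := by
  have := unitCutoff_ne_zero h i
  have hs := Q.side_pos
  simp only [PiLp.smul_apply, PiLp.sub_apply, smul_eq_mul, inv_mul_eq_div] at this
  rw [lt_div_iff₀ hs, div_lt_iff₀ hs] at this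
  constructor <;> linarith

theorem Cube.mem_triple_of_cutoff_ne_zero {Q : Cube d} {y : Space d} (h : Q.cutoff y ≠ 0) :
    y ∈ Q.triple.toSet := by
  rw [Cube.mem_triple]
  intro i
  have := Cube.cutoff_ne_zero h i
  have hs := Q.side_pos
  constructor <;> linarith

theorem Cube.cutoff_eq_one {Q : Cube d} {y : Space d}
    (h : ∀ i, Q.corner i - Q.side / 2 ≤ y i ∧ y i ≤ Q.corner i + 3 / 2 * Q.side) :
    Q.cutoff y = 1 := by
  unfold Cube.cutoff unitCutoff
  refine Finset.prod_eq_one fun i _ => ?_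
  have hs := Q.side_pos
  have := h i
  simp only [PiLp.smul_apply, PiLp.sub_apply, smul_eq_mul, inv_mul_eq_div]
  refine plateau_eq_one ?_ ?_
  · rw [le_div_iff₀ hs]; linarith
  · rw [div_le_iff₀ hs]; linarith

theorem Cube.cutoff_mem_Icc (Q : Cube d) (y : Space d) : 0 ≤ Q.cutoff y ∧ Q.cutoff y ≤ 1 := by
  unfold Cube.cutoff unitCutoff
  exact ⟨Finset.prod_nonneg fun _ _ => plateau.nonneg,
    Finset.prod_le_one (fun _ _ => plateau.nonneg) fun _ _ => plateau.le_one⟩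

theorem Cube.continuous_cutoff (Q : Cube d) : Continuous Q.cutoff :=
  (contDiff_unitCutoff (n := 0)).continuous.comp (by fun_prop)

/-! ### The grids and the Whitney pieces -/

namespace Cube

variable (Q : Cube d)

/-- The side length of the cubes of generation `k`. -/
noncomputable def scale (k : ℕ) : ℝ := Q.side / 2 ^ k

theorem scale_pos (k : ℕ) : 0 < Q.scale k := div_pos Q.side_pos (by positivity)

theorem scale_succ (k : ℕ) : Q.scale (k + 1) = Q.scale k / 2 := by
  unfold scale; rw [pow_succ]; field_simp

theorem scale_le (k : ℕ) : Q.scale k ≤ Q.side :=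
  div_le_self Q.side_pos.le (one_le_pow₀ (by norm_num))

/-- The points of the grid of generation `k` that covers a neighborhood of `3Q`. -/
noncomputable def gridPoint (k : ℕ) (n : Fin d → ℕ) : Space d :=
  WithLp.toLp 2 fun i => Q.corner i - 2 * Q.side + Q.scale k * n i

/-- The center of the support of `Q.gridBump k n`. -/
noncomputable def gridCenter (k : ℕ) (n : Fin d → ℕ) : Space d :=
  WithLp.toLp 2 fun i => Q.corner i - 2 * Q.side + Q.scale k * n i + Q.scale k

/-- The members of the smooth partition of unity of generation `k`. -/
noncomputable def gridBump (k : ℕ) (n : Fin d → ℕ) (y : Space d) : ℝ :=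
  unitTent ((Q.scale k)⁻¹ • (y - Q.gridPoint k n))

/-- The cells of the grid of generation `k`. -/
noncomputable def gridCube (k : ℕ) (n : Fin d → ℕ) : Cube d :=
  ⟨Q.gridPoint k n, Q.scale k, Q.scale_pos k⟩

/-- The indices of the grid of generation `k` that are relevant for `3Q`. -/
def gridBox (d k : ℕ) : Finset (Fin d → ℕ) := Fintype.piFinset fun _ => Finset.range (4 * 2 ^ k)

theorem gridPoint_apply (k : ℕ) (n : Fin d → ℕ) (i : Fin d) :
    Q.gridPoint k n i = Q.corner i - 2 * Q.side + Q.scale k * n i := rfl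

theorem gridCenter_apply (k : ℕ) (n : Fin d → ℕ) (i : Fin d) :
    Q.gridCenter k n i = Q.corner i - 2 * Q.side + Q.scale k * n i + Q.scale k := rfl

theorem gridBump_nonneg (k : ℕ) (n : Fin d → ℕ) (y : Space d) : 0 ≤ Q.gridBump k n y := by
  unfold gridBump unitTent
  exact Finset.prod_nonneg fun _ _ => tent_nonneg _

theorem continuous_gridBump (k : ℕ) (n : Fin d → ℕ) : Continuous (Q.gridBump k n) :=
  (contDiff_unitTent (n := 0)).continuous.comp (by fun_prop)

variable {Q}

theorem gridBump_ne_zero {k : ℕ} {n : Fin d → ℕ} {y : Space d} (h : Q.gridBump k n y ≠ 0)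
    (i : Fin d) : Q.gridPoint k n i < y i ∧ y i < Q.gridPoint k n i + 2 * Q.scale k := by
  have := unitTent_ne_zero h i
  have hs := Q.scale_pos k
  simp only [PiLp.smul_apply, PiLp.sub_apply, smul_eq_mul, inv_mul_eq_div] at this
  rw [lt_div_iff₀ hs, div_lt_iff₀ hs] at this
  constructor <;> linarith

theorem norm_sub_gridCenter_le_of_gridBump_ne_zero {k : ℕ} {n : Fin d → ℕ} {y : Space d}
    (h : Q.gridBump k n y ≠ 0) : ‖y - Q.gridCenter k n‖ ≤ d * Q.scale k := by
  refine norm_le_of_abs_apply_le (Q.scale_pos k).le fun i => ?_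
  have := gridBump_ne_zero h i
  rw [gridPoint_apply] at this
  rw [PiLp.sub_apply, gridCenter_apply, abs_le]
  constructor <;> linarith

theorem norm_sub_gridPoint_le_of_gridBump_ne_zero {k : ℕ} {n : Fin d → ℕ} {y : Space d}
    (h : Q.gridBump k n y ≠ 0) : ‖y - Q.gridPoint k n‖ ≤ d * (2 * Q.scale k) := by
  have hs := Q.scale_pos k
  refine norm_le_of_abs_apply_le (by positivity) fun i => ?_
  have := gridBump_ne_zero h i
  rw [PiLp.sub_apply, abs_le]
  constructor <;> linarith

theorem norm_gridCenter_sub_gridPoint_le (k : ℕ) (n : Fin d → ℕ) :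
    ‖Q.gridCenter k n - Q.gridPoint k n‖ ≤ d * Q.scale k := by
  have hs := Q.scale_pos k
  refine norm_le_of_abs_apply_le hs.le fun i => ?_
  rw [PiLp.sub_apply, gridCenter_apply, gridPoint_apply, add_sub_cancel_left, abs_of_pos hs]

theorem norm_sub_gridCenter_le_of_mem_gridCube {k : ℕ} {n : Fin d → ℕ} {y : Space d}
    (h : y ∈ (Q.gridCube k n).toSet) : ‖y - Q.gridCenter k n‖ ≤ d * Q.scale k := by
  have hs := Q.scale_pos k
  refine norm_le_of_abs_apply_le hs.le fun i => ?_
  have h1 : Q.gridPoint k n i ≤ y i ∧ y i < Q.gridPoint k n i + Q.scale k := h i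
  rw [gridPoint_apply] at h1
  rw [PiLp.sub_apply, gridCenter_apply, abs_le]
  constructor <;> linarith

theorem sum_gridBump (k : ℕ) {y : Space d} (hy : y ∈ Q.triple.toSet) :
    ∑ n ∈ gridBox d k, Q.gridBump k n y = 1 := by
  rw [mem_triple] at hy
  have hs := Q.scale_pos k
  have hQ := Q.side_pos
  have hsQ : Q.scale k * 2 ^ k = Q.side := by unfold scale; field_simp
  have h2 : (1 : ℝ) ≤ 2 ^ k := one_le_pow₀ (by norm_num)
  have e : ∀ n ∈ gridBox d k, Q.gridBump k n y =
      ∏ i, tent ((y i - (Q.corner i - 2 * Q.side)) / Q.scale k - n i) := by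
    intro n _
    unfold gridBump unitTent
    refine Finset.prod_congr rfl fun i _ => ?_
    congr 1
    simp only [PiLp.smul_apply, PiLp.sub_apply, smul_eq_mul, gridPoint_apply]
    field_simp; ring
  rw [Finset.sum_congr rfl e, gridBox, ← Finset.prod_univ_sum (fun _ => Finset.range (4 * 2 ^ k))
    (fun i (n : ℕ) => tent ((y i - (Q.corner i - 2 * Q.side)) / Q.scale k - n))]
  refine Finset.prod_eq_one fun i _ => sum_tent ?_ ?_
  · rw [le_div_iff₀ hs]
    have := (hy i).1
    nlinarith
  · rw [div_le_iff₀ hs]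
    have := (hy i).2
    push_cast
    nlinarith

end Cube

/-- Indices of the pieces: a generation `k`, and grid indices of the generations `k` and
`k + 1`. -/
abbrev PieceIndex (d : ℕ) : Type := Σ _ : ℕ, (Fin d → ℕ) × (Fin d → ℕ)

/-- The grid point `Q.gridPoint k n` is far from `F` relative to the scale of generation `k`. The
constant is so large that being far is inherited by the overlapping bumps of the next generation
(`Cube.FarFrom.succ`), and that no point of generation `0` near `3Q` is far from a set in `Q`. -/
def Cube.FarFrom (Q : Cube d) (F : Set (Space d)) (k : ℕ) (n : Fin d → ℕ) : Prop :=
  128 * d ^ 2 * Q.scale k ≤ Metric.infDist (Q.gridPoint k n) F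

/-- The product of two grid bumps of consecutive generations. -/
noncomputable def Cube.pieceBump (Q : Cube d) (j : PieceIndex d) (y : Space d) : ℝ :=
  Q.gridBump j.1 j.2.1 y * Q.gridBump (j.1 + 1) j.2.2 y

/-- The pieces that make up the Whitney partition of unity of the complement of `F`: generation
`k + 1` sees that the piece is far from `F`, and generation `k` does not. -/
structure Cube.IsWhitney (Q : Cube d) (F : Set (Space d)) (j : PieceIndex d) : Prop where
  mem_fst : j.2.1 ∈ Cube.gridBox d j.1
  mem_snd : j.2.2 ∈ Cube.gridBox d (j.1 + 1)
  not_far : ¬ Q.FarFrom F j.1 j.2.1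
  far : Q.FarFrom F (j.1 + 1) j.2.2
  exists_ne_zero : ∃ y ∈ Q.triple.toSet, Q.pieceBump j y ≠ 0

open Classical in
/-- The Whitney pieces of generation less than `N`. -/
noncomputable def Cube.whitney (Q : Cube d) (F : Set (Space d)) (N : ℕ) : Finset (PieceIndex d) :=
  ((Finset.range N).sigma fun k => Cube.gridBox d k ×ˢ Cube.gridBox d (k + 1)).filter
    fun j => Q.IsWhitney F j

open Classical in
/-- The part of the partition of unity of generation `k` that is far from `F`. -/
noncomputable def Cube.farPart (Q : Cube d) (F : Set (Space d)) (k : ℕ) (y : Space d) : ℝ :=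
  ∑ n ∈ Cube.gridBox d k, if Q.FarFrom F k n then Q.gridBump k n y else 0

namespace Cube

variable {Q : Cube d} {F : Set (Space d)}

theorem IsWhitney.of_mem_whitney {N : ℕ} {j : PieceIndex d} (h : j ∈ Q.whitney F N) :
    Q.IsWhitney F j := by
  classical
  exact (Finset.mem_filter.mp h).2

theorem abs_infDist_sub_infDist_le (x y : Space d) :
    |Metric.infDist x F - Metric.infDist y F| ≤ ‖x - y‖ := by
  rw [abs_le, ← dist_eq_norm]
  have h1 : Metric.infDist x F ≤ Metric.infDist y F + dist x y := Metric.infDist_le_infDist_add_dist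
  have h2 : Metric.infDist y F ≤ Metric.infDist x F + dist y x := Metric.infDist_le_infDist_add_dist
  rw [dist_comm y x] at h2
  constructor <;> linarith

theorem norm_gridCenter_sub_gridPoint_succ_le {k : ℕ} {n n' : Fin d → ℕ} {y : Space d}
    (h : Q.gridBump k n y ≠ 0) (h' : Q.gridBump (k + 1) n' y ≠ 0) :
    ‖Q.gridCenter k n - Q.gridPoint (k + 1) n'‖ ≤ 2 * d * Q.scale k := by
  have h1 := norm_sub_gridCenter_le_of_gridBump_ne_zero h
  have h2 := norm_sub_gridPoint_le_of_gridBump_ne_zero h'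
  rw [Q.scale_succ] at h2
  have h3 := norm_add_le (Q.gridCenter k n - y) (y - Q.gridPoint (k + 1) n')
  rw [sub_add_sub_cancel, norm_sub_rev (Q.gridCenter k n) y] at h3
  linarith

/-- On a Whitney piece, and near it, the distance to `F` is comparable to the scale. -/
theorem IsWhitney.infDist_gridCenter (hd : 0 < d) {j : PieceIndex d} (h : Q.IsWhitney F j) :
    62 * d ^ 2 * Q.scale j.1 ≤ Metric.infDist (Q.gridCenter j.1 j.2.1) F ∧
      Metric.infDist (Q.gridCenter j.1 j.2.1) F ≤ 129 * d ^ 2 * Q.scale j.1 := by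
  obtain ⟨y, _, hy⟩ := h.exists_ne_zero
  have hd1 : (1 : ℝ) ≤ d := by exact_mod_cast hd
  have hs := Q.scale_pos j.1
  have h1 := norm_gridCenter_sub_gridPoint_succ_le (left_ne_zero_of_mul hy)
    (right_ne_zero_of_mul hy)
  have h2 := abs_le.mp ((abs_infDist_sub_infDist_le (F := F) _ _).trans h1)
  have h3 := abs_le.mp ((abs_infDist_sub_infDist_le (F := F) _ _).trans
    (norm_gridCenter_sub_gridPoint_le (Q := Q) j.1 j.2.1))
  have h4 := h.far
  have h5 := h.not_far
  unfold FarFrom at h4 h5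
  rw [Q.scale_succ] at h4
  rw [not_le] at h5
  have h6 : d * Q.scale j.1 ≤ d ^ 2 * Q.scale j.1 := by
    have : (d : ℝ) ≤ d ^ 2 := by nlinarith
    gcongr
  constructor <;> linarith

theorem IsWhitney.infDist_of_norm_le (hd : 0 < d) {j : PieceIndex d} (h : Q.IsWhitney F j)
    {y : Space d} (hy : ‖y - Q.gridCenter j.1 j.2.1‖ ≤ 2 * d * Q.scale j.1) :
    60 * d ^ 2 * Q.scale j.1 ≤ Metric.infDist y F ∧
      Metric.infDist y F ≤ 131 * d ^ 2 * Q.scale j.1 := by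
  have hd1 : (1 : ℝ) ≤ d := by exact_mod_cast hd
  have hs := Q.scale_pos j.1
  have h1 := h.infDist_gridCenter hd
  have h2 := abs_le.mp ((abs_infDist_sub_infDist_le (F := F) _ _).trans hy)
  have h6 : d * Q.scale j.1 ≤ d ^ 2 * Q.scale j.1 := by
    have : (d : ℝ) ≤ d ^ 2 := by nlinarith
    gcongr
  constructor <;> linarith

/-- Because of this monotonicity the difference of the far parts of consecutive generations is a
sum of pieces with coefficients in `{0, 1}`. -/
theorem FarFrom.succ (hd : 0 < d) {k : ℕ} {n n' : Fin d → ℕ} {y : Space d}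
    (h : Q.gridBump k n y ≠ 0) (h' : Q.gridBump (k + 1) n' y ≠ 0) (hf : Q.FarFrom F k n) :
    Q.FarFrom F (k + 1) n' := by
  unfold FarFrom at *
  have hd1 : (1 : ℝ) ≤ d := by exact_mod_cast hd
  have hs := Q.scale_pos k
  have h1 := abs_le.mp ((abs_infDist_sub_infDist_le (F := F) _ _).trans
    (norm_gridCenter_sub_gridPoint_succ_le h h'))
  have h3 := abs_le.mp ((abs_infDist_sub_infDist_le (F := F) _ _).trans
    (norm_gridCenter_sub_gridPoint_le (Q := Q) k n))
  rw [Q.scale_succ]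
  have h6 : d * Q.scale k ≤ d ^ 2 * Q.scale k := by
    have : (d : ℝ) ≤ d ^ 2 := by nlinarith
    gcongr
  linarith

open Classical in
theorem farPart_zero (hd : 0 < d) (hF : F.Nonempty) (hFQ : F ⊆ Q.toSet) {y : Space d}
    (hy : y ∈ Q.triple.toSet) : Q.farPart F 0 y = 0 := by
  refine Finset.sum_eq_zero fun n _ => ?_
  split_ifs with hfar
  · by_contra hne
    obtain ⟨z, hz⟩ := hF
    have h1 := norm_sub_gridPoint_le_of_gridBump_ne_zero hne
    have h2 := Cube.norm_sub_le hy (Q.toSet_subset_triple (hFQ hz))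
    have h3 : Metric.infDist (Q.gridPoint 0 n) F ≤ dist (Q.gridPoint 0 n) z :=
      Metric.infDist_le_dist_of_mem hz
    rw [dist_eq_norm] at h3
    have h4 := norm_add_le (Q.gridPoint 0 n - y) (y - z)
    rw [sub_add_sub_cancel, norm_sub_rev _ y] at h4
    unfold FarFrom at hfar
    have h5 : Q.triple.side = 3 * Q.side := rfl
    have h6 : Q.scale 0 = Q.side := by simp [scale]
    rw [h6] at hfar h1
    rw [h5] at h2
    have hd1 : (1 : ℝ) ≤ d := by exact_mod_cast hd
    have hs := Q.side_pos
    have h7 : d * Q.side ≤ d ^ 2 * Q.side := by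
      have : (d : ℝ) ≤ d ^ 2 := by nlinarith
      gcongr
    have h8 : 0 < d * Q.side := by positivity
    linarith
  · rfl

open Classical in
/-- The Whitney pieces of generation less than `N` add up to the part of the partition of unity
of generation `N` that is far from `F`. -/
theorem sum_whitney_pieceBump (hd : 0 < d) (hF : F.Nonempty) (hFQ : F ⊆ Q.toSet) (N : ℕ)
    {y : Space d} (hy : y ∈ Q.triple.toSet) :
    ∑ j ∈ Q.whitney F N, Q.pieceBump j y = Q.farPart F N y := by
  have step : ∀ k, ∑ p ∈ gridBox d k ×ˢ gridBox d (k + 1),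
      (if Q.IsWhitney F ⟨k, p⟩ then Q.pieceBump ⟨k, p⟩ y else 0) =
      Q.farPart F (k + 1) y - Q.farPart F k y := by
    intro k
    have e1 : Q.farPart F (k + 1) y = ∑ n ∈ gridBox d k, ∑ n' ∈ gridBox d (k + 1),
        (if Q.FarFrom F (k + 1) n' then Q.gridBump k n y * Q.gridBump (k + 1) n' y else 0) := by
      have : Q.farPart F (k + 1) y =
          (∑ n ∈ gridBox d k, Q.gridBump k n y) * Q.farPart F (k + 1) y := by
        rw [sum_gridBump k hy, one_mul]
      rw [this, farPart, Finset.sum_mul_sum]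
      simp only [mul_ite, mul_zero]
    have e2 : Q.farPart F k y = ∑ n ∈ gridBox d k, ∑ n' ∈ gridBox d (k + 1),
        (if Q.FarFrom F k n then Q.gridBump k n y * Q.gridBump (k + 1) n' y else 0) := by
      have : Q.farPart F k y =
          Q.farPart F k y * (∑ n ∈ gridBox d (k + 1), Q.gridBump (k + 1) n y) := by
        rw [sum_gridBump (k + 1) hy, mul_one]
      rw [this, farPart, Finset.sum_mul_sum]
      simp only [ite_mul, zero_mul]
    rw [e1, e2, ← Finset.sum_sub_distrib, Finset.sum_product]
    refine Finset.sum_congr rfl fun n hn => ?_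
    rw [← Finset.sum_sub_distrib]
    refine Finset.sum_congr rfl fun n' hn' => ?_
    by_cases h0 : Q.gridBump k n y * Q.gridBump (k + 1) n' y = 0
    · have : Q.pieceBump ⟨k, (n, n')⟩ y = 0 := h0
      simp [h0, this]
    · have hp : Q.pieceBump ⟨k, (n, n')⟩ y = Q.gridBump k n y * Q.gridBump (k + 1) n' y := rfl
      by_cases hf : Q.FarFrom F k n
      · have hf' := hf.succ hd (left_ne_zero_of_mul h0) (right_ne_zero_of_mul h0)
        rw [if_neg (fun h => h.not_far hf), if_pos hf, if_pos hf', sub_self]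
      · by_cases hf' : Q.FarFrom F (k + 1) n'
        · rw [if_pos ⟨hn, hn', hf, hf', y, hy, h0⟩, if_pos hf', if_neg hf, sub_zero, hp]
        · rw [if_neg (fun h => hf' h.far), if_neg hf, if_neg hf', sub_zero]
  rw [whitney, Finset.sum_filter, Finset.sum_sigma]
  rw [Finset.sum_congr rfl fun k _ => step k, Finset.sum_range_sub (fun k => Q.farPart F k y),
    farPart_zero hd hF hFQ hy, sub_zero]

theorem farPart_mem_Icc (k : ℕ) {y : Space d} (hy : y ∈ Q.triple.toSet) :
    0 ≤ Q.farPart F k y ∧ Q.farPart F k y ≤ 1 := by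
  classical
  constructor
  · refine Finset.sum_nonneg fun n _ => ?_
    split_ifs
    · exact Q.gridBump_nonneg k n y
    · rfl
  · rw [← sum_gridBump k hy]
    refine Finset.sum_le_sum fun n _ => ?_
    split_ifs
    · rfl
    · exact Q.gridBump_nonneg k n y

theorem farPart_eq_zero_of_mem_closure (hd : 0 < d) (k : ℕ) {y : Space d} (hy : y ∈ closure F) :
    Q.farPart F k y = 0 := by
  classical
  refine Finset.sum_eq_zero fun n _ => ?_
  split_ifs with hfar
  · by_contra hne
    have h1 := norm_sub_gridPoint_le_of_gridBump_ne_zero hne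
    have h2 := abs_le.mp ((abs_infDist_sub_infDist_le (F := F) _ _).trans h1)
    rw [Metric.infDist_zero_of_mem_closure hy] at h2
    unfold FarFrom at hfar
    have hd1 : (1 : ℝ) ≤ d := by exact_mod_cast hd
    have hs := Q.scale_pos k
    have h6 : d * Q.scale k ≤ d ^ 2 * Q.scale k := by
      have : (d : ℝ) ≤ d ^ 2 := by nlinarith
      gcongr
    have h8 : 0 < d * Q.scale k := by positivity
    linarith
  · rfl

theorem tendsto_scale (Q : Cube d) : Filter.Tendsto Q.scale Filter.atTop (nhds 0) := by
  have h := tendsto_pow_atTop_nhds_zero_of_lt_one (r := (1 / 2 : ℝ)) (by norm_num) (by norm_num)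
  have := h.const_mul Q.side
  rw [mul_zero] at this
  refine this.congr fun k => ?_
  unfold scale
  rw [one_div, inv_pow]; rfl

theorem eventually_farPart_eq_one (hF : F.Nonempty) {y : Space d}
    (hy : y ∈ Q.triple.toSet) (hyF : y ∉ closure F) :
    ∀ᶠ k in Filter.atTop, Q.farPart F k y = 1 := by
  classical
  have hpos : 0 < Metric.infDist y F := by
    refine lt_of_le_of_ne Metric.infDist_nonneg fun h => hyF ?_
    exact (Metric.mem_closure_iff_infDist_zero hF).mpr h.symm
  have hlim : Filter.Tendsto (fun k => (128 * (d : ℝ) ^ 2 + 2 * d) * Q.scale k) Filter.atTop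
      (nhds ((128 * (d : ℝ) ^ 2 + 2 * d) * 0)) := Q.tendsto_scale.const_mul _
  rw [mul_zero] at hlim
  filter_upwards [hlim.eventually_lt_const hpos] with k hk
  rw [← sum_gridBump k hy]
  refine Finset.sum_congr rfl fun n _ => ?_
  by_cases h0 : Q.gridBump k n y = 0
  · simp [h0]
  · rw [if_pos]
    have h1 := norm_sub_gridPoint_le_of_gridBump_ne_zero h0
    have h2 := abs_le.mp ((abs_infDist_sub_infDist_le (F := F) _ _).trans h1)
    unfold FarFrom
    linarith

/-- Bounded overlap of the grid cells of the Whitney pieces. -/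
theorem card_le_of_forall_mem_gridCube (hd : 0 < d) {T : Finset (PieceIndex d)} {y : Space d}
    (hT : ∀ j ∈ T, Q.IsWhitney F j) (hy : ∀ j ∈ T, y ∈ (Q.gridCube j.1 j.2.1).toSet) :
    T.card ≤ 2 * 5 ^ d := by
  rcases T.eq_empty_or_nonempty with rfl | hne
  · simp
  have hd1 : (1 : ℝ) ≤ d := by exact_mod_cast hd
  obtain ⟨j₀, hj₀, hmin⟩ := T.exists_min_image (fun j => j.1) hne
  have hdist : ∀ j ∈ T, 60 * d ^ 2 * Q.scale j.1 ≤ Metric.infDist y F ∧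
      Metric.infDist y F ≤ 131 * d ^ 2 * Q.scale j.1 := fun j hj => by
    refine (hT j hj).infDist_of_norm_le hd
      ((norm_sub_gridCenter_le_of_mem_gridCube (hy j hj)).trans ?_)
    have := Q.scale_pos j.1
    have : 0 < d * Q.scale j.1 := by positivity
    linarith
  -- at most two generations occur
  have hgen : ∀ j ∈ T, j.1 ∈ Finset.Icc j₀.1 (j₀.1 + 1) := by
    intro j hj
    rw [Finset.mem_Icc]
    refine ⟨hmin j hj, ?_⟩
    by_contra! hlt
    have h1 := (hdist j hj).2
    have h2 := (hdist j₀ hj₀).1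
    have h3 : Q.scale j.1 ≤ Q.scale j₀.1 / 4 := by
      unfold scale
      rw [div_div]
      have h4 : (2 : ℝ) ^ j₀.1 * 4 ≤ 2 ^ j.1 := by
        calc (2 : ℝ) ^ j₀.1 * 4 = 2 ^ (j₀.1 + 2) := by rw [pow_add]; norm_num
          _ ≤ _ := pow_le_pow_right₀ (by norm_num) (by omega)
      have := Q.side_pos
      gcongr
    have h5 := Q.scale_pos j₀.1
    have h6 : 0 < (d : ℝ) ^ 2 * Q.scale j₀.1 := by positivity
    have h7 : (d : ℝ) ^ 2 * Q.scale j.1 ≤ d ^ 2 * (Q.scale j₀.1 / 4) := by gcongr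
    linarith
  -- the cell containing `y` in a given generation
  set cell : ℕ → (Fin d → ℕ) := fun k i =>
    ⌊(y i - (Q.corner i - 2 * Q.side)) / Q.scale k⌋₊ with hcell
  have hsub : T ⊆ (Finset.Icc j₀.1 (j₀.1 + 1)).sigma fun k => ({cell k} : Finset (Fin d → ℕ)) ×ˢ
      Fintype.piFinset fun i => Finset.Icc (2 * cell k i - 1) (2 * cell k i + 3) := by
    intro j hj
    have hn : j.2.1 = cell j.1 := by
      ext i
      have h1 : Q.gridPoint j.1 j.2.1 i ≤ y i ∧ y i < Q.gridPoint j.1 j.2.1 i + Q.scale j.1 :=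
        hy j hj i
      rw [gridPoint_apply] at h1
      have hs := Q.scale_pos j.1
      refine ((Nat.floor_eq_iff (div_nonneg ?_ hs.le)).mpr ⟨?_, ?_⟩).symm
      · have : 0 ≤ Q.scale j.1 * j.2.1 i := by positivity
        linarith
      · rw [le_div_iff₀ hs]; linarith
      · rw [div_lt_iff₀ hs]; linarith
    obtain ⟨z, _, hz⟩ := (hT j hj).exists_ne_zero
    rw [Finset.mem_sigma, Finset.mem_product, Finset.mem_singleton, Fintype.mem_piFinset]
    refine ⟨hgen j hj, hn, fun i => ?_⟩
    have h1 := gridBump_ne_zero (left_ne_zero_of_mul hz) i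
    have h2 := gridBump_ne_zero (right_ne_zero_of_mul hz) i
    have hs := Q.scale_pos j.1
    rw [gridPoint_apply] at h1
    rw [gridPoint_apply, Q.scale_succ] at h2
    rw [← hn, Finset.mem_Icc]
    have h3 : Q.scale j.1 * (j.2.1 i : ℝ) < Q.scale j.1 * ((j.2.2 i : ℝ) / 2 + 1) := by linarith
    have h4 : Q.scale j.1 * ((j.2.2 i : ℝ) / 2) < Q.scale j.1 * ((j.2.1 i : ℝ) + 2) := by linarith
    have h5 := lt_of_mul_lt_mul_left h3 hs.le
    have h6 := lt_of_mul_lt_mul_left h4 hs.le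
    have h7 : (2 * j.2.1 i : ℝ) < ((j.2.2 i + 2 : ℕ) : ℝ) := by push_cast; linarith
    have h8 : (j.2.2 i : ℝ) < ((2 * j.2.1 i + 4 : ℕ) : ℝ) := by push_cast; linarith
    have h9 : 2 * j.2.1 i < j.2.2 i + 2 := by exact_mod_cast h7
    have h10 : j.2.2 i < 2 * j.2.1 i + 4 := by exact_mod_cast h8
    omega
  refine (Finset.card_le_card hsub).trans ?_
  rw [Finset.card_sigma]
  calc _ ≤ ∑ k ∈ Finset.Icc j₀.1 (j₀.1 + 1), 5 ^ d := by
        refine Finset.sum_le_sum fun k _ => ?_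
        rw [Finset.card_product, Finset.card_singleton, one_mul, Fintype.card_piFinset]
        calc _ ≤ ∏ _i : Fin d, 5 := by
              refine Finset.prod_le_prod' fun i _ => ?_
              rw [Nat.card_Icc]; omega
          _ = _ := by simp
    _ = _ := by rw [Finset.sum_const, Nat.card_Icc, smul_eq_mul]; congr 1; omega

end Cube

end CancellativeSparse

/-! ### The Marcinkiewicz function -/

namespace CancellativeSparse

variable {d : ℕ}

theorem decay_eq {δ t : ℝ} (ht : 0 < t) (x y : Space d) :
    decay δ t x y = (1 + ‖t⁻¹ • (x - y)‖) ^ (-((d : ℝ) + δ)) := by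
  unfold decay
  rw [norm_smul, Real.norm_of_nonneg (by positivity), Real.rpow_neg (by positivity),
    ← Real.inv_rpow (by positivity)]
  congr 1
  field_simp

/-- The integral of the decay profile at scale `1`. -/
noncomputable def decayMass (d : ℕ) (δ : ℝ) : ℝ := ∫ x : Space d, (1 + ‖x‖) ^ (-((d : ℝ) + δ))

theorem decayMass_nonneg (d : ℕ) (δ : ℝ) : 0 ≤ decayMass d δ :=
  integral_nonneg fun x => by positivity

theorem integrable_decay {δ t : ℝ} (hδ : 0 < δ) (ht : 0 < t) (y : Space d) :
    Integrable (fun x => decay δ t x y) := by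
  simp only [decay_eq ht]
  have h : Integrable (fun x : Space d => (1 + ‖x‖) ^ (-((d : ℝ) + δ))) :=
    integrable_one_add_norm (by simpa using hδ)
  exact (h.comp_smul (inv_ne_zero ht.ne')).comp_sub_right y

theorem integral_decay {δ t : ℝ} (ht : 0 < t) (y : Space d) :
    ∫ x, decay δ t x y = t ^ d * decayMass d δ := by
  simp only [decay_eq ht]
  rw [integral_sub_right_eq_self (fun x : Space d => (1 + ‖t⁻¹ • x‖) ^ (-((d : ℝ) + δ))) y,
    Measure.integral_comp_inv_smul_of_nonneg volume
      (fun x : Space d => (1 + ‖x‖) ^ (-((d : ℝ) + δ))) ht.le]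
  simp [decayMass]

theorem decay_comm (δ t : ℝ) (x y : Space d) : decay δ t x y = decay δ t y x := by
  unfold decay; rw [norm_sub_rev]

namespace Cube

/-- A discrete Marcinkiewicz function: the superposition of the decay profiles of the Whitney
pieces of the complement of `F`. -/
noncomputable def marcinkiewicz (Q : Cube d) (F : Set (Space d)) (δ : ℝ) (x : Space d) : ℝ≥0∞ :=
  ∑' j : {j // Q.IsWhitney F j},
    ENNReal.ofReal (decay δ (Q.scale j.1.1) x (Q.gridCenter j.1.1 j.1.2.1))

variable {Q : Cube d} {F : Set (Space d)}

theorem continuous_decay {δ t : ℝ} (hδ : 0 < δ) (ht : 0 < t) (y : Space d) :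
    Continuous fun x => decay δ t x y := by
  unfold decay
  refine Continuous.rpow_const (Continuous.div continuous_const (by fun_prop) fun x => ?_)
    fun x => Or.inr (by positivity)
  positivity

theorem measurable_marcinkiewicz {δ : ℝ} (hδ : 0 < δ) : Measurable (Q.marcinkiewicz F δ) :=
  Measurable.tsum fun _ =>
    (continuous_decay hδ (Q.scale_pos _) _).measurable.ennreal_ofReal

theorem IsWhitney.gridCube_subset {j : PieceIndex d} (h : Q.IsWhitney F j) :
    (Q.gridCube j.1 j.2.1).toSet ⊆
      (⟨Q.gridPoint 0 0, 4 * Q.side, by have := Q.side_pos; positivity⟩ : Cube d).toSet := by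
  intro y hy i
  have h1 : Q.gridPoint j.1 j.2.1 i ≤ y i ∧ y i < Q.gridPoint j.1 j.2.1 i + Q.scale j.1 := hy i
  have h2 : j.2.1 i < 4 * 2 ^ j.1 := Finset.mem_range.mp ((Fintype.mem_piFinset.mp h.mem_fst) i)
  have h3 : (j.2.1 i : ℝ) + 1 ≤ 4 * 2 ^ j.1 := by exact_mod_cast h2
  have hs := Q.scale_pos j.1
  have hsQ : Q.scale j.1 * 2 ^ j.1 = Q.side := by unfold scale; field_simp
  rw [gridPoint_apply] at h1
  have h4 : Q.scale j.1 * ((j.2.1 i : ℝ) + 1) ≤ Q.scale j.1 * (4 * 2 ^ j.1) := by gcongr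
  have h5 : 0 ≤ Q.scale j.1 * (j.2.1 i : ℝ) := by positivity
  change Q.gridPoint 0 0 i ≤ y i ∧ y i < Q.gridPoint 0 0 i + 4 * Q.side
  rw [gridPoint_apply]
  simp only [Pi.zero_apply, Nat.cast_zero, mul_zero, add_zero]
  constructor <;> nlinarith

theorem sum_indicator_gridCube_le (hd : 0 < d) {T : Finset (PieceIndex d)}
    (hT : ∀ j ∈ T, Q.IsWhitney F j) (y : Space d) :
    ∑ j ∈ T, (Q.gridCube j.1 j.2.1).toSet.indicator (fun _ => (1 : ℝ)) y ≤ 2 * 5 ^ d := by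
  classical
  simp only [Set.indicator_apply]
  rw [Finset.sum_boole]
  have := card_le_of_forall_mem_gridCube (Q := Q) (F := F) hd
    (T := T.filter fun j => y ∈ (Q.gridCube j.1 j.2.1).toSet) (y := y)
    (fun j hj => hT j (Finset.mem_filter.mp hj).1) (fun j hj => (Finset.mem_filter.mp hj).2)
  exact_mod_cast this

theorem tsum_indicator_gridCube_le (hd : 0 < d) (y : Space d) :
    ∑' j : {j // Q.IsWhitney F j},
      (Q.gridCube j.1.1 j.1.2.1).toSet.indicator (fun _ => (1 : ℝ≥0∞)) y ≤ 2 * 5 ^ d := by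
  classical
  rw [ENNReal.tsum_eq_iSup_sum]
  refine iSup_le fun T => ?_
  simp only [Set.indicator_apply]
  rw [Finset.sum_boole]
  have := card_le_of_forall_mem_gridCube (Q := Q) (F := F) hd
    (T := (T.filter fun j => y ∈ (Q.gridCube j.1.1 j.1.2.1).toSet).map
      (Function.Embedding.subtype _)) (y := y)
    (fun j hj => by
      obtain ⟨i, _, rfl⟩ := Finset.mem_map.mp hj
      exact i.2)
    (fun j hj => by
      obtain ⟨i, hi, rfl⟩ := Finset.mem_map.mp hj
      exact (Finset.mem_filter.mp hi).2)
  rw [Finset.card_map] at this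
  exact_mod_cast this

theorem lintegral_marcinkiewicz_le (hd : 0 < d) {δ : ℝ} (hδ : 0 < δ) :
    ∫⁻ x, Q.marcinkiewicz F δ x ≤
      ENNReal.ofReal (decayMass d δ) * (2 * 5 ^ d) * ENNReal.ofReal (4 ^ d) * volume Q.toSet := by
  unfold marcinkiewicz
  rw [lintegral_tsum fun j =>
    (continuous_decay hδ (Q.scale_pos _) _).measurable.ennreal_ofReal.aemeasurable]
  set B : Cube d := ⟨Q.gridPoint 0 0, 4 * Q.side, by have := Q.side_pos; positivity⟩ with hB
  have e : ∀ j : {j // Q.IsWhitney F j},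
      ∫⁻ x, ENNReal.ofReal (decay δ (Q.scale j.1.1) x (Q.gridCenter j.1.1 j.1.2.1)) =
      ENNReal.ofReal (decayMass d δ) *
        ∫⁻ y in B.toSet, (Q.gridCube j.1.1 j.1.2.1).toSet.indicator (fun _ => (1 : ℝ≥0∞)) y := by
    intro j
    have hs := Q.scale_pos j.1.1
    rw [← ofReal_integral_eq_lintegral_ofReal (integrable_decay hδ hs _)
      (Filter.Eventually.of_forall fun x => decay_nonneg hs.le _ _), integral_decay hs,
      lintegral_indicator (measurableSet_toSet _), Measure.restrict_restrict
      (measurableSet_toSet _), Set.inter_eq_left.mpr j.2.gridCube_subset, setLIntegral_one,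
      volume_toSet, mul_comm, ENNReal.ofReal_mul (decayMass_nonneg _ _)]
    rfl
  rw [tsum_congr e, ENNReal.tsum_mul_left, ← lintegral_tsum fun j =>
    (measurable_const.indicator (measurableSet_toSet _)).aemeasurable]
  have hBv : volume B.toSet = ENNReal.ofReal (4 ^ d) * volume Q.toSet := by
    rw [volume_toSet, volume_toSet, ← ENNReal.ofReal_mul (by positivity), ← mul_pow]
  calc _ ≤ ENNReal.ofReal (decayMass d δ) * ∫⁻ y in B.toSet, 2 * 5 ^ d := by
        gcongr with y
        exact tsum_indicator_gridCube_le hd y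
    _ = _ := by
        rw [setLIntegral_const, hBv]; ring

end Cube

/-! ### Operators acting on functions -/

open Classical in
/-- The action of an operator on `L²` on functions (with the value `0` on functions that are not
in `L²`). -/
noncomputable def applyOp (T : L2 d →L[ℝ] L2 d) (f : Space d → ℝ) : Space d → ℝ :=
  if h : MemLp f 2 (volume : Measure (Space d)) then T (h.toLp f) else 0

section applyOp

variable {T : L2 d →L[ℝ] L2 d} {f g : Space d → ℝ}

theorem applyOp_eq (h : MemLp f 2 (volume : Measure (Space d))) : applyOp T f = T (h.toLp f) :=
  dif_pos h

theorem applyOp_congr (h : f =ᵐ[volume] g) : applyOp T f = applyOp T g := by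
  by_cases hf : MemLp f 2 (volume : Measure (Space d))
  · have hg := hf.ae_eq h
    rw [applyOp_eq hf, applyOp_eq hg, MemLp.toLp_congr hf hg h]
  · have hg : ¬ MemLp g 2 (volume : Measure (Space d)) := fun hg => hf (hg.ae_eq h.symm)
    simp only [applyOp, dif_neg hf, dif_neg hg]

theorem aestronglyMeasurable_applyOp : AEStronglyMeasurable (applyOp T f) volume := by
  unfold applyOp
  split_ifs with h
  · exact Lp.aestronglyMeasurable _
  · exact aestronglyMeasurable_zero

theorem applyOp_sub (hf : MemLp f 2 (volume : Measure (Space d)))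
    (hg : MemLp g 2 (volume : Measure (Space d))) :
    applyOp T (fun y => f y - g y) =ᵐ[volume] fun x => applyOp T f x - applyOp T g x := by
  have h := hf.sub hg
  have e : applyOp T (fun y => f y - g y) = T (h.toLp (f - g)) := applyOp_eq h
  rw [e, MemLp.toLp_sub hf hg, map_sub, applyOp_eq hf, applyOp_eq hg]
  exact Lp.coeFn_sub _ _

theorem applyOp_add (hf : MemLp f 2 (volume : Measure (Space d)))
    (hg : MemLp g 2 (volume : Measure (Space d))) :
    applyOp T (fun y => f y + g y) =ᵐ[volume] fun x => applyOp T f x + applyOp T g x := by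
  have h := hf.add hg
  have e : applyOp T (fun y => f y + g y) = T (h.toLp (f + g)) := applyOp_eq h
  rw [e, MemLp.toLp_add hf hg, map_add, applyOp_eq hf, applyOp_eq hg]
  exact Lp.coeFn_add _ _

theorem applyOp_sum {ι : Type*} (s : Finset ι) {b : ι → Space d → ℝ}
    (hb : ∀ j ∈ s, MemLp (b j) 2 (volume : Measure (Space d))) :
    applyOp T (fun y => ∑ j ∈ s, b j y) =ᵐ[volume] fun x => ∑ j ∈ s, applyOp T (b j) x := by
  classical
  induction s using Finset.induction_on with
  | empty =>
    have h0 : MemLp (fun _ : Space d => (0 : ℝ)) 2 volume := MemLp.zero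
    have e : h0.toLp (fun _ : Space d => (0 : ℝ)) = 0 := MemLp.toLp_zero h0
    simp only [Finset.sum_empty]
    rw [applyOp_eq h0, e, map_zero]
    exact Lp.coeFn_zero _ _ _
  | insert a s ha ih =>
    simp only [Finset.sum_insert ha]
    have h1 := hb a (Finset.mem_insert_self a s)
    have h2 : MemLp (fun y => ∑ j ∈ s, b j y) 2 volume :=
      memLp_finsetSum s fun j hj => hb j (Finset.mem_insert_of_mem hj)
    filter_upwards [applyOp_add (T := T) h1 h2,
      ih fun j hj => hb j (Finset.mem_insert_of_mem hj)] with x hx1 hx2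
    rw [hx1, hx2]

theorem eLpNorm_applyOp_le (hf : MemLp f 2 (volume : Measure (Space d))) :
    eLpNorm (applyOp T f) 2 volume ≤ ‖T‖ₑ * eLpNorm f 2 volume := by
  rw [applyOp_eq hf, ← Lp.enorm_def, ← Lp.enorm_toLp hf]
  exact T.le_opENorm _

theorem exists_subseq_applyOp_tendsto {h : ℕ → Space d → ℝ}
    (hh : ∀ n, MemLp (h n) 2 (volume : Measure (Space d)))
    (hlim : Filter.Tendsto (fun n => eLpNorm (h n) 2 volume) Filter.atTop (nhds 0)) :
    ∃ ns : ℕ → ℕ, StrictMono ns ∧ ∀ᵐ x ∂(volume : Measure (Space d)),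
      Filter.Tendsto (fun i => applyOp T (h (ns i)) x) Filter.atTop (nhds 0) := by
  have h1 : Filter.Tendsto (fun n => eLpNorm (applyOp T (h n) - fun _ => 0) 2 volume)
      Filter.atTop (nhds 0) := by
    have h2 : Filter.Tendsto (fun n => ‖T‖ₑ * eLpNorm (h n) 2 volume) Filter.atTop
        (nhds (‖T‖ₑ * 0)) := ENNReal.Tendsto.const_mul hlim (Or.inr (by simp))
    rw [mul_zero] at h2
    refine tendsto_of_tendsto_of_tendsto_of_le_of_le tendsto_const_nhds h2
      (fun _ => zero_le) fun n => ?_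
    have : (applyOp T (h n) - fun _ => 0) = applyOp T (h n) := by ext x; simp
    rw [this]
    exact eLpNorm_applyOp_le (hh n)
  exact (tendstoInMeasure_of_tendsto_eLpNorm (by norm_num)
    (fun n => aestronglyMeasurable_applyOp) aestronglyMeasurable_const h1).exists_seq_tendsto_ae

end applyOp

end CancellativeSparse

/-! ### The pieces of the Calderón–Zygmund decomposition -/

namespace CancellativeSparse

variable {d : ℕ}

theorem IsLinftyC.integrable {f : Space d → ℝ} (hf : IsLinftyC f) : Integrable f volume := by
  rw [← memLp_one_iff_integrable]
  exact hf.memLp_top.mono_exponent_of_measure_support_ne_top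
    (s := tsupport f) (fun _ hx => image_eq_zero_of_notMem_tsupport hx)
    hf.hasCompactSupport.measure_lt_top.ne le_top

theorem IsLinftyC.mul_continuous {f g : Space d → ℝ} (hf : IsLinftyC f) (hg : Continuous g)
    (hg' : HasCompactSupport g) : IsLinftyC fun y => f y * g y := by
  refine ⟨?_, hf.hasCompactSupport.mul_right⟩
  obtain ⟨C, hC⟩ := hg'.exists_bound_of_continuous hg
  have h2 : MemLp g ∞ volume := memLp_top_of_bound hg.aestronglyMeasurable C
    (Filter.Eventually.of_forall hC)
  exact h2.mul hf.memLp_top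

theorem isLinftyC_of_bound {f : Space d → ℝ} (hm : AEStronglyMeasurable f volume) {C : ℝ}
    (hC : ∀ᵐ y ∂(volume : Measure (Space d)), |f y| ≤ C) {c : Space d} {R : ℝ}
    (hs : ∀ y, f y ≠ 0 → ‖y - c‖ ≤ R) : IsLinftyC f :=
  ⟨memLp_top_of_bound hm C hC, HasCompactSupport.of_support_subset_isCompact
    (isCompact_closedBall c R) fun y hy => by
      rw [Metric.mem_closedBall, dist_eq_norm]; exact hs y hy⟩

namespace Cube

/-- A cutoff `ψ` in `3Q` is adapted to `F` if, on every ball whose distance to `F` is large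
relative to its radius, it coincides with a function that is smooth at the scale of that ball. -/
structure IsAdapted (Q : Cube d) (F : Set (Space d)) (m : ℕ) (δ A : ℝ) (ψ : Space d → ℝ) :
    Prop where
  continuous : Continuous ψ
  mem_triple : ∀ y, ψ y ≠ 0 → y ∈ Q.triple.toSet
  abs_le_one : ∀ y, |ψ y| ≤ 1
  exists_smooth : ∀ l, 0 < l → l ≤ Q.side → ∀ c,
    (∀ y, ‖y - c‖ ≤ d * l → 3 * d * l ≤ Metric.infDist y F) →
    ∃ ψ', SmoothAtScale m δ l A Set.univ ψ' ∧ ∀ y, ‖y - c‖ ≤ d * l → ψ y = ψ' y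

variable (Q : Cube d)

/-- The integral of a Whitney piece of `f ψ`. -/
noncomputable def pieceMass (f ψ : Space d → ℝ) (j : PieceIndex d) : ℝ :=
  ∫ y, f y * (ψ y * Q.pieceBump j y)

/-- The mass of a Whitney piece of `f ψ`, spread evenly over a grid cell. -/
noncomputable def pieceGood (f ψ : Space d → ℝ) (j : PieceIndex d) (y : Space d) : ℝ :=
  Q.pieceMass f ψ j / Q.scale j.1 ^ d * (Q.gridCube j.1 j.2.1).toSet.indicator (fun _ => 1) y

/-- The cancellative part of a Whitney piece of `f ψ`. -/
noncomputable def pieceBad (f ψ : Space d → ℝ) (j : PieceIndex d) (y : Space d) : ℝ :=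
  f y * (ψ y * Q.pieceBump j y) - Q.pieceGood f ψ j y

variable {Q}

theorem pieceBump_ne_zero {j : PieceIndex d} {y : Space d} (h : Q.pieceBump j y ≠ 0) :
    ‖y - Q.gridCenter j.1 j.2.1‖ ≤ d * Q.scale j.1 :=
  norm_sub_gridCenter_le_of_gridBump_ne_zero (left_ne_zero_of_mul h)

theorem continuous_pieceBump (j : PieceIndex d) : Continuous (Q.pieceBump j) :=
  (Q.continuous_gridBump _ _).mul (Q.continuous_gridBump _ _)

theorem hasCompactSupport_pieceBump (j : PieceIndex d) : HasCompactSupport (Q.pieceBump j) :=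
  HasCompactSupport.of_support_subset_isCompact
    (isCompact_closedBall (Q.gridCenter j.1 j.2.1) (d * Q.scale j.1)) fun y hy => by
      rw [Metric.mem_closedBall, dist_eq_norm]; exact pieceBump_ne_zero hy

theorem pieceGood_ne_zero {f ψ : Space d → ℝ} {j : PieceIndex d} {y : Space d}
    (h : Q.pieceGood f ψ j y ≠ 0) : y ∈ (Q.gridCube j.1 j.2.1).toSet := by
  by_contra hy
  exact h (by simp [pieceGood, hy])

theorem pieceBad_ne_zero {f ψ : Space d → ℝ} {j : PieceIndex d} {y : Space d}
    (h : Q.pieceBad f ψ j y ≠ 0) : ‖y - Q.gridCenter j.1 j.2.1‖ ≤ d * Q.scale j.1 := by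
  by_cases hg : Q.pieceGood f ψ j y = 0
  · refine pieceBump_ne_zero (j := j) fun h0 => h ?_
    simp [pieceBad, hg, h0]
  · exact norm_sub_gridCenter_le_of_mem_gridCube (pieceGood_ne_zero hg)

theorem isLinftyC_piece {f ψ : Space d → ℝ} (hf : IsLinftyC f) (hψ : Continuous ψ)
    (j : PieceIndex d) : IsLinftyC fun y => f y * (ψ y * Q.pieceBump j y) :=
  hf.mul_continuous (hψ.mul (continuous_pieceBump j)) (hasCompactSupport_pieceBump j).mul_left

theorem measurable_pieceGood (f ψ : Space d → ℝ) (j : PieceIndex d) :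
    Measurable (Q.pieceGood f ψ j) :=
  (measurable_const.indicator (measurableSet_toSet _)).const_mul _

theorem isLinftyC_pieceGood (f ψ : Space d → ℝ) (j : PieceIndex d) :
    IsLinftyC (Q.pieceGood f ψ j) := by
  refine isLinftyC_of_bound (measurable_pieceGood f ψ j).aestronglyMeasurable
    (C := |Q.pieceMass f ψ j / Q.scale j.1 ^ d|) (Filter.Eventually.of_forall fun y => ?_)
    (c := Q.gridCenter j.1 j.2.1) (R := d * Q.scale j.1)
    fun y hy => norm_sub_gridCenter_le_of_mem_gridCube (pieceGood_ne_zero hy)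
  unfold pieceGood
  rw [abs_mul]
  refine mul_le_of_le_one_right (abs_nonneg _) ?_
  by_cases hy : y ∈ (Q.gridCube j.1 j.2.1).toSet <;> simp [hy]

theorem isLinftyC_pieceBad {f ψ : Space d → ℝ} (hf : IsLinftyC f) (hψ : Continuous ψ)
    (j : PieceIndex d) : IsLinftyC (Q.pieceBad f ψ j) :=
  ⟨(isLinftyC_piece hf hψ j).memLp_top.sub (isLinftyC_pieceGood f ψ j).memLp_top,
    (isLinftyC_piece hf hψ j).hasCompactSupport.sub (isLinftyC_pieceGood f ψ j).hasCompactSupport⟩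

theorem integral_pieceGood (f ψ : Space d → ℝ) (j : PieceIndex d) :
    ∫ y, Q.pieceGood f ψ j y = Q.pieceMass f ψ j := by
  unfold pieceGood
  have hs := Q.scale_pos j.1
  rw [integral_const_mul, integral_indicator (measurableSet_toSet _), setIntegral_const,
    Measure.real, volume_toSet]
  have : (Q.gridCube j.1 j.2.1).side = Q.scale j.1 := rfl
  rw [this, ENNReal.toReal_ofReal (by positivity), smul_eq_mul, mul_one,
    div_mul_cancel₀ _ (by positivity)]

theorem integral_pieceBad {f ψ : Space d → ℝ} (hf : IsLinftyC f) (hψ : Continuous ψ)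
    (j : PieceIndex d) : ∫ y, Q.pieceBad f ψ j y = 0 := by
  unfold pieceBad
  rw [integral_sub (isLinftyC_piece hf hψ j).integrable (isLinftyC_pieceGood f ψ j).integrable,
    integral_pieceGood]
  exact sub_self _

variable {F : Set (Space d)} {s : ℝ}

/-- The height of `ψ` times the bump of a Whitney piece, as a smooth function at the scale of the
piece. -/
theorem exists_smoothAtScale_piece (hs : 0 < s) (hd : 0 < d) (A : ℝ) :
    ∃ B : ℝ, 0 < B ∧ ∀ (Q : Cube d) (F : Set (Space d)) (ψ : Space d → ℝ),
      Q.IsAdapted F (intPart s) (holderPart s) A ψ → ∀ j, Q.IsWhitney F j →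
        SmoothAtScale (intPart s) (holderPart s) (Q.scale j.1 / 2) B Set.univ
          (fun y => ψ y * Q.pieceBump j y) := by
  obtain ⟨hms, hδ, hδ1⟩ := holderPart_mem hs
  obtain ⟨A₁, hA₁, -, hT, -⟩ := exists_smoothAtScale_profiles d (intPart s) hδ.le hδ1
  set m := intPart s
  set δ := holderPart s
  refine ⟨2 ^ (m + 1) * (|A| + 1) * (2 ^ (m + 1) * A₁ * A₁), by positivity,
    fun Q F ψ hψ j hj => ?_⟩
  have hsc := Q.scale_pos j.1
  have hd1 : (1 : ℝ) ≤ d := by exact_mod_cast hd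
  obtain ⟨ψ', hψ', heq⟩ := hψ.exists_smooth (Q.scale j.1) hsc (Q.scale_le _)
    (Q.gridCenter j.1 j.2.1) fun y hy => by
      have h1 := (hj.infDist_of_norm_le hd (y := y) (hy.trans (by nlinarith))).1
      have : (d : ℝ) ≤ d ^ 2 := by nlinarith
      have : d * Q.scale j.1 ≤ d ^ 2 * Q.scale j.1 := by gcongr
      have : 0 < d * Q.scale j.1 := by positivity
      linarith
  have e : (fun y => ψ y * Q.pieceBump j y) = fun y => ψ' y * Q.pieceBump j y := by
    ext y
    by_cases h0 : Q.pieceBump j y = 0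
    · simp [h0]
    · rw [heq y (pieceBump_ne_zero h0)]
  rw [e]
  have h1 := (hT.comp_affine hsc (Q.gridPoint j.1 j.2.1)).mono_scale (L' := Q.scale j.1 / 2)
    (by positivity) (by linarith) hδ.le
  have h2 := hT.comp_affine (Q.scale_pos (j.1 + 1)) (Q.gridPoint (j.1 + 1) j.2.2)
  have h3 := h1.mul isOpen_univ (by positivity) (by rw [Q.scale_succ] at h2; exact h2)
  have h4 := ((hψ'.mono_const (B := |A| + 1) (by linarith [le_abs_self A]) hsc).mono_scale
    (L' := Q.scale j.1 / 2) (by positivity) (by linarith) hδ.le).mul isOpen_univ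
      (by positivity) h3
  convert h4 using 2 with y
  simp only [pieceBump, gridBump, Q.scale_succ]

theorem IsWhitney.exists_mem_near (hd : 0 < d) (hF : F.Nonempty) {j : PieceIndex d}
    (hj : Q.IsWhitney F j) : ∃ z ∈ F, ∀ y, ‖y - Q.gridCenter j.1 j.2.1‖ ≤ d * Q.scale j.1 →
      ‖y - z‖ ≤ 262 * d ^ 2 * (Q.scale j.1 / 2) := by
  have hd1 : (1 : ℝ) ≤ d := by exact_mod_cast hd
  have hsc := Q.scale_pos j.1
  have h6 : d * Q.scale j.1 ≤ d ^ 2 * Q.scale j.1 := by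
    have : (d : ℝ) ≤ d ^ 2 := by nlinarith
    gcongr
  have h7 : 0 < (d : ℝ) ^ 2 * Q.scale j.1 := by positivity
  obtain ⟨z, hz, hzd⟩ := (Metric.infDist_lt_iff (r := 130 * d ^ 2 * Q.scale j.1) hF).mp
    (lt_of_le_of_lt (hj.infDist_gridCenter hd).2 (by linarith))
  refine ⟨z, hz, fun y hy => ?_⟩
  rw [dist_eq_norm] at hzd
  have := norm_add_le (y - Q.gridCenter j.1 j.2.1) (Q.gridCenter j.1 j.2.1 - z)
  rw [sub_add_sub_cancel] at this
  linarith

/-- The mass of a Whitney piece is controlled by the maximal function at a nearby point of `F`. -/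
theorem exists_abs_pieceMass_le (hs : 0 < s) (hd : 0 < d) (A : ℝ) :
    ∃ C : ℝ, 0 < C ∧ ∀ (Q : Cube d) (f : Space d → ℝ) (μ : ℝ≥0) (F : Set (Space d))
      (_ : F.Nonempty) (_ : F ⊆ Q.toSet) (_ : ∀ z ∈ F, smoothMaximal s Q.triple f z ≤ μ)
      (ψ : Space d → ℝ), Q.IsAdapted F (intPart s) (holderPart s) A ψ →
      ∀ j, Q.IsWhitney F j → |Q.pieceMass f ψ j| ≤ C * μ * Q.scale j.1 ^ d := by
  obtain ⟨B, hB, hsm⟩ := exists_smoothAtScale_piece hs hd A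
  refine ⟨B * (4 * (262 * d ^ 2)) ^ (intPart s + 1 + d), by positivity,
    fun Q f μ F hF hFQ hM ψ hψ j hj => ?_⟩
  have hd1 : (1 : ℝ) ≤ d := by exact_mod_cast hd
  have hsc := Q.scale_pos j.1
  obtain ⟨z, hz, hnear⟩ := hj.exists_mem_near hd hF
  have := abs_integral_mul_le_of_smoothMaximal_le hs (Q.toSet_subset_triple (hFQ hz)) (hM z hz)
    (by positivity) hB (b := 262 * d ^ 2) (by nlinarith) (hsm Q F ψ hψ j hj)
    (fun y hy => hψ.mem_triple y (left_ne_zero_of_mul hy))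
    (fun y hy => hnear y (pieceBump_ne_zero (right_ne_zero_of_mul hy)))
  refine this.trans ?_
  calc _ ≤ B * (4 * (262 * d ^ 2)) ^ (intPart s + 1 + d) * Q.scale j.1 ^ d * μ := by
        gcongr; linarith
    _ = _ := by ring

/-- The action of the kernel on the cancellative part of a Whitney piece. -/
theorem exists_abs_integral_kernel_pieceBad_le (hs : 0 < s) (hd : 0 < d) (A : ℝ)
    {K : Space d → Space d → ℝ} {CK : ℝ} (hCK : 0 < CK) (hK : IsSmoothKernel s K CK) :
    ∃ C : ℝ, 0 < C ∧ ∀ (Q : Cube d) (f : Space d → ℝ) (_ : IsLinftyC f) (μ : ℝ≥0)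
      (F : Set (Space d)) (_ : F.Nonempty) (_ : F ⊆ Q.toSet)
      (_ : ∀ z ∈ F, smoothMaximal s Q.triple f z ≤ μ)
      (ψ : Space d → ℝ), Q.IsAdapted F (intPart s) (holderPart s) A ψ →
      ∀ j, Q.IsWhitney F j → ∀ x, 19 * d * Q.scale j.1 ≤ ‖x - Q.gridCenter j.1 j.2.1‖ →
        |∫ y, K x y * Q.pieceBad f ψ j y| ≤
          C * μ * decay (holderPart s) (Q.scale j.1) x (Q.gridCenter j.1 j.2.1) := by
  obtain ⟨B, hB, hsm⟩ := exists_smoothAtScale_piece hs hd A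
  obtain ⟨C₁, hC₁, hmass⟩ := exists_abs_pieceMass_le hs hd A
  obtain ⟨hms, hδ, hδ1⟩ := holderPart_mem hs
  set m := intPart s with hm
  set δ := holderPart s with hδdef
  set D : ℝ := 2 * (CK * (2 * d) ^ (d + m + 2)) with hD
  set E : ℝ := (4 * (262 * d ^ 2)) ^ (m + 1 + d) with hE
  have hd1 : (1 : ℝ) ≤ d := by exact_mod_cast hd
  have hD0 : 0 < D := by positivity
  refine ⟨(2 ^ (m + 1) * D * B * E + D * C₁) * 2 ^ (d + 1), by positivity,
    fun Q f hf μ F hF hFQ hM ψ hψ j hj x hx => ?_⟩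
  set l := Q.scale j.1 with hl
  set c := Q.gridCenter j.1 j.2.1 with hc
  set r := ‖x - c‖ with hr
  have hl0 : 0 < l := Q.scale_pos j.1
  have hdl : l ≤ d * l := by nlinarith
  have hr0 : 0 < r := by linarith
  -- the kernel with its value at the center of the piece subtracted
  set k : Space d → ℝ := fun y => K x y - K x c with hk
  set a : ℝ := D * ((l / r) ^ δ / r ^ d) with ha
  have ha0 : 0 < a := by positivity
  set U := Metric.ball c (2 * d * l) with hU
  have hks : SmoothAtScale m δ l a U k := by
    have := hK.smoothAtScale_sub hs hd hCK.le (y₀ := c) hl0 hx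
    rw [ha, hD]
    convert this using 1
    ring
  have hcU : Metric.closedBall c (d * l) ⊆ U := Metric.closedBall_subset_ball (by linarith)
  have hkc : ContinuousOn k (Metric.closedBall c (d * l)) := hks.contDiffOn.continuousOn.mono hcU
  have hkb : ∀ y ∈ Metric.closedBall c (d * l), |k y| ≤ a := fun y hy => hks.abs_le (hcU hy)
  have hprof : a * l ^ d ≤ D * 2 ^ (d + 1) * decay δ l x c := by
    have e1 : a * l ^ d = D * (l / r) ^ ((d : ℝ) + δ) := by
      rw [ha, Real.rpow_add (by positivity), Real.rpow_natCast, div_pow]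
      field_simp
    rw [e1, mul_assoc D]
    refine mul_le_mul_of_nonneg_left ?_ hD0.le
    unfold decay
    calc (l / r) ^ ((d : ℝ) + δ) ≤ (2 * (l / (l + r))) ^ ((d : ℝ) + δ) := by
          gcongr
          rw [← mul_div_assoc, div_le_div_iff₀ hr0 (by positivity)]
          nlinarith
      _ = 2 ^ ((d : ℝ) + δ) * (l / (l + r)) ^ ((d : ℝ) + δ) := by
          rw [Real.mul_rpow (by norm_num) (by positivity)]
      _ ≤ 2 ^ (((d + 1 : ℕ)) : ℝ) * (l / (l + r)) ^ ((d : ℝ) + δ) := by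
          gcongr
          · norm_num
          · push_cast; linarith
      _ = _ := by rw [Real.rpow_natCast]
  -- the part of the piece coming from `f`
  set φ : Space d → ℝ := fun y => k y * (ψ y * Q.pieceBump j y) with hφ
  have hφne : ∀ y, φ y ≠ 0 → ‖y - c‖ ≤ d * l := fun y hy =>
    pieceBump_ne_zero (right_ne_zero_of_mul (right_ne_zero_of_mul hy))
  have hφt : tsupport φ ⊆ Metric.closedBall c (d * l) := by
    refine closure_minimal (fun y hy => ?_) Metric.isClosed_closedBall
    rw [Metric.mem_closedBall, dist_eq_norm]; exact hφne y hy
  have hφs : SmoothAtScale m δ (l / 2) (2 ^ (m + 1) * a * B) Set.univ φ := by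
    have h1 := (hks.mono_scale (L' := l / 2) (by positivity) (by linarith) hδ.le).mul
      Metric.isOpen_ball (by positivity) ((hsm Q F ψ hψ j hj).mono_set (Set.subset_univ U))
    refine h1.of_tsupport Metric.isOpen_ball (by positivity) hδ.le (by positivity) fun y hy => ?_
    refine Metric.ball_subset_ball' ?_
    have := hφt hy
    rw [Metric.mem_closedBall] at this
    nlinarith
  obtain ⟨z, hz, hnear⟩ := hj.exists_mem_near hd hF
  have p1 : |∫ y, f y * φ y| ≤ 2 ^ (m + 1) * a * B * E * l ^ d * μ := by
    refine (abs_integral_mul_le_of_smoothMaximal_le hs (Q.toSet_subset_triple (hFQ hz)) (hM z hz)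
      (by positivity) (by positivity) (b := 262 * d ^ 2) (by nlinarith) hφs
      (fun y hy => hψ.mem_triple y (left_ne_zero_of_mul (right_ne_zero_of_mul hy)))
      (fun y hy => hnear y (hφne y hy))).trans ?_
    gcongr; linarith
  have hφcont : Continuous φ := (contDiffOn_univ.mp hφs.contDiffOn).continuous
  have hφcs : HasCompactSupport φ :=
    (isCompact_closedBall c (d * l)).of_isClosed_subset isClosed_closure hφt
  have i1 : Integrable fun y => f y * φ y := (hf.mul_continuous hφcont hφcs).integrable
  -- the part of the piece coming from the redistributed mass
  set I := (Q.gridCube j.1 j.2.1).toSet with hI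
  have hIsub : I ⊆ Metric.closedBall c (d * l) := fun y hy => by
    rw [Metric.mem_closedBall, dist_eq_norm]; exact norm_sub_gridCenter_le_of_mem_gridCube hy
  have hIm : MeasurableSet I := measurableSet_toSet _
  have hIv : volume.real I = l ^ d := by
    rw [Measure.real, volume_toSet]
    exact ENNReal.toReal_ofReal (by positivity)
  have i2 : IntegrableOn k I :=
    (hkc.integrableOn_compact (isCompact_closedBall c (d * l))).mono_set hIsub
  have p2 : |∫ y in I, k y| ≤ a * l ^ d := by
    rw [← hIv]
    exact norm_setIntegral_le_of_norm_le_const (f := k) (volume_toSet_ne_top _).lt_top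
      fun y hy => hkb y (hIsub hy)
  set M := Q.pieceMass f ψ j with hMdef
  have p3 : |M| ≤ C₁ * μ * l ^ d := hmass Q f μ F hF hFQ hM ψ hψ j hj
  have eg : ∀ y, k y * Q.pieceGood f ψ j y = M / l ^ d * I.indicator k y := by
    intro y
    unfold pieceGood
    by_cases hy : y ∈ I
    · simp only [Set.indicator_of_mem hy, ← hI]; ring
    · simp only [Set.indicator_of_notMem hy, ← hI]; ring
  have i3 : Integrable fun y => k y * Q.pieceGood f ψ j y := by
    simp only [eg]
    exact (i2.integrable_indicator hIm).const_mul _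
  have eb : ∀ y, k y * Q.pieceBad f ψ j y = f y * φ y - k y * Q.pieceGood f ψ j y := by
    intro y; simp only [pieceBad, hφ]; ring
  have i4 : Integrable fun y => k y * Q.pieceBad f ψ j y := by
    simp only [eb]; exact i1.sub i3
  have main : ∫ y, K x y * Q.pieceBad f ψ j y =
      (∫ y, f y * φ y) - M / l ^ d * ∫ y in I, k y := by
    have e1 : ∀ y, K x y * Q.pieceBad f ψ j y =
        k y * Q.pieceBad f ψ j y + K x c * Q.pieceBad f ψ j y := by
      intro y; simp only [hk]; ring
    simp only [e1]
    rw [integral_add i4 ((isLinftyC_pieceBad hf hψ.continuous j).integrable.const_mul _),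
      integral_const_mul, integral_pieceBad hf hψ.continuous, mul_zero, add_zero]
    simp only [eb]
    rw [integral_sub i1 i3]
    simp only [eg]
    rw [integral_const_mul, integral_indicator hIm]
  rw [main]
  have hld : 0 < l ^ d := by positivity
  calc _ ≤ |∫ y, f y * φ y| + |M / l ^ d * ∫ y in I, k y| := abs_sub _ _
    _ ≤ 2 ^ (m + 1) * a * B * E * l ^ d * μ + (C₁ * μ * l ^ d) / l ^ d * (a * l ^ d) := by
        rw [abs_mul, abs_div, abs_of_pos hld]
        gcongr
    _ = (2 ^ (m + 1) * B * E + C₁) * μ * (a * l ^ d) := by field_simp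
    _ ≤ (2 ^ (m + 1) * B * E + C₁) * μ * (D * 2 ^ (d + 1) * decay δ l x c) := by gcongr
    _ = _ := by ring

end Cube

end CancellativeSparse

/-! ### The decomposition at the level of the maximal function -/

namespace CancellativeSparse

variable {d : ℕ}

/-- Bounded convergence in `L²` for functions with supports in a common ball. -/
theorem tendsto_eLpNorm_two_of_bounded {h : ℕ → Space d → ℝ}
    (hm : ∀ n, AEStronglyMeasurable (h n) volume) {C : ℝ}
    (hC : ∀ n, ∀ᵐ y ∂(volume : Measure (Space d)), |h n y| ≤ C) {c : Space d} {R : ℝ}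
    (hs : ∀ n y, h n y ≠ 0 → ‖y - c‖ ≤ R)
    (hlim : ∀ y, Filter.Tendsto (fun n => h n y) Filter.atTop (nhds 0)) :
    Filter.Tendsto (fun n => eLpNorm (h n) 2 volume) Filter.atTop (nhds 0) := by
  have h1 : Filter.Tendsto (fun n => ∫⁻ y, ‖h n y‖ₑ ^ (2 : ℝ)) Filter.atTop
      (nhds (∫⁻ _y : Space d, 0)) := by
    refine tendsto_lintegral_of_dominated_convergence'
      ((Metric.closedBall c R).indicator fun _ => ENNReal.ofReal C ^ (2 : ℝ))
      (fun n => (hm n).enorm.pow_const _) (fun n => ?_) ?_ (Filter.Eventually.of_forall fun y => ?_)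
    · filter_upwards [hC n] with y hy
      by_cases hyB : y ∈ Metric.closedBall c R
      · rw [Set.indicator_of_mem hyB, Real.enorm_eq_ofReal_abs]
        gcongr
      · have : h n y = 0 := by
          by_contra hne
          exact hyB (by rw [Metric.mem_closedBall, dist_eq_norm]; exact hs n y hne)
        simp [this]
    · rw [lintegral_indicator measurableSet_closedBall, setLIntegral_const]
      exact ENNReal.mul_ne_top (by simp) (isCompact_closedBall c R).measure_lt_top.ne
    · have := ((continuous_enorm.tendsto _).comp (hlim y)).ennrpow_const 2
      simpa using this
  rw [lintegral_zero] at h1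
  have h2 := h1.ennrpow_const (1 / 2)
  rw [ENNReal.zero_rpow_of_pos (by norm_num)] at h2
  refine h2.congr fun n => ?_
  rw [eLpNorm_eq_lintegral_rpow_enorm_toReal (by norm_num) (by norm_num)]
  simp

theorem IsLinftyC.exists_ae_bound {f : Space d → ℝ} (hf : IsLinftyC f) :
    ∃ C : ℝ, 0 ≤ C ∧ ∀ᵐ y ∂(volume : Measure (Space d)), |f y| ≤ C := by
  refine ⟨(eLpNorm f ∞ volume).toReal, ENNReal.toReal_nonneg, ?_⟩
  filter_upwards [ae_le_eLpNormEssSup (f := f) (μ := volume)] with y hy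
  rw [← eLpNorm_exponent_top] at hy
  rw [← Real.norm_eq_abs, ← toReal_enorm]
  exact ENNReal.toReal_mono hf.memLp_top.2.ne hy

namespace Cube

variable {Q : Cube d} {F : Set (Space d)} {s : ℝ}

theorem norm_sub_corner_le {y : Space d} (hy : y ∈ Q.toSet) : ‖y - Q.corner‖ ≤ d * Q.side := by
  refine norm_le_of_abs_apply_le Q.side_pos.le fun i => ?_
  have := hy i
  rw [PiLp.sub_apply, abs_le]
  constructor <;> linarith

variable (Q) in
/-- The cube that contains all grid cells of the Whitney pieces. -/
noncomputable def hull : Cube d :=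
  ⟨Q.gridPoint 0 0, 4 * Q.side, by have := Q.side_pos; positivity⟩

theorem volume_hull : volume Q.hull.toSet = ENNReal.ofReal (4 ^ d) * volume Q.toSet := by
  rw [volume_toSet, volume_toSet, ← ENNReal.ofReal_mul (by positivity), ← mul_pow]; rfl

theorem triple_subset_hull : Q.triple.toSet ⊆ Q.hull.toSet := by
  intro y hy i
  have h1 := mem_triple.mp hy i
  have hs := Q.side_pos
  change Q.gridPoint 0 0 i ≤ y i ∧ y i < Q.gridPoint 0 0 i + 4 * Q.side
  rw [gridPoint_apply]
  simp only [Pi.zero_apply, Nat.cast_zero, mul_zero, add_zero]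
  constructor <;> linarith

theorem whitney_mono {N N' : ℕ} (h : N ≤ N') : Q.whitney F N ⊆ Q.whitney F N' := by
  classical
  intro j hj
  rw [whitney, Finset.mem_filter, Finset.mem_sigma, Finset.mem_range] at hj ⊢
  exact ⟨⟨hj.1.1.trans_le h, hj.1.2⟩, hj.2⟩

theorem le_of_mem_whitney_of_notMem {N N' : ℕ} {j : PieceIndex d} (h : j ∈ Q.whitney F N')
    (h' : j ∉ Q.whitney F N) : N ≤ j.1 := by
  classical
  by_contra! hlt
  rw [whitney, Finset.mem_filter, Finset.mem_sigma] at h h'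
  exact h' ⟨⟨Finset.mem_range.mpr hlt, h.1.2⟩, h.2⟩

/-- At each point the redistributed masses of only finitely many generations are present. -/
theorem exists_sum_pieceGood_eq (hd : 0 < d) (f ψ : Space d → ℝ) (y : Space d) :
    ∃ N₀, ∀ N ≥ N₀, ∑ j ∈ Q.whitney F N, Q.pieceGood f ψ j y =
      ∑ j ∈ Q.whitney F N₀, Q.pieceGood f ψ j y := by
  have hd1 : (1 : ℝ) ≤ d := by exact_mod_cast hd
  have hdist : ∀ j, Q.IsWhitney F j → Q.pieceGood f ψ j y ≠ 0 →
      60 * d ^ 2 * Q.scale j.1 ≤ Metric.infDist y F ∧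
        Metric.infDist y F ≤ 131 * d ^ 2 * Q.scale j.1 := fun j hj hne => by
    refine hj.infDist_of_norm_le hd
      ((norm_sub_gridCenter_le_of_mem_gridCube (pieceGood_ne_zero hne)).trans ?_)
    have := Q.scale_pos j.1
    have : 0 < d * Q.scale j.1 := by positivity
    linarith
  have key : ∃ N₀, ∀ j, Q.IsWhitney F j → N₀ ≤ j.1 → Q.pieceGood f ψ j y = 0 := by
    rcases (Metric.infDist_nonneg (x := y) (s := F)).eq_or_lt with h0 | hpos
    · refine ⟨0, fun j hj _ => ?_⟩
      by_contra hne
      have := (hdist j hj hne).1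
      have := Q.scale_pos j.1
      have : 0 < 60 * (d : ℝ) ^ 2 * Q.scale j.1 := by positivity
      linarith
    · have hlim : Filter.Tendsto (fun k => 131 * (d : ℝ) ^ 2 * Q.scale k) Filter.atTop
        (nhds (131 * (d : ℝ) ^ 2 * 0)) := Q.tendsto_scale.const_mul _
      rw [mul_zero] at hlim
      obtain ⟨N₀, hN₀⟩ := Filter.eventually_atTop.mp (hlim.eventually_lt_const hpos)
      refine ⟨N₀, fun j hj hle => ?_⟩
      by_contra hne
      have := (hdist j hj hne).2
      have := hN₀ j.1 hle
      linarith
  obtain ⟨N₀, hN₀⟩ := key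
  refine ⟨N₀, fun N hN => (Finset.sum_subset (whitney_mono hN) fun j hj hj' => ?_).symm⟩
  exact hN₀ j (IsWhitney.of_mem_whitney hj) (le_of_mem_whitney_of_notMem hj hj')

/-- **Calderón–Zygmund decomposition** at the level `μ` of the smooth maximal function: up to a
bounded function, `f ψ` is a sum of cancellative pieces, whose images under the operator are
controlled by the Marcinkiewicz function. The map `x₀` allows this function to be evaluated
at a point near `x` instead of `x` itself. -/
theorem exists_decomposition (hs : 0 < s) (hd : 0 < d) (A : ℝ) {T : L2 d →L[ℝ] L2 d}
    {K : Space d → Space d → ℝ} {CK : ℝ} (hCK : 0 < CK) (hK : IsSmoothKernel s K CK)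
    (hT : ∀ (f : Space d → ℝ) (hf : IsLinftyC f),
      ∀ᵐ x ∂(volume : Measure (Space d)), x ∉ tsupport f →
        T (hf.memLp_two.toLp f) x = ∫ y, K x y * f y) :
    ∃ C : ℝ, 0 < C ∧ ∀ (Q : Cube d) (f : Space d → ℝ) (_ : IsLinftyC f) (μ : ℝ≥0)
      (F : Set (Space d)) (_ : F.Nonempty) (_ : F ⊆ Q.toSet)
      (_ : ∀ z ∈ F, smoothMaximal s Q.triple f z ≤ μ)
      (ψ : Space d → ℝ), Q.IsAdapted F (intPart s) (holderPart s) A ψ →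
      ∃ G : Space d → ℝ, IsLinftyC G ∧
        (∀ᵐ y ∂(volume : Measure (Space d)), |G y| ≤ C * μ) ∧
        (∀ y, G y ≠ 0 → y ∈ Q.hull.toSet) ∧
        ∀ (E : Set (Space d)) (x₀ : Space d → Space d),
          (∀ x ∈ E, ∀ y, ψ y ≠ 0 →
            Metric.infDist y F ≤ 3 * d * ‖x - y‖ ∧ ‖x₀ x - x‖ ≤ 2 * d * ‖x - y‖) →
          (∀ x ∈ E, ∀ y, G y ≠ 0 → ∃ y₀, ψ y₀ ≠ 0 ∧ ‖x - y₀‖ ≤ 2 * ‖x - y‖) ∧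
          ∀ᵐ x ∂(volume : Measure (Space d)), x ∈ E →
            ‖applyOp T (fun y => f y * ψ y) x - applyOp T G x‖ₑ ≤
              ENNReal.ofReal (C * μ) * Q.marcinkiewicz F (holderPart s) (x₀ x) := by
  obtain ⟨C₁, hC₁, hmass⟩ := exists_abs_pieceMass_le hs hd A
  obtain ⟨C₂, hC₂, hbad⟩ := exists_abs_integral_kernel_pieceBad_le hs hd A hCK hK
  obtain ⟨C₃, hC₃, hleb⟩ := exists_forall_ae_abs_le_of_smoothMaximal_le d hs
  obtain ⟨hms, hδ, hδ1⟩ := holderPart_mem hs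
  set δ := holderPart s with hδdef
  have hd1 : (1 : ℝ) ≤ d := by exact_mod_cast hd
  have hdd : (d : ℝ) ≤ d ^ 2 := by nlinarith
  refine ⟨C₃ + C₁ * (2 * 5 ^ d) + C₂ * (5 * d ^ 2) ^ (d + 1), by positivity,
    fun Q f hf μ F hF hFQ hM ψ hψ => ?_⟩
  set C : ℝ := C₃ + C₁ * (2 * 5 ^ d) + C₂ * (5 * d ^ 2) ^ (d + 1) with hC
  have hψcs : HasCompactSupport ψ := HasCompactSupport.of_support_subset_isCompact
    (isCompact_closedBall Q.triple.corner (d * Q.triple.side)) fun y hy => by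
      rw [Metric.mem_closedBall, dist_eq_norm]; exact norm_sub_corner_le (hψ.mem_triple y hy)
  have hfψ : IsLinftyC fun y => f y * ψ y := hf.mul_continuous hψ.continuous hψcs
  have hmass' := fun j hj => hmass Q f μ F hF hFQ hM ψ hψ j hj
  -- the redistributed masses
  set gN : ℕ → Space d → ℝ := fun N y => ∑ j ∈ Q.whitney F N, Q.pieceGood f ψ j y with hgN
  have hgNb : ∀ N y, |gN N y| ≤ C₁ * (2 * 5 ^ d) * μ := by
    intro N y
    calc |gN N y| ≤ ∑ j ∈ Q.whitney F N, |Q.pieceGood f ψ j y| := Finset.abs_sum_le_sum_abs _ _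
      _ ≤ ∑ j ∈ Q.whitney F N,
          C₁ * μ * (Q.gridCube j.1 j.2.1).toSet.indicator (fun _ => (1 : ℝ)) y := by
          refine Finset.sum_le_sum fun j hj => ?_
          have hsc := Q.scale_pos j.1
          unfold pieceGood
          rw [abs_mul, abs_div, abs_of_pos (by positivity : 0 < Q.scale j.1 ^ d),
            abs_of_nonneg (a := Set.indicator _ _ _)
              (Set.indicator_nonneg (fun _ _ => zero_le_one) _)]
          refine mul_le_mul_of_nonneg_right ?_ (Set.indicator_nonneg (fun _ _ => zero_le_one) _)
          rw [div_le_iff₀ (by positivity)]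
          exact hmass' j (IsWhitney.of_mem_whitney hj)
      _ = C₁ * μ * ∑ j ∈ Q.whitney F N,
          (Q.gridCube j.1 j.2.1).toSet.indicator (fun _ => (1 : ℝ)) y := by rw [Finset.mul_sum]
      _ ≤ C₁ * μ * (2 * 5 ^ d) := by
          gcongr
          exact sum_indicator_gridCube_le hd (fun j hj => IsWhitney.of_mem_whitney hj) y
      _ = _ := by ring
  have hgNm : ∀ N, Measurable (gN N) := fun N =>
    Finset.measurable_fun_sum _ fun j _ => measurable_pieceGood f ψ j
  have hgNhull : ∀ N y, gN N y ≠ 0 → y ∈ Q.hull.toSet := by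
    intro N y hne
    obtain ⟨j, hj, hjne⟩ := Finset.exists_ne_zero_of_sum_ne_zero hne
    exact (IsWhitney.of_mem_whitney hj).gridCube_subset (pieceGood_ne_zero hjne)
  choose N₀ hN₀ using fun y => exists_sum_pieceGood_eq (Q := Q) (F := F) hd f ψ y
  set g : Space d → ℝ := fun y => gN (N₀ y) y with hg
  have hglim : ∀ y, Filter.Tendsto (fun N => gN N y) Filter.atTop (nhds (g y)) := fun y =>
    tendsto_atTop_of_eventually_const (i₀ := N₀ y) fun N hN => hN₀ y N hN
  have hgm : Measurable g := measurable_of_tendsto_metrizable hgNm (tendsto_pi_nhds.mpr hglim)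
  -- the bounded part
  set G : Space d → ℝ := fun y => (closure F).indicator (fun y => f y * ψ y) y + g y with hG
  have hcl : MeasurableSet (closure F) := isClosed_closure.measurableSet
  have hGm : AEStronglyMeasurable G volume :=
    (hfψ.integrable.aestronglyMeasurable.indicator hcl).add hgm.aestronglyMeasurable
  have hGb : ∀ᵐ y ∂(volume : Measure (Space d)), |G y| ≤ C * μ := by
    filter_upwards [hleb Q f hf.integrable.locallyIntegrable μ F hFQ hM] with y hy
    have h1 : |(closure F).indicator (fun y => f y * ψ y) y| ≤ C₃ * μ := by
      by_cases hyF : y ∈ closure F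
      · rw [Set.indicator_of_mem hyF, abs_mul]
        exact (mul_le_of_le_one_right (abs_nonneg _) (hψ.abs_le_one y)).trans (hy hyF)
      · rw [Set.indicator_of_notMem hyF, abs_zero]; positivity
    calc |G y| ≤ C₃ * μ + C₁ * (2 * 5 ^ d) * μ := (abs_add_le _ _).trans (add_le_add h1 (hgNb _ _))
      _ ≤ C * μ := by
          rw [hC, add_mul, add_mul]
          have : 0 ≤ C₂ * (5 * d ^ 2) ^ (d + 1) * (μ : ℝ) := by positivity
          linarith
  have hGhull : ∀ y, G y ≠ 0 → y ∈ Q.hull.toSet := by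
    intro y hy
    by_contra hne
    refine hy ?_
    have h1 : ψ y = 0 := by
      by_contra h; exact hne (triple_subset_hull (hψ.mem_triple y h))
    have h2 : g y = 0 := by
      by_contra h; exact hne (hgNhull _ y h)
    simp [hG, h2, h1]
  have hGL : IsLinftyC G := isLinftyC_of_bound hGm hGb (c := Q.hull.corner)
    (R := d * Q.hull.side) fun y hy => norm_sub_corner_le (hGhull y hy)
  refine ⟨G, hGL, hGb, hGhull, fun E x₀ hE => ?_⟩
  -- pieces are far from `E`
  have hfar : ∀ x ∈ E, ∀ j, Q.IsWhitney F j → ∀ y₀, ψ y₀ * Q.pieceBump j y₀ ≠ 0 →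
      20 * d * Q.scale j.1 ≤ ‖x - y₀‖ := by
    intro x hx j hj y₀ hy₀
    have h1 := (hE x hx y₀ (left_ne_zero_of_mul hy₀)).1
    have hsc := Q.scale_pos j.1
    have h2 := (hj.infDist_of_norm_le hd (y := y₀)
      ((pieceBump_ne_zero (right_ne_zero_of_mul hy₀)).trans (by nlinarith))).1
    have h3 : 3 * (d : ℝ) * (20 * d * Q.scale j.1) ≤ 3 * d * ‖x - y₀‖ := by
      calc _ = 60 * (d : ℝ) ^ 2 * Q.scale j.1 := by ring
        _ ≤ _ := h2.trans h1
    exact le_of_mul_le_mul_left h3 (by positivity)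
  have hmass0 : ∀ j, (∀ y, ψ y * Q.pieceBump j y = 0) → ∀ y, Q.pieceGood f ψ j y = 0 := by
    intro j hj y
    have : Q.pieceMass f ψ j = 0 := by simp [pieceMass, hj]
    simp [pieceGood, this]
  constructor
  · intro x hx y hy
    by_cases h1 : (closure F).indicator (fun y => f y * ψ y) y = 0
    · have h2 : gN (N₀ y) y ≠ 0 := fun h => hy (by simp only [hG, h1, zero_add]; exact h)
      obtain ⟨j, hj, hjne⟩ := Finset.exists_ne_zero_of_sum_ne_zero h2
      have hjw := IsWhitney.of_mem_whitney hj
      have h3 : ∃ y₀, ψ y₀ * Q.pieceBump j y₀ ≠ 0 := by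
        by_contra! hcon
        exact hjne (hmass0 j hcon y)
      obtain ⟨y₀, hy₀⟩ := h3
      refine ⟨y₀, left_ne_zero_of_mul hy₀, ?_⟩
      have h4 := hfar x hx j hjw y₀ hy₀
      have h5 := pieceBump_ne_zero (right_ne_zero_of_mul hy₀)
      have h6 := norm_sub_gridCenter_le_of_mem_gridCube (pieceGood_ne_zero hjne)
      have h7 := norm_add_le (x - y) (y - Q.gridCenter j.1 j.2.1 - (y₀ - Q.gridCenter j.1 j.2.1))
      have h8 := _root_.norm_sub_le (y - Q.gridCenter j.1 j.2.1) (y₀ - Q.gridCenter j.1 j.2.1)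
      have e : x - y + (y - Q.gridCenter j.1 j.2.1 - (y₀ - Q.gridCenter j.1 j.2.1)) = x - y₀ := by
        abel
      rw [e] at h7
      have hsc := Q.scale_pos j.1
      have : 0 < d * Q.scale j.1 := by positivity
      linarith
    · have h2 : ψ y ≠ 0 := by
        intro h; exact h1 (by simp [h])
      exact ⟨y, h2, by linarith [norm_nonneg (x - y)]⟩
  -- the remainder after subtracting finitely many cancellative pieces
  set bN : ℕ → Space d → ℝ := fun N y => ∑ j ∈ Q.whitney F N, Q.pieceBad f ψ j y with hbN
  set hN : ℕ → Space d → ℝ := fun N y => f y * ψ y - G y - bN N y with hhN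
  have hbad2 : ∀ j, MemLp (Q.pieceBad f ψ j) 2 (volume : Measure (Space d)) := fun j =>
    (isLinftyC_pieceBad hf hψ.continuous j).memLp_two
  have hbN2 : ∀ N, MemLp (bN N) 2 (volume : Measure (Space d)) := fun N =>
    memLp_finsetSum _ fun j _ => hbad2 j
  have hdiff2 : MemLp (fun y => f y * ψ y - G y) 2 (volume : Measure (Space d)) :=
    hfψ.memLp_two.sub hGL.memLp_two
  have hhN2 : ∀ N, MemLp (hN N) 2 (volume : Measure (Space d)) := fun N => hdiff2.sub (hbN2 N)
  have hformula : ∀ N y, hN N y = f y * ψ y * (1 - Q.farPart F N y -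
      (closure F).indicator (fun _ => 1) y) + (gN N y - g y) := by
    intro N y
    have h1 : bN N y = f y * ψ y * Q.farPart F N y - gN N y := by
      simp only [hbN, hgN, pieceBad, Finset.sum_sub_distrib]
      congr 1
      by_cases h0 : ψ y = 0
      · simp [h0]
      · rw [← sum_whitney_pieceBump hd hF hFQ N (hψ.mem_triple y h0), Finset.mul_sum]
        exact Finset.sum_congr rfl fun j _ => by ring
    have h2 : (closure F).indicator (fun y => f y * ψ y) y =
        f y * ψ y * (closure F).indicator (fun _ => 1) y := by
      by_cases hy : y ∈ closure F <;> simp [hy]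
    simp only [hhN, hG, h1, h2]
    ring
  obtain ⟨Cf, hCf0, hCf⟩ := hf.exists_ae_bound
  have hto : Filter.Tendsto (fun N => eLpNorm (hN N) 2 volume) Filter.atTop (nhds 0) := by
    refine tendsto_eLpNorm_two_of_bounded (fun N => (hhN2 N).1)
      (C := Cf + (C₁ * (2 * 5 ^ d) * μ + C₁ * (2 * 5 ^ d) * μ)) (fun N => ?_)
      (c := Q.hull.corner) (R := d * Q.hull.side) (fun N y hne => ?_) (fun y => ?_)
    · filter_upwards [hCf] with y hy
      rw [hformula]
      refine (abs_add_le _ _).trans (add_le_add ?_ ((abs_sub _ _).trans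
        (add_le_add (hgNb N y) (hgNb _ y))))
      by_cases h0 : ψ y = 0
      · simpa [h0] using hCf0
      · rw [abs_mul, abs_mul]
        have h1 := farPart_mem_Icc (F := F) N (hψ.mem_triple y h0)
        have h2 : |1 - Q.farPart F N y - (closure F).indicator (fun _ => (1 : ℝ)) y| ≤ 1 := by
          by_cases hyF : y ∈ closure F
          · rw [farPart_eq_zero_of_mem_closure hd N hyF]; simp [hyF]
          · rw [Set.indicator_of_notMem hyF, abs_le]
            constructor <;> linarith
        calc |f y| * |ψ y| * _ ≤ Cf * 1 * 1 := by
              gcongr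
              exact hψ.abs_le_one y
          _ = Cf := by ring
    · refine norm_sub_corner_le ?_
      by_contra hy
      refine hne ?_
      rw [hformula]
      have h1 : ψ y = 0 := by
        by_contra h; exact hy (triple_subset_hull (hψ.mem_triple y h))
      have h2 : ∀ N, gN N y = 0 := fun N => by
        by_contra h; exact hy (hgNhull _ y h)
      simp [h1, hg, h2]
    · have h1 : Filter.Tendsto (fun N => f y * ψ y * (1 - Q.farPart F N y -
          (closure F).indicator (fun _ => 1) y)) Filter.atTop (nhds 0) := by
        by_cases h0 : ψ y = 0
        · simp [h0]
        · refine tendsto_const_nhds.congr' ?_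
          by_cases hyF : y ∈ closure F
          · refine Filter.Eventually.of_forall fun N => ?_
            simp [farPart_eq_zero_of_mem_closure hd N hyF, hyF]
          · filter_upwards [eventually_farPart_eq_one hF (hψ.mem_triple y h0) hyF] with N hN
            simp [hN, hyF]
      have h2 := (hglim y).sub_const (g y)
      rw [sub_self] at h2
      have h3 := h1.add h2
      rw [add_zero] at h3
      exact h3.congr fun N => (hformula N y).symm
  obtain ⟨ns, -, hns⟩ := exists_subseq_applyOp_tendsto (T := T) hhN2 hto
  -- the pointwise bound for the pieces
  have hpt : ∀ᵐ x ∂(volume : Measure (Space d)), ∀ j : PieceIndex d,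
      x ∉ tsupport (Q.pieceBad f ψ j) →
        applyOp T (Q.pieceBad f ψ j) x = ∫ y, K x y * Q.pieceBad f ψ j y := by
    refine ae_all_iff.mpr fun j => ?_
    have h1 := hT _ (isLinftyC_pieceBad (Q := Q) hf hψ.continuous j)
    rw [applyOp_eq (hbad2 j)]
    exact h1
  have hsumb : ∀ᵐ x ∂(volume : Measure (Space d)), ∀ N,
      applyOp T (fun y => f y * ψ y) x - applyOp T G x =
        applyOp T (hN N) x + ∑ j ∈ Q.whitney F N, applyOp T (Q.pieceBad f ψ j) x := by
    refine ae_all_iff.mpr fun N => ?_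
    filter_upwards [applyOp_sub (T := T) hfψ.memLp_two hGL.memLp_two,
      applyOp_sub (T := T) hdiff2 (hbN2 N),
      applyOp_sum (T := T) (Q.whitney F N) (b := Q.pieceBad f ψ) fun j _ => hbad2 j]
      with x h1 h2 h3
    rw [← h1, ← h3]
    have h4 : applyOp T (hN N) x =
      applyOp T (fun y => f y * ψ y - G y) x - applyOp T (bN N) x := h2
    rw [h4, sub_add_cancel]
  filter_upwards [hns, hpt, hsumb] with x hx1 hx2 hx3 hxE
  have hpiece : ∀ j, Q.IsWhitney F j → ‖applyOp T (Q.pieceBad f ψ j) x‖ₑ ≤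
      ENNReal.ofReal (C * μ) *
        ENNReal.ofReal (decay δ (Q.scale j.1) (x₀ x) (Q.gridCenter j.1 j.2.1)) := by
    intro j hj
    have hsc := Q.scale_pos j.1
    have hdsc : 0 < d * Q.scale j.1 := by positivity
    by_cases hz : ∀ y, ψ y * Q.pieceBump j y = 0
    · have h0 : Q.pieceBad f ψ j = fun _ => 0 := by
        ext y; simp [pieceBad, hz, hmass0 j hz y]
      have := hx2 j (by rw [h0]; simp [tsupport])
      rw [this]
      simp [h0]
    · push Not at hz
      obtain ⟨y₀, hy₀⟩ := hz
      have h4 := hfar x hxE j hj y₀ hy₀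
      have h5 := pieceBump_ne_zero (right_ne_zero_of_mul hy₀)
      have h6 := norm_add_le (x - Q.gridCenter j.1 j.2.1) (Q.gridCenter j.1 j.2.1 - y₀)
      rw [sub_add_sub_cancel, norm_sub_rev (Q.gridCenter j.1 j.2.1) y₀] at h6
      have h7 : 19 * d * Q.scale j.1 ≤ ‖x - Q.gridCenter j.1 j.2.1‖ := by linarith
      have hnt : x ∉ tsupport (Q.pieceBad f ψ j) := by
        intro hmem
        have hsub : tsupport (Q.pieceBad f ψ j) ⊆
            Metric.closedBall (Q.gridCenter j.1 j.2.1) (d * Q.scale j.1) :=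
          closure_minimal (fun y hy => by
            rw [Metric.mem_closedBall, dist_eq_norm]; exact pieceBad_ne_zero hy)
            Metric.isClosed_closedBall
        have := hsub hmem
        rw [Metric.mem_closedBall, dist_eq_norm] at this
        linarith
      rw [hx2 j hnt, Real.enorm_eq_ofReal_abs, ← ENNReal.ofReal_mul (by positivity)]
      refine ENNReal.ofReal_le_ofReal ?_
      refine (hbad Q f hf μ F hF hFQ hM ψ hψ j hj x h7).trans ?_
      have h8 : decay δ (Q.scale j.1) x (Q.gridCenter j.1 j.2.1) ≤ (5 * (d : ℝ) ^ 2) ^ (d + 1) *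
          decay δ (Q.scale j.1) (x₀ x) (Q.gridCenter j.1 j.2.1) := by
        refine decay_le_mul_decay hsc hsc hδ.le hδ1 (by nlinarith) ?_
        have h9 := (hE x hxE y₀ (left_ne_zero_of_mul hy₀)).2
        have h10 := norm_add_le (x₀ x - x) (x - Q.gridCenter j.1 j.2.1)
        rw [sub_add_sub_cancel] at h10
        have h11 : ‖x₀ x - Q.gridCenter j.1 j.2.1‖ ≤
            (1 + 2 * d) * ‖x - Q.gridCenter j.1 j.2.1‖ + 2 * d ^ 2 * Q.scale j.1 := by
          have : 2 * (d : ℝ) * ‖x - y₀‖ ≤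
              2 * d * (‖x - Q.gridCenter j.1 j.2.1‖ + d * Q.scale j.1) := by
            gcongr; linarith
          calc _ ≤ 2 * (d : ℝ) * (‖x - Q.gridCenter j.1 j.2.1‖ + d * Q.scale j.1) +
                ‖x - Q.gridCenter j.1 j.2.1‖ := by linarith
            _ = _ := by ring
        have h12 : (1 + 2 * (d : ℝ)) * ‖x - Q.gridCenter j.1 j.2.1‖ ≤
            5 * d ^ 2 * ‖x - Q.gridCenter j.1 j.2.1‖ := by
          gcongr; nlinarith
        have h13 : 1 * Q.scale j.1 ≤ d ^ 2 * Q.scale j.1 := by gcongr; nlinarith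
        have h14 : Q.scale j.1 + ‖x₀ x - Q.gridCenter j.1 j.2.1‖ ≤
            5 * d ^ 2 * (Q.scale j.1 + ‖x - Q.gridCenter j.1 j.2.1‖) := by
          rw [mul_add]; nlinarith
        calc _ ≤ Q.scale j.1 * (5 * d ^ 2 * (Q.scale j.1 + ‖x - Q.gridCenter j.1 j.2.1‖)) := by
              gcongr
          _ = _ := by ring
      have hdec := decay_nonneg (δ := δ) hsc.le (x₀ x) (Q.gridCenter j.1 j.2.1)
      calc _ ≤ C₂ * μ * ((5 * (d : ℝ) ^ 2) ^ (d + 1) *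
            decay δ (Q.scale j.1) (x₀ x) (Q.gridCenter j.1 j.2.1)) := by gcongr
        _ = C₂ * (5 * d ^ 2) ^ (d + 1) * μ *
            decay δ (Q.scale j.1) (x₀ x) (Q.gridCenter j.1 j.2.1) := by ring
        _ ≤ _ := by
            gcongr
            rw [hC]
            have : 0 < C₃ + C₁ * (2 * 5 ^ d) := by positivity
            linarith
  have hsum : ∀ N, ∑ j ∈ Q.whitney F N, ‖applyOp T (Q.pieceBad f ψ j) x‖ₑ ≤
      ENNReal.ofReal (C * μ) * Q.marcinkiewicz F δ (x₀ x) := by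
    intro N
    calc _ ≤ ∑ j ∈ Q.whitney F N, ENNReal.ofReal (C * μ) *
          ENNReal.ofReal (decay δ (Q.scale j.1) (x₀ x) (Q.gridCenter j.1 j.2.1)) :=
          Finset.sum_le_sum fun j hj => hpiece j (IsWhitney.of_mem_whitney hj)
      _ = ENNReal.ofReal (C * μ) * ∑ j ∈ Q.whitney F N, {j | Q.IsWhitney F j}.indicator
          (fun j => ENNReal.ofReal (decay δ (Q.scale j.1) (x₀ x) (Q.gridCenter j.1 j.2.1))) j := by
          rw [Finset.mul_sum]
          refine Finset.sum_congr rfl fun j hj => ?_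
          rw [Set.indicator_of_mem]
          exact IsWhitney.of_mem_whitney hj
      _ ≤ _ := by
          gcongr
          refine (ENNReal.sum_le_tsum _).trans (le_of_eq ?_)
          exact (tsum_subtype {j | Q.IsWhitney F j} (fun j =>
            ENNReal.ofReal (decay δ (Q.scale j.1) (x₀ x) (Q.gridCenter j.1 j.2.1)))).symm
  have hlim : Filter.Tendsto (fun i => ‖applyOp T (hN (ns i)) x‖ₑ +
      ENNReal.ofReal (C * μ) * Q.marcinkiewicz F δ (x₀ x)) Filter.atTop
      (nhds (0 + ENNReal.ofReal (C * μ) * Q.marcinkiewicz F δ (x₀ x))) := by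
    refine Filter.Tendsto.add ?_ tendsto_const_nhds
    have := (continuous_enorm.tendsto _).comp hx1
    simpa [Function.comp_def] using this
  rw [zero_add] at hlim
  refine ge_of_tendsto' hlim fun i => ?_
  rw [hx3 (ns i)]
  refine (enorm_add_le _ _).trans ?_
  gcongr
  exact (enorm_sum_le _ _).trans (hsum (ns i))

end Cube

end CancellativeSparse

/-! ### Cutoffs adapted to the decomposition -/

namespace CancellativeSparse

variable {d : ℕ}

theorem SmoothAtScale.one_sub {m : ℕ} {δ L A : ℝ} {φ : Space d → ℝ} (hL : 0 < L)
    (h : SmoothAtScale m δ L A Set.univ φ) :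
    SmoothAtScale m δ L (1 + A) Set.univ (fun y => 1 - φ y) := by
  have hA := h.nonneg_of_mem (Set.mem_univ 0)
  have hφ : ContDiff ℝ m φ := contDiffOn_univ.mp h.contDiffOn
  have key : ∀ n ≤ m, ∀ y, iteratedFDeriv ℝ n (fun y => 1 - φ y) y =
      iteratedFDeriv ℝ n (fun _ : Space d => (1 : ℝ)) y - iteratedFDeriv ℝ n φ y := by
    intro n hn y
    exact fun_iteratedFDeriv_sub_apply contDiffAt_const
      ((hφ.contDiffAt).of_le (by exact_mod_cast hn))
  have hc : ∀ n (y y' : Space d), iteratedFDeriv ℝ n (fun _ : Space d => (1 : ℝ)) y =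
      iteratedFDeriv ℝ n (fun _ : Space d => (1 : ℝ)) y' := by
    intro n y y'
    rcases Nat.eq_zero_or_pos n with rfl | hn
    · ext v; simp
    · rw [iteratedFDeriv_const_of_ne hn.ne']; rfl
  refine ⟨contDiffOn_const.sub h.contDiffOn, fun n hn y _ => ?_, fun n hn y _ y' _ => ?_⟩
  · rw [key n hn]
    refine (norm_sub_le _ _).trans ?_
    rw [add_div]
    refine add_le_add ?_ (h.bound n hn y (Set.mem_univ y))
    rcases Nat.eq_zero_or_pos n with rfl | hn
    · simp
    · rw [iteratedFDeriv_const_of_ne hn.ne', Pi.zero_apply, norm_zero]; positivity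
  · rw [key n hn, key n hn, hc n y y', sub_sub_sub_cancel_left, norm_sub_rev]
    refine (h.holder n hn y (Set.mem_univ _) y' (Set.mem_univ _)).trans ?_
    gcongr; linarith

namespace Cube

variable {Q P : Cube d} {F : Set (Space d)} {s : ℝ}

/-- `P` is contained in `Q` and at most half as large. -/
structure IsHalf (P Q : Cube d) : Prop where
  side_le : P.side ≤ Q.side / 2
  corner_le : ∀ i, Q.corner i ≤ P.corner i
  add_side_le : ∀ i, P.corner i + P.side ≤ Q.corner i + Q.side

theorem IsHalf.subset (h : P.IsHalf Q) : P.toSet ⊆ Q.toSet := fun _ hy i =>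
  ⟨(h.corner_le i).trans (hy i).1, (hy i).2.trans_le (h.add_side_le i)⟩

theorem IsHalf.triple_subset (h : P.IsHalf Q) : P.triple.toSet ⊆ Q.triple.toSet := by
  intro y hy
  rw [mem_triple] at hy ⊢
  intro i
  have h1 := hy i
  have h2 := h.corner_le i
  have h3 := h.add_side_le i
  have h4 := h.side_le
  have h5 := Q.side_pos
  constructor <;> linarith

theorem IsHalf.cutoff_mul_cutoff (h : P.IsHalf Q) (y : Space d) :
    Q.cutoff y * P.cutoff y = P.cutoff y := by
  by_cases h0 : P.cutoff y = 0
  · simp [h0]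
  · rw [cutoff_eq_one fun i => ?_, one_mul]
    have h1 := cutoff_ne_zero h0 i
    have h2 := h.corner_le i
    have h3 := h.add_side_le i
    have h4 := h.side_le
    constructor <;> linarith

theorem half_side_le_norm_sub {x y : Space d} (hx : x ∈ P.toSet) (hy : P.cutoff y ≠ 1) :
    P.side / 2 ≤ ‖x - y‖ := by
  by_contra! hlt
  refine hy (cutoff_eq_one fun i => ?_)
  have h1 := (abs_apply_le_norm (x - y) i).trans_lt hlt
  rw [PiLp.sub_apply, abs_lt] at h1
  have h2 := hx i
  constructor <;> linarith

/-- The cutoff of `Q`, and its product with `1 - P.cutoff` for a small cube `P` that meets `F`, are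
adapted to `F`. -/
theorem exists_isAdapted (d : ℕ) (hd : 0 < d) (m : ℕ) {δ : ℝ} (hδ : 0 ≤ δ) (hδ1 : δ ≤ 1) :
    ∃ A : ℝ, ∀ (Q : Cube d) (F : Set (Space d)), Q.IsAdapted F m δ A Q.cutoff ∧
      ∀ P : Cube d, (F ∩ P.toSet).Nonempty →
        Q.IsAdapted F m δ A (fun y => Q.cutoff y * (1 - P.cutoff y)) := by
  obtain ⟨A₁, hA₁, hT, -, -⟩ := exists_smoothAtScale_profiles d m hδ hδ1
  have hd1 : (1 : ℝ) ≤ d := by exact_mod_cast hd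
  have hle : A₁ ≤ 2 ^ (m + 1) * A₁ * (1 + A₁) := by
    have : (1 : ℝ) ≤ 2 ^ (m + 1) := one_le_pow₀ (by norm_num)
    calc A₁ = 1 * A₁ * 1 := by ring
      _ ≤ _ := by gcongr; linarith
  have hQs : ∀ (Q : Cube d) (l : ℝ), 0 < l → l ≤ Q.side →
      SmoothAtScale m δ l A₁ Set.univ Q.cutoff := fun Q l hl hlQ =>
    (hT.comp_affine Q.side_pos Q.corner).mono_scale hl hlQ hδ
  refine ⟨2 ^ (m + 1) * A₁ * (1 + A₁), fun Q F => ⟨⟨Q.continuous_cutoff,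
    fun _ hy => mem_triple_of_cutoff_ne_zero hy, fun y => ?_, fun l hl hlQ c _ => ?_⟩,
    fun P hP => ⟨Q.continuous_cutoff.mul (continuous_const.sub P.continuous_cutoff),
      fun y hy => mem_triple_of_cutoff_ne_zero (left_ne_zero_of_mul hy), fun y => ?_,
      fun l hl hlQ c hc => ?_⟩⟩⟩
  · rw [abs_of_nonneg (Q.cutoff_mem_Icc y).1]; exact (Q.cutoff_mem_Icc y).2
  · exact ⟨Q.cutoff, (hQs Q l hl hlQ).mono_const hle hl, fun _ _ => rfl⟩
  · have h1 := Q.cutoff_mem_Icc y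
    have h2 := P.cutoff_mem_Icc y
    rw [abs_mul, abs_of_nonneg h1.1, abs_of_nonneg (by linarith : 0 ≤ 1 - P.cutoff y)]
    exact mul_le_one₀ h1.2 (by linarith) (by linarith)
  · by_cases hmeet : ∃ y, ‖y - c‖ ≤ d * l ∧ P.cutoff y ≠ 0
    · obtain ⟨y, hyc, hyP⟩ := hmeet
      obtain ⟨z, hzF, hzP⟩ := hP
      have h1 := hc y hyc
      have h2 : Metric.infDist y F ≤ dist y z := Metric.infDist_le_dist_of_mem hzF
      rw [dist_eq_norm] at h2
      have h3 := Cube.norm_sub_le (mem_triple_of_cutoff_ne_zero hyP) (P.toSet_subset_triple hzP)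
      have h4 : P.triple.side = 3 * P.side := rfl
      rw [h4] at h3
      have hlP : l ≤ P.side := by
        have h5 : 3 * (d : ℝ) * l ≤ 3 * d * P.side := by linarith
        exact le_of_mul_le_mul_left h5 (by positivity)
      exact ⟨_, (hQs Q l hl hlQ).mul isOpen_univ hl ((hQs P l hl hlP).one_sub hl), fun _ _ => rfl⟩
    · push Not at hmeet
      refine ⟨Q.cutoff, (hQs Q l hl hlQ).mono_const hle hl, fun y hy => ?_⟩
      rw [hmeet y hy, sub_zero, mul_one]

end Cube

/-! ### Distributional estimates -/

/-- Chebyshev's inequality at a level proportional to `a`, also for `a = 0`. -/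
theorem measure_lt_le_of_lintegral_le {g : Space d → ℝ≥0∞} (hg : AEMeasurable g volume)
    {c κ a : ℝ≥0} (hc : 0 < c) (hκ : 0 < κ) {V : ℝ≥0∞} (h : ∫⁻ x, g x ≤ c * a * V) :
    volume {x | ((c / κ : ℝ≥0) : ℝ≥0∞) * a < g x} ≤ κ * V := by
  rcases eq_or_ne a 0 with rfl | ha
  · simp only [ENNReal.coe_zero, mul_zero, zero_mul, nonpos_iff_eq_zero] at h ⊢
    rw [lintegral_eq_zero_iff' hg] at h
    have : volume {x | 0 < g x} = 0 := by
      exact measure_mono_null (fun x hx => (ne_of_gt hx : g x ≠ 0)) (ae_iff.mp h)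
    rw [this]; exact zero_le
  · have h1 := mul_meas_ge_le_lintegral₀ hg (((c / κ : ℝ≥0) : ℝ≥0∞) * a)
    have h2 : ((c / κ : ℝ≥0) : ℝ≥0∞) * a ≠ 0 := by
      rw [← ENNReal.coe_mul]
      exact ENNReal.coe_ne_zero.mpr (by positivity)
    have h3 : ((c / κ : ℝ≥0) : ℝ≥0∞) * a ≠ ∞ := by rw [← ENNReal.coe_mul]; exact ENNReal.coe_ne_top
    have h4 : (c : ℝ≥0∞) * a * V = ((c / κ : ℝ≥0) : ℝ≥0∞) * a * (κ * V) := by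
      have : (c : ℝ≥0∞) = ((c / κ : ℝ≥0) : ℝ≥0∞) * κ := by
        rw [← ENNReal.coe_mul, div_mul_cancel₀ _ hκ.ne']
      conv_lhs => rw [this]
      ring
    have h5 := (h1.trans h).trans_eq h4
    have h6 := (ENNReal.mul_le_mul_iff_right h2 h3).mp h5
    exact le_trans (measure_mono (Set.ofPred_subset_ofPred.mpr fun x hx => le_of_lt hx)) h6

namespace Cube

variable {s : ℝ}

/-- Weak type estimate for the Marcinkiewicz function. -/
theorem exists_measure_marcinkiewicz_le (hd : 0 < d) {δ : ℝ} (hδ : 0 < δ) {κ : ℝ≥0} (hκ : 0 < κ) :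
    ∃ C : ℝ≥0, ∀ (Q : Cube d) (F : Set (Space d)),
      volume {x | (C : ℝ≥0∞) < Q.marcinkiewicz F δ x} ≤ κ * volume Q.toSet := by
  set c : ℝ≥0 := Real.toNNReal (decayMass d δ) * (2 * 5 ^ d) * 4 ^ d + 1 with hc
  refine ⟨c / κ, fun Q F => ?_⟩
  have h := measure_lt_le_of_lintegral_le (measurable_marcinkiewicz (Q := Q) (F := F) hδ).aemeasurable
    (c := c) (κ := κ) (a := 1) (by positivity) hκ (V := volume Q.toSet) (by
      refine (lintegral_marcinkiewicz_le hd hδ).trans ?_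
      rw [ENNReal.coe_one, mul_one]
      gcongr
      rw [hc, ENNReal.coe_add, ENNReal.coe_mul, ENNReal.coe_mul]
      refine le_trans (le_of_eq ?_) le_self_add
      congr 1
      rw [ENNReal.ofReal_pow (by norm_num)]; simp)
  simpa using h

/-- Weak type estimate: on the part of `Q` where the maximal function is at most `μ`, the image
of the localized function exceeds a large multiple of `μ` on a small set only. -/
theorem exists_measure_applyOp_le (hs : 0 < s) (hd : 0 < d) {T : L2 d →L[ℝ] L2 d}
    {K : Space d → Space d → ℝ} {CK : ℝ} (hCK : 0 < CK) (hK : IsSmoothKernel s K CK)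
    (hT : ∀ (f : Space d → ℝ) (hf : IsLinftyC f),
      ∀ᵐ x ∂(volume : Measure (Space d)), x ∉ tsupport f →
        T (hf.memLp_two.toLp f) x = ∫ y, K x y * f y) {κ : ℝ≥0} (hκ : 0 < κ) :
    ∃ C : ℝ≥0, ∀ (Q : Cube d) (f : Space d → ℝ) (_ : IsLinftyC f) (μ : ℝ≥0)
      (F : Set (Space d)) (_ : F.Nonempty) (_ : F ⊆ Q.toSet)
      (_ : ∀ z ∈ F, smoothMaximal s Q.triple f z ≤ μ),
      volume {x | x ∈ F ∧ ((C : ℝ≥0∞) * μ) < ‖applyOp T (fun y => f y * Q.cutoff y) x‖ₑ} ≤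
        κ * volume Q.toSet := by
  obtain ⟨hms, hδ, hδ1⟩ := holderPart_mem hs
  obtain ⟨A, hA⟩ := exists_isAdapted d hd (intPart s) hδ.le hδ1
  obtain ⟨C₁, hC₁, hdec⟩ := exists_decomposition hs hd A hCK hK hT
  have hκ2 : 0 < κ / 2 := by positivity
  obtain ⟨C₂, hmar⟩ := exists_measure_marcinkiewicz_le hd hδ hκ2
  set C₁' : ℝ≥0 := C₁.toNNReal with hC₁'
  have hC₁c : ∀ μ : ℝ≥0, ENNReal.ofReal (C₁ * μ) = (C₁' : ℝ≥0∞) * μ := fun μ => by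
    rw [ENNReal.ofReal_mul hC₁.le, ENNReal.ofReal_coe_nnreal]; rfl
  set c : ℝ≥0 := ‖T‖₊ ^ 2 * C₁' ^ 2 * 4 ^ d + 1 with hc
  set t : ℝ≥0 := c / (κ / 2) + 1 with ht
  refine ⟨t + C₁' * C₂, fun Q f hf μ F hF hFQ hM => ?_⟩
  obtain ⟨G, hGL, hGb, hGh, hGE⟩ := hdec Q f hf μ F hF hFQ hM Q.cutoff (hA Q F).1
  have hae := (hGE F id fun x hx y _ => by
    constructor
    · have h1 : Metric.infDist y F ≤ dist y x := Metric.infDist_le_dist_of_mem hx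
      rw [dist_comm, dist_eq_norm] at h1
      have hd1 : (1 : ℝ) ≤ d := by exact_mod_cast hd
      have := norm_nonneg (x - y)
      nlinarith
    · simp only [id, sub_self, norm_zero]; positivity).2
  -- the set where the image of the bounded part is large
  have hL2 : ∫⁻ x, ‖applyOp T G x‖ₑ ^ 2 ≤ c * (μ ^ 2 : ℝ≥0) * volume Q.toSet := by
    have e : ∀ g : Space d → ℝ, ∫⁻ x, ‖g x‖ₑ ^ 2 = eLpNorm g 2 volume ^ 2 := by
      intro g
      have := eLpNorm_nnreal_pow_eq_lintegral (f := g) (μ := volume) (p := 2) (by norm_num)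
      simpa using this.symm
    have hGint : ∫⁻ x, ‖G x‖ₑ ^ 2 ≤ (C₁' * μ) ^ 2 * (4 ^ d * volume Q.toSet) := by
      calc ∫⁻ x, ‖G x‖ₑ ^ 2 ≤ ∫⁻ x, Q.hull.toSet.indicator (fun _ => ((C₁' : ℝ≥0∞) * μ) ^ 2) x := by
            refine lintegral_mono_ae ?_
            filter_upwards [hGb] with y hy
            by_cases h0 : G y = 0
            · simp [h0]
            · rw [Set.indicator_of_mem (hGh y h0), ← hC₁c, Real.enorm_eq_ofReal_abs]
              gcongr
        _ = _ := by
            rw [lintegral_indicator (measurableSet_toSet _), setLIntegral_const, volume_hull,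
              ENNReal.ofReal_pow (by norm_num)]
            simp
    calc _ = eLpNorm (applyOp T G) 2 volume ^ 2 := e _
      _ ≤ (‖T‖ₑ * eLpNorm G 2 volume) ^ 2 := by
          gcongr; exact eLpNorm_applyOp_le hGL.memLp_two
      _ = ‖T‖ₑ ^ 2 * ∫⁻ x, ‖G x‖ₑ ^ 2 := by rw [mul_pow, e]
      _ ≤ ‖T‖ₑ ^ 2 * ((C₁' * μ) ^ 2 * (4 ^ d * volume Q.toSet)) := by gcongr
      _ = (‖T‖ₑ ^ 2 * C₁' ^ 2 * 4 ^ d) * (μ ^ 2 : ℝ≥0) * volume Q.toSet := by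
          push_cast; ring
      _ ≤ _ := by
          gcongr
          rw [hc]; push_cast
          exact le_self_add
  have hTG := measure_lt_le_of_lintegral_le
    ((aestronglyMeasurable_applyOp (T := T) (f := G)).enorm.pow_const 2)
    (c := c) (a := μ ^ 2) (by positivity) hκ2 hL2
  have hsub : ∀ᵐ x ∂(volume : Measure (Space d)),
      (x ∈ F ∧ (((t + C₁' * C₂ : ℝ≥0) : ℝ≥0∞) * μ) < ‖applyOp T (fun y => f y * Q.cutoff y) x‖ₑ) →
      (((c / (κ / 2) : ℝ≥0) : ℝ≥0∞) * (μ ^ 2 : ℝ≥0) < ‖applyOp T G x‖ₑ ^ 2) ∨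
        ((C₂ : ℝ≥0∞) < Q.marcinkiewicz F (holderPart s) x) := by
    filter_upwards [hae] with x hx ⟨hxF, hlt⟩
    by_contra! hcon
    obtain ⟨h1, h2⟩ := hcon
    have h3 := hx hxF
    rw [hC₁c] at h3
    have h4 : ‖applyOp T G x‖ₑ ≤ t * μ := by
      have h5 : ‖applyOp T G x‖ₑ ^ 2 ≤ ((t : ℝ≥0∞) * μ) ^ 2 := by
        refine h1.trans ?_
        rw [mul_pow, ENNReal.coe_pow]
        gcongr
        rw [← ENNReal.coe_pow, ENNReal.coe_le_coe, ht]
        nlinarith [zero_le (a := c / (κ / 2))]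
      exact (ENNReal.pow_le_pow_left_iff two_ne_zero).mp h5
    have h6 : ‖applyOp T (fun y => f y * Q.cutoff y) x‖ₑ ≤
        ‖applyOp T (fun y => f y * Q.cutoff y) x - applyOp T G x‖ₑ + ‖applyOp T G x‖ₑ := by
      have := enorm_add_le (applyOp T (fun y => f y * Q.cutoff y) x - applyOp T G x)
        (applyOp T G x)
      rwa [sub_add_cancel] at this
    refine absurd hlt (not_lt.mpr (h6.trans ?_))
    calc _ ≤ (C₁' : ℝ≥0∞) * μ * C₂ + t * μ := by
          gcongr
          exact h3.trans (by gcongr; exact h2)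
      _ = _ := by push_cast; ring
  calc _ ≤ volume ({x | ((c / (κ / 2) : ℝ≥0) : ℝ≥0∞) * (μ ^ 2 : ℝ≥0) < ‖applyOp T G x‖ₑ ^ 2} ∪
        {x | (C₂ : ℝ≥0∞) < Q.marcinkiewicz F (holderPart s) x}) := measure_mono_ae hsub
    _ ≤ _ := measure_union_le _ _
    _ ≤ ((κ / 2 : ℝ≥0) : ℝ≥0∞) * volume Q.toSet + ((κ / 2 : ℝ≥0) : ℝ≥0∞) * volume Q.toSet :=
        add_le_add hTG (hmar Q F)
    _ = _ := by
        rw [← add_mul, ← ENNReal.coe_add, add_halves]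

end Cube

end CancellativeSparse

/-! ### One step of the stopping-time argument -/

namespace CancellativeSparse

variable {d : ℕ}

theorem smoothMaximal_mono {s : ℝ} {P Q : Cube d} (h : P.toSet ⊆ Q.toSet) {f : Space d → ℝ}
    (x : Space d) : smoothMaximal s P f x ≤ smoothMaximal s Q f x :=
  iSup_mono fun _ => iSup_mono' fun hR => ⟨hR.trans h, le_rfl⟩

theorem Cube.hasCompactSupport_cutoff (Q : Cube d) : HasCompactSupport Q.cutoff :=
  HasCompactSupport.of_support_subset_isCompact
    (isCompact_closedBall Q.triple.corner (d * Q.triple.side)) fun y hy => by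
      rw [Metric.mem_closedBall, dist_eq_norm]
      exact Cube.norm_sub_corner_le (Cube.mem_triple_of_cutoff_ne_zero hy)

/-- The kernel is integrable against bounded functions that vanish near `x`. -/
theorem integrable_kernel_mul {s : ℝ} {K : Space d → Space d → ℝ} {CK : ℝ}
    (hK : IsSmoothKernel s K CK) (hCK : 0 ≤ CK) {G : Space d → ℝ} (hG : IsLinftyC G)
    {x : Space d} {ρ : ℝ} (hρ : 0 < ρ) (h : ∀ y, G y ≠ 0 → ρ ≤ ‖x - y‖) :
    Integrable fun y => K x y * G y := by
  have hcont : ContinuousOn (K x) (Metric.ball x ρ)ᶜ := by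
    refine (hK.contDiffOn x).continuousOn.mono fun y hy => ?_
    rintro rfl
    exact hy (Metric.mem_ball_self hρ)
  have hm : AEStronglyMeasurable ((Metric.ball x ρ)ᶜ.indicator (K x)) volume :=
    (aestronglyMeasurable_indicator_iff Metric.isOpen_ball.measurableSet.compl).mpr
      (hcont.aestronglyMeasurable Metric.isOpen_ball.measurableSet.compl)
  have e : (fun y => K x y * G y) = fun y => (Metric.ball x ρ)ᶜ.indicator (K x) y * G y := by
    funext y
    by_cases hy : y ∈ (Metric.ball x ρ)ᶜ
    · rw [Set.indicator_of_mem hy]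
    · have : G y = 0 := by
        by_contra h0
        refine hy fun hb => ?_
        rw [Metric.mem_ball, dist_comm, dist_eq_norm] at hb
        exact absurd (h y h0) (not_le.mpr hb)
      simp [this]
  rw [e]
  refine hG.integrable.bdd_mul hm (c := CK / ρ ^ d) (Filter.Eventually.of_forall fun y => ?_)
  by_cases hy : y ∈ (Metric.ball x ρ)ᶜ
  · rw [Set.indicator_of_mem hy, Real.norm_eq_abs]
    have hxy : ρ ≤ ‖x - y‖ := by
      rw [← dist_eq_norm, dist_comm]
      simpa using hy
    have hne : x ≠ y := by rintro rfl; simp at hxy; linarith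
    refine (hK.abs_le hne).trans ?_
    gcongr
  · rw [Set.indicator_of_notMem hy, norm_zero]; positivity

namespace Cube

variable {s : ℝ}

/-- The image of a bounded function that vanishes near a cube has bounded oscillation on that
cube. -/
theorem exists_abs_integral_kernel_sub_le (hs : 0 < s) (hd : 0 < d)
    {K : Space d → Space d → ℝ} {CK : ℝ} (hCK : 0 < CK) (hK : IsSmoothKernel s K CK) :
    ∃ C : ℝ, 0 < C ∧ ∀ (P : Cube d) (G : Space d → ℝ) (_ : IsLinftyC G) (b : ℝ)
      (_ : ∀ᵐ y ∂(volume : Measure (Space d)), |G y| ≤ b)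
      (_ : ∀ x ∈ P.toSet, ∀ y, G y ≠ 0 → P.side / 4 ≤ ‖x - y‖),
      ∀ x ∈ P.toSet, ∀ x' ∈ P.toSet,
        |(∫ y, K x y * G y) - ∫ y, K x' y * G y| ≤ C * b := by
  obtain ⟨-, hδ, -⟩ := holderPart_mem hs
  set δ := holderPart s with hδdef
  have hd1 : (1 : ℝ) ≤ d := by exact_mod_cast hd
  have hmass := decayMass_nonneg d δ
  refine ⟨2 * CK * (4 * d) ^ d * 3 ^ (d + 1) * decayMass d δ + 1, by positivity,
    fun P G hG b hb hsep x hx x' hx' => ?_⟩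
  have hP := P.side_pos
  set t : ℝ := d * P.side with ht
  have ht0 : 0 < t := by positivity
  have hb0 : 0 ≤ b := by
    obtain ⟨y, hy⟩ := hb.exists
    exact (abs_nonneg _).trans hy
  have i1 := integrable_kernel_mul hK hCK.le hG (by positivity) (hsep x hx)
  have i2 := integrable_kernel_mul hK hCK.le hG (by positivity) (hsep x' hx')
  set c : ℝ := 2 * CK * (4 * d) ^ d * 3 ^ (d + 1) / t ^ d with hc
  have hc0 : 0 ≤ c := by positivity
  have i3 : Integrable fun y => c * b * decay δ t y x := (integrable_decay hδ ht0 x).const_mul _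
  rw [← integral_sub i1 i2]
  have hle : |∫ y, (K x y * G y - K x' y * G y)| ≤ ∫ y, c * b * decay δ t y x := by
    refine norm_integral_le_of_norm_le (f := fun y => K x y * G y - K x' y * G y) i3 ?_
    filter_upwards [hb] with y hy
    have hdec := decay_nonneg (d := d) (δ := δ) ht0.le y x
    by_cases h0 : G y = 0
    · simp only [h0, mul_zero, sub_zero, norm_zero]; positivity
    · have h1 := hsep x hx y h0
      have h2 := hsep x' hx' y h0
      rw [← sub_mul, Real.norm_eq_abs, abs_mul]
      have h3 := IsSmoothKernel.abs_sub_left_le hs hCK.le hK (x := x) (x' := x') (y := y) (c := 4 * d) ht0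
        (by linarith) (Cube.norm_sub_le hx' hx) (by rw [ht]; nlinarith) (by rw [ht]; nlinarith)
      rw [decay_comm] at h3
      calc _ ≤ (c * decay δ t y x) * b := by gcongr
        _ = _ := by ring
  refine hle.trans ?_
  rw [integral_const_mul, integral_decay ht0]
  calc c * b * (t ^ d * decayMass d δ)
      = (2 * CK * (4 * d) ^ d * 3 ^ (d + 1) * decayMass d δ) * b := by rw [hc]; field_simp
    _ ≤ _ := by gcongr; linarith

/-- **One step of the stopping-time argument.** Outside a small exceptional set `B` the image of
the localized function is pointwise controlled by the level `μ`; on a smaller cube that is not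
mostly contained in `B` it is controlled up to the image of the function localized to that cube. -/
theorem exists_exceptional_set (hs : 0 < s) (hd : 0 < d) {T : L2 d →L[ℝ] L2 d}
    {K : Space d → Space d → ℝ} {CK : ℝ} (hCK : 0 < CK) (hK : IsSmoothKernel s K CK)
    (hT : ∀ (f : Space d → ℝ) (hf : IsLinftyC f),
      ∀ᵐ x ∂(volume : Measure (Space d)), x ∉ tsupport f →
        T (hf.memLp_two.toLp f) x = ∫ y, K x y * f y) {κ : ℝ≥0} (hκ : 0 < κ) (hκ4 : κ ≤ 1 / 4) :
    ∃ C : ℝ≥0, 0 < C ∧ ∀ (Q : Cube d) (f : Space d → ℝ) (_ : IsLinftyC f) (μ : ℝ≥0)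
      (_ : volume {x | x ∈ Q.toSet ∧ (μ : ℝ≥0∞) < smoothMaximal s Q.triple f x} ≤
        κ * volume Q.toSet),
      ∃ B : Set (Space d), MeasurableSet B ∧ volume B ≤ 3 * κ * volume Q.toSet ∧
        (∀ᵐ x ∂(volume : Measure (Space d)), x ∈ Q.toSet → x ∉ B →
          ‖applyOp T (fun y => f y * Q.cutoff y) x‖ₑ ≤ C * μ) ∧
        ∀ P : Cube d, P.IsHalf Q → volume (B ∩ P.toSet) ≤ volume P.toSet / 4 →
          ∀ᵐ x ∂(volume : Measure (Space d)), x ∈ P.toSet →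
            ‖applyOp T (fun y => f y * Q.cutoff y) x‖ₑ ≤
              C * μ + ‖applyOp T (fun y => f y * P.cutoff y) x‖ₑ := by
  obtain ⟨hms, hδ, hδ1⟩ := holderPart_mem hs
  have hd1 : (1 : ℝ) ≤ d := by exact_mod_cast hd
  obtain ⟨A, hA⟩ := exists_isAdapted d hd (intPart s) hδ.le hδ1
  obtain ⟨C₀, hC₀, hdec⟩ := exists_decomposition hs hd A hCK hK hT
  obtain ⟨C₁, hweak⟩ := exists_measure_applyOp_le hs hd hCK hK hT hκ
  obtain ⟨C₂, hmar⟩ := exists_measure_marcinkiewicz_le hd hδ hκ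
  obtain ⟨C₃, hC₃, hosc⟩ := exists_abs_integral_kernel_sub_le hs hd hCK hK
  lift C₀ to ℝ≥0 using hC₀.le
  lift C₃ to ℝ≥0 using hC₃.le
  refine ⟨2 * C₁ + 2 * (C₀ * C₂) + C₃ * C₀ + 1, by positivity, fun Q f hf μ hμ => ?_⟩
  set M := smoothMaximal s Q.triple f with hMdef
  set F : Set (Space d) := {x | x ∈ Q.toSet ∧ M x ≤ μ} with hF
  have hFM : ∀ z ∈ F, M z ≤ μ := fun z hz => hz.2
  have hFQ : F ⊆ Q.toSet := fun z hz => hz.1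
  have hFne : F.Nonempty := by
    by_contra hne
    have h1 : Q.toSet ⊆ {x | x ∈ Q.toSet ∧ (μ : ℝ≥0∞) < M x} := fun x hx =>
      ⟨hx, by by_contra hc; exact hne ⟨x, hx, not_lt.mp hc⟩⟩
    have h2 := (measure_mono h1).trans hμ
    have h3 : (κ : ℝ≥0∞) * volume Q.toSet < 1 * volume Q.toSet := by
      refine ENNReal.mul_lt_mul_left (volume_toSet_ne_zero Q) (volume_toSet_ne_top Q) ?_
      rw [ENNReal.coe_lt_one_iff]
      refine hκ4.trans_lt ?_
      rw [← NNReal.coe_lt_coe]; norm_num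
    rw [one_mul] at h3
    exact absurd h2 (not_le.mpr h3)
  set B₀ : Set (Space d) := {x | x ∈ Q.toSet ∧ (μ : ℝ≥0∞) < M x} ∪
    ({x | x ∈ F ∧ ((C₁ : ℝ≥0∞) * μ) < ‖applyOp T (fun y => f y * Q.cutoff y) x‖ₑ} ∪
      {x | (C₂ : ℝ≥0∞) < Q.marcinkiewicz F (holderPart s) x}) with hB₀
  have hB₀v : volume B₀ ≤ 3 * κ * volume Q.toSet := by
    calc volume B₀ ≤ _ + (_ + _) := (measure_union_le _ _).trans (by
            gcongr; exact measure_union_le _ _)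
      _ ≤ κ * volume Q.toSet + (κ * volume Q.toSet + κ * volume Q.toSet) :=
          add_le_add hμ (add_le_add (hweak Q f hf μ F hFne hFQ hFM) (hmar Q F))
      _ = _ := by ring
  have hgood : ∀ x ∈ Q.toSet, x ∉ toMeasurable volume B₀ → x ∈ F ∧
      ‖applyOp T (fun y => f y * Q.cutoff y) x‖ₑ ≤ C₁ * μ ∧
        Q.marcinkiewicz F (holderPart s) x ≤ C₂ := by
    intro x hxQ hx
    have h1 : x ∉ B₀ := fun h => hx (subset_toMeasurable _ _ h)
    simp only [hB₀, Set.mem_union, Set.mem_ofPred_eq, not_or, not_and, not_lt] at h1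
    have hxF : x ∈ F := ⟨hxQ, h1.1 hxQ⟩
    exact ⟨hxF, h1.2.1 hxF, h1.2.2⟩
  refine ⟨toMeasurable volume B₀, measurableSet_toMeasurable _ _, by rwa [measure_toMeasurable],
    Filter.Eventually.of_forall fun x hxQ hx => ?_, fun P hPQ hPB => ?_⟩
  · refine (hgood x hxQ hx).2.1.trans ?_
    gcongr
    rw [← NNReal.coe_le_coe]; push_cast
    have : (0 : ℝ) ≤ C₁ + 2 * (C₀ * C₂) + C₃ * C₀ := by positivity
    linarith
  set B := toMeasurable volume B₀ with hB
  have hPQs := hPQ.subset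
  have hPs := P.side_pos
  have hP0 := volume_toSet_ne_zero P
  have hPt := volume_toSet_ne_top P
  -- a good point of `P`, at which the Marcinkiewicz function is evaluated
  obtain ⟨x₁, hx₁P, hx₁B⟩ : ∃ x ∈ P.toSet, x ∉ B := by
    by_contra! hcon
    rw [Set.inter_eq_right.mpr hcon] at hPB
    refine absurd hPB (not_le.mpr ?_)
    exact ENNReal.div_lt_of_lt_mul (by
      calc volume P.toSet = volume P.toSet * 1 := (mul_one _).symm
        _ < volume P.toSet * 4 := ENNReal.mul_lt_mul_right hP0 hPt (by norm_num))
  obtain ⟨hx₁F, -, hx₁m⟩ := hgood x₁ (hPQs hx₁P) hx₁B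
  obtain ⟨G, hG, hGb, -, hGE⟩ := hdec Q f hf μ F hFne hFQ hFM _ ((hA Q F).2 P ⟨x₁, hx₁F, hx₁P⟩)
  have hsep : ∀ x ∈ P.toSet, ∀ y, Q.cutoff y * (1 - P.cutoff y) ≠ 0 → P.side / 2 ≤ ‖x - y‖ :=
    fun x hx y hy => half_side_le_norm_sub hx fun h => hy (by rw [h, sub_self, mul_zero])
  obtain ⟨hGsup, hGae⟩ := hGE P.toSet (fun _ => x₁) fun x hx y hy => by
    have h1 := hsep x hx y hy
    have h2 := Cube.norm_sub_le hx₁P hx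
    have h3 : Metric.infDist y F ≤ dist y x₁ := Metric.infDist_le_dist_of_mem hx₁F
    have h4 : dist y x₁ ≤ ‖x - y‖ + ‖x₁ - x‖ := by
      rw [dist_eq_norm, show y - x₁ = -((x - y) + (x₁ - x)) by abel, norm_neg]
      exact norm_add_le _ _
    constructor <;> nlinarith
  have hGsep : ∀ x ∈ P.toSet, ∀ y, G y ≠ 0 → P.side / 4 ≤ ‖x - y‖ := fun x hx y hy => by
    obtain ⟨y₀, hy₀, h⟩ := hGsup x hx y hy
    have := hsep x hx y₀ hy₀
    linarith
  have hGts : ∀ x ∈ P.toSet, x ∉ tsupport G := by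
    intro x hx hxt
    have hcl : tsupport G ⊆ {y | P.side / 4 ≤ ‖x - y‖} :=
      closure_minimal (fun y hy => hGsep x hx y hy)
        (isClosed_le continuous_const (by fun_prop))
    have h1 : P.side / 4 ≤ ‖x - x‖ := hcl hxt
    rw [sub_self, norm_zero] at h1
    linarith
  have hsplit : ∀ᵐ x ∂(volume : Measure (Space d)),
      applyOp T (fun y => f y * (Q.cutoff y * (1 - P.cutoff y))) x =
        applyOp T (fun y => f y * Q.cutoff y) x - applyOp T (fun y => f y * P.cutoff y) x := by
    have e : (fun y => f y * (Q.cutoff y * (1 - P.cutoff y))) =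
        fun y => f y * Q.cutoff y - f y * P.cutoff y := by
      funext y
      rw [mul_one_sub, hPQ.cutoff_mul_cutoff, mul_sub]
    rw [e]
    exact applyOp_sub (hf.mul_continuous Q.continuous_cutoff Q.hasCompactSupport_cutoff).memLp_two
      (hf.mul_continuous P.continuous_cutoff P.hasCompactSupport_cutoff).memLp_two
  set D : Space d → ℝ := fun x =>
    applyOp T (fun y => f y * Q.cutoff y) x - applyOp T (fun y => f y * P.cutoff y) x with hD
  have hDae : ∀ᵐ x ∂(volume : Measure (Space d)), x ∈ P.toSet →
      ‖D x - ∫ y, K x y * G y‖ₑ ≤ C₀ * μ * C₂ := by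
    filter_upwards [hGae, hsplit, hT G hG] with x h1 h2 h3 hx
    have h4 := h1 hx
    rw [h2, applyOp_eq hG.memLp_two, h3 (hGts x hx)] at h4
    refine h4.trans ?_
    rw [← NNReal.coe_mul, ENNReal.ofReal_coe_nnreal, ENNReal.coe_mul]
    gcongr
  -- a good point of `P` for both localizations
  obtain ⟨x₂, hx₂P, hx₂D, hx₂B, hx₂w⟩ : ∃ x ∈ P.toSet, ‖D x - ∫ y, K x y * G y‖ₑ ≤ C₀ * μ * C₂ ∧
      x ∉ B ∧ ‖applyOp T (fun y => f y * P.cutoff y) x‖ₑ ≤ C₁ * μ := by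
    by_contra! hcon
    have hw := hweak P f hf μ (F ∩ P.toSet) ⟨x₁, hx₁F, hx₁P⟩ Set.inter_subset_right
      (fun z hz => (smoothMaximal_mono hPQ.triple_subset z).trans (hFM z hz.1))
    have hcov : volume P.toSet ≤ volume (B ∩ P.toSet ∪ {x | x ∈ F ∩ P.toSet ∧
        ((C₁ : ℝ≥0∞) * μ) < ‖applyOp T (fun y => f y * P.cutoff y) x‖ₑ}) := by
      refine measure_mono_ae ?_
      filter_upwards [hDae] with x hx hxP
      by_cases hxB : x ∈ B
      · exact Or.inl ⟨hxB, hxP⟩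
      · exact Or.inr ⟨⟨(hgood x (hPQs hxP) hxB).1, hxP⟩, hcon x hxP (hx hxP) hxB⟩
    have hκ' : (κ : ℝ≥0∞) * volume P.toSet ≤ volume P.toSet / 4 := by
      rw [ENNReal.div_eq_inv_mul]
      gcongr
      calc (κ : ℝ≥0∞) ≤ ((1 / 4 : ℝ≥0) : ℝ≥0∞) := by exact_mod_cast hκ4
        _ = 4⁻¹ := by rw [one_div, ENNReal.coe_inv (by norm_num)]; norm_num
    have h5 : volume P.toSet ≤ volume P.toSet / 4 + volume P.toSet / 4 :=
      hcov.trans ((measure_union_le _ _).trans (add_le_add hPB (hw.trans hκ')))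
    have h6 : volume P.toSet / 4 + volume P.toSet / 4 < volume P.toSet := by
      rw [← ENNReal.add_div, ← two_mul]
      refine ENNReal.div_lt_of_lt_mul ?_
      rw [mul_comm]
      exact ENNReal.mul_lt_mul_right hP0 hPt (by norm_num)
    exact absurd h5 (not_le.mpr h6)
  have hx₂Q := (hgood x₂ (hPQs hx₂P) hx₂B).2.1
  filter_upwards [hDae] with x hx hxP
  have h1 := hx hxP
  have h2 : ‖(∫ y, K x y * G y) - ∫ y, K x₂ y * G y‖ₑ ≤ C₃ * (C₀ * μ) := by
    rw [Real.enorm_eq_ofReal_abs]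
    refine (ENNReal.ofReal_le_ofReal (hosc P G hG _ hGb hGsep x hxP x₂ hx₂P)).trans ?_
    rw [← NNReal.coe_mul, ← NNReal.coe_mul, ENNReal.ofReal_coe_nnreal, ENNReal.coe_mul,
      ENNReal.coe_mul]
  have h3 : ‖D x₂‖ₑ ≤ C₁ * μ + C₁ * μ := (enorm_sub_le).trans (add_le_add hx₂Q hx₂w)
  have e : applyOp T (fun y => f y * Q.cutoff y) x =
      (D x - ∫ y, K x y * G y) + (((∫ y, K x y * G y) - ∫ y, K x₂ y * G y) +
        (-(D x₂ - ∫ y, K x₂ y * G y) + (D x₂ + applyOp T (fun y => f y * P.cutoff y) x))) := by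
    simp only [hD]; ring
  calc _ ≤ C₀ * μ * C₂ + (C₃ * (C₀ * μ) + (C₀ * μ * C₂ + ((C₁ * μ + C₁ * μ) +
        ‖applyOp T (fun y => f y * P.cutoff y) x‖ₑ))) := by
        rw [e]
        refine (enorm_add_le _ _).trans (add_le_add h1 ((enorm_add_le _ _).trans (add_le_add h2
          ((enorm_add_le _ _).trans (add_le_add ?_ ((enorm_add_le _ _).trans ?_))))))
        · rw [enorm_neg]; exact hx₂D
        · gcongr
    _ = ((2 * C₁ + 2 * (C₀ * C₂) + C₃ * C₀ : ℝ≥0) : ℝ≥0∞) * μ +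
        ‖applyOp T (fun y => f y * P.cutoff y) x‖ₑ := by push_cast; ring
    _ ≤ _ := by
        exact add_le_add (mul_le_mul' (ENNReal.coe_le_coe.mpr le_self_add) le_rfl) le_rfl

end Cube

end CancellativeSparse

/-! ### Dyadic cubes -/

namespace CancellativeSparse

variable {d : ℕ}

namespace Cube

variable {P P' Q R : Cube d}

theorem eq_of_corner_of_side (hc : ∀ i, P.corner i = Q.corner i) (hs : P.side = Q.side) :
    P = Q := by
  obtain ⟨c, l, hl⟩ := P
  obtain ⟨c', l', hl'⟩ := Q
  obtain rfl : c = c' := PiLp.ext hc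
  obtain rfl : l = l' := hs
  rfl

/-- The dyadic subcube of generation `k` with index `j`. -/
noncomputable def subcube (Q : Cube d) (k : ℕ) (j : Fin d → ℕ) : Cube d where
  corner := WithLp.toLp 2 fun i => Q.corner i + j i * (Q.side / 2 ^ k)
  side := Q.side / 2 ^ k
  side_pos := div_pos Q.side_pos (by positivity)

theorem mem_dyadicCubes : P ∈ dyadicCubes Q ↔
    ∃ (k : ℕ) (j : Fin d → ℕ), (∀ i, j i < 2 ^ k) ∧ P = Q.subcube k j := by
  constructor
  · rintro ⟨k, hs, j, hj⟩
    exact ⟨k, j, fun i => (hj i).1, eq_of_corner_of_side (fun i => by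
      rw [(hj i).2, hs]; rfl) hs⟩
  · rintro ⟨k, j, hj, rfl⟩
    exact ⟨k, rfl, j, fun i => ⟨hj i, rfl⟩⟩

theorem mem_dyadicCubes_self (Q : Cube d) : Q ∈ dyadicCubes Q :=
  ⟨0, by simp, fun _ => 0, fun i => by simp⟩

theorem countable_dyadicCubes (Q : Cube d) : (dyadicCubes Q).Countable := by
  refine (Set.countable_range fun p : ℕ × (Fin d → ℕ) => Q.subcube p.1 p.2).mono fun P hP => ?_
  obtain ⟨k, j, -, rfl⟩ := mem_dyadicCubes.mp hP
  exact ⟨(k, j), rfl⟩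

theorem dyadicCubes_trans (hP : P ∈ dyadicCubes Q) (hQ : Q ∈ dyadicCubes R) :
    P ∈ dyadicCubes R := by
  obtain ⟨k, hs, j, hj⟩ := hP
  obtain ⟨k', hs', j', hj'⟩ := hQ
  refine ⟨k' + k, by rw [hs, hs', pow_add, div_div], fun i => j' i * 2 ^ k + j i,
    fun i => ⟨?_, ?_⟩⟩
  · have h1 := (hj i).1
    have h2 : j' i + 1 ≤ 2 ^ k' := (hj' i).1
    calc j' i * 2 ^ k + j i < j' i * 2 ^ k + 2 ^ k := by omega
      _ = (j' i + 1) * 2 ^ k := by ring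
      _ ≤ 2 ^ k' * 2 ^ k := by gcongr
      _ = _ := (pow_add _ _ _).symm
  · rw [(hj i).2, (hj' i).2]
    have : Q.side = 2 ^ k * P.side := by rw [hs]; field_simp
    rw [this]; push_cast; ring

theorem eq_or_isHalf (h : P ∈ dyadicCubes Q) : P = Q ∨ P.IsHalf Q := by
  obtain ⟨k, hs, j, hj⟩ := h
  rcases Nat.eq_zero_or_pos k with rfl | hk
  · left
    refine eq_of_corner_of_side (fun i => ?_) (by simpa using hs)
    have h1 := hj i
    simp only [pow_zero, Nat.lt_one_iff] at h1
    rw [h1.2, h1.1]; simp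
  · right
    have hP := P.side_pos
    have e : Q.side = 2 ^ k * P.side := by rw [hs]; field_simp
    refine ⟨?_, fun i => ?_, fun i => ?_⟩
    · have : (2 : ℝ) ^ 1 ≤ 2 ^ k := pow_le_pow_right₀ (by norm_num) hk
      rw [e]; nlinarith
    · rw [(hj i).2]
      have : 0 ≤ (j i : ℝ) * P.side := by positivity
      linarith
    · have h1 : ((j i : ℝ) + 1) ≤ 2 ^ k := by exact_mod_cast (hj i).1
      rw [(hj i).2, e]
      nlinarith

theorem subset_of_mem_dyadicCubes (h : P ∈ dyadicCubes Q) : P.toSet ⊆ Q.toSet := by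
  rcases eq_or_isHalf h with rfl | h
  · exact subset_rfl
  · exact h.subset

/-- Dyadic cubes that intersect are nested. -/
theorem mem_dyadicCubes_of_mem_of_mem (hP : P ∈ dyadicCubes Q) (hP' : P' ∈ dyadicCubes Q)
    (hle : P.side ≤ P'.side) {x : Space d} (hx : x ∈ P.toSet) (hx' : x ∈ P'.toSet) :
    P ∈ dyadicCubes P' := by
  obtain ⟨k, hs, j, hj⟩ := hP
  obtain ⟨k', hs', j', hj'⟩ := hP'
  have hQ := Q.side_pos
  have hP0 := P.side_pos
  have hkk : k' ≤ k := by
    rw [hs, hs'] at hle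
    by_contra! hlt
    have : (2 : ℝ) ^ k < 2 ^ k' := pow_lt_pow_right₀ (by norm_num) hlt
    exact absurd hle (not_le.mpr (by gcongr))
  obtain ⟨n, rfl⟩ := Nat.exists_eq_add_of_le hkk
  have e : P'.side = 2 ^ n * P.side := by rw [hs, hs', pow_add]; field_simp
  have key : ∀ i, j' i * 2 ^ n ≤ j i ∧ j i < j' i * 2 ^ n + 2 ^ n := by
    intro i
    have h1 := hx i
    have h2 := hx' i
    rw [(hj i).2] at h1
    rw [(hj' i).2, e] at h2
    have h3 : (j' i * 2 ^ n : ℝ) < j i + 1 := by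
      have : (j' i * 2 ^ n : ℝ) * P.side < (j i + 1) * P.side := by linarith
      exact lt_of_mul_lt_mul_right this hP0.le
    have h4 : (j i : ℝ) < j' i * 2 ^ n + 2 ^ n := by
      have : (j i : ℝ) * P.side < (j' i * 2 ^ n + 2 ^ n) * P.side := by linarith
      exact lt_of_mul_lt_mul_right this hP0.le
    constructor
    · exact Nat.lt_succ_iff.mp (by exact_mod_cast h3)
    · exact_mod_cast h4
  refine ⟨n, by rw [e]; field_simp, fun i => j i - j' i * 2 ^ n, fun i => ⟨?_, ?_⟩⟩
  · have := key i
    dsimp only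
    omega
  · rw [(hj i).2, (hj' i).2, e, Nat.cast_sub (key i).1]
    push_cast; ring

theorem eq_of_mem_of_mem (hP : P ∈ dyadicCubes Q) (hP' : P' ∈ dyadicCubes Q)
    (heq : P.side = P'.side) {x : Space d} (hx : x ∈ P.toSet) (hx' : x ∈ P'.toSet) : P = P' := by
  rcases eq_or_isHalf (mem_dyadicCubes_of_mem_of_mem hP hP' heq.le hx hx') with h | h
  · exact h
  · have := h.side_le
    have := P.side_pos
    linarith

theorem exists_parent (hP : P ∈ dyadicCubes Q) (hne : P ≠ Q) :
    ∃ R ∈ dyadicCubes Q, R.side = 2 * P.side ∧ P.toSet ⊆ R.toSet := by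
  obtain ⟨k, j, hj, rfl⟩ := mem_dyadicCubes.mp hP
  rcases k with _ | k
  · rcases eq_or_isHalf hP with h | h
    · exact absurd h hne
    · have h1 := h.side_le
      have h2 : (Q.subcube 0 j).side = Q.side := by simp [subcube]
      have := Q.side_pos
      linarith
  · have hQ := Q.side_pos
    refine ⟨Q.subcube k fun i => j i / 2, mem_dyadicCubes.mpr ⟨k, _, fun i => ?_, rfl⟩, ?_, ?_⟩
    · have := hj i; rw [pow_succ] at this; omega
    · change Q.side / 2 ^ k = 2 * (Q.side / 2 ^ (k + 1))
      rw [pow_succ]; field_simp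
    · intro y hy i
      have h1 := hy i
      change Q.corner i + j i * (Q.side / 2 ^ (k + 1)) ≤ y i ∧
        y i < Q.corner i + j i * (Q.side / 2 ^ (k + 1)) + Q.side / 2 ^ (k + 1) at h1
      change Q.corner i + ((j i / 2 : ℕ) : ℝ) * (Q.side / 2 ^ k) ≤ y i ∧
        y i < Q.corner i + ((j i / 2 : ℕ) : ℝ) * (Q.side / 2 ^ k) + Q.side / 2 ^ k
      have e : Q.side / 2 ^ k = 2 * (Q.side / 2 ^ (k + 1)) := by rw [pow_succ]; field_simp
      have hl : 0 < Q.side / 2 ^ (k + 1) := by positivity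
      have h2 : (2 * ((j i / 2 : ℕ) : ℝ)) ≤ j i := by
        exact_mod_cast (by omega : 2 * (j i / 2) ≤ j i)
      have h3 : (j i : ℝ) + 1 ≤ 2 * ((j i / 2 : ℕ) : ℝ) + 2 := by
        exact_mod_cast (by omega : j i + 1 ≤ 2 * (j i / 2) + 2)
      rw [e]
      constructor <;> nlinarith

theorem exists_mem_dyadicCubes {x : Space d} (hx : x ∈ Q.toSet) (k : ℕ) :
    ∃ P ∈ dyadicCubes Q, P.side = Q.side / 2 ^ k ∧ x ∈ P.toSet := by
  have hQ := Q.side_pos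
  have hl : 0 < Q.side / 2 ^ k := by positivity
  refine ⟨Q.subcube k fun i => ⌊(x i - Q.corner i) / (Q.side / 2 ^ k)⌋₊,
    mem_dyadicCubes.mpr ⟨k, _, fun i => ?_, rfl⟩, rfl, fun i => ?_⟩
  · have h := hx i
    have h0 : 0 ≤ x i - Q.corner i := by linarith
    rw [Nat.floor_lt (by positivity), div_lt_iff₀ hl]
    push_cast
    rw [mul_div_cancel₀ _ (by positivity)]
    linarith
  · have h0 : 0 ≤ x i - Q.corner i := by linarith [(hx i).1]
    change Q.corner i + ((⌊(x i - Q.corner i) / (Q.side / 2 ^ k)⌋₊ : ℕ) : ℝ) *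
      (Q.side / 2 ^ k) ≤ x i ∧ x i < Q.corner i +
      ((⌊(x i - Q.corner i) / (Q.side / 2 ^ k)⌋₊ : ℕ) : ℝ) * (Q.side / 2 ^ k) + Q.side / 2 ^ k
    have h1 := Nat.floor_le (div_nonneg h0 hl.le)
    have h2 := Nat.lt_floor_add_one ((x i - Q.corner i) / (Q.side / 2 ^ k))
    rw [le_div_iff₀ hl] at h1
    rw [div_lt_iff₀ hl] at h2
    constructor <;> linarith

/-- Almost every point of a measurable set is contained in arbitrarily small dyadic cubes that
are mostly contained in the set. -/
theorem ae_exists_dyadic_measure_le (hd : 0 < d) (Q : Cube d) {B : Set (Space d)}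
    (hB : MeasurableSet B) {a : ℝ≥0∞} (ha : 2 ≤ a) :
    ∀ᵐ x ∂(volume : Measure (Space d)), x ∈ Q.toSet → x ∈ B →
      ∃ P ∈ dyadicCubes Q, x ∈ P.toSet ∧ volume P.toSet ≤ a * volume (B ∩ P.toSet) := by
  set V := volume (Metric.ball (0 : Space d) 1) with hV
  have hVt : V ≠ ∞ := Metric.isBounded_ball.measure_lt_top.ne
  set D : ℝ≥0∞ := ENNReal.ofReal ((d : ℝ) ^ d) * V with hD
  have hDt : D ≠ ∞ := ENNReal.mul_ne_top ENNReal.ofReal_ne_top hVt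
  -- the density at which the complement fills at most half of a cube
  set ε : ℝ≥0∞ := (2 * (D + 1))⁻¹ with hε
  have hε0 : 0 < ε := ENNReal.inv_pos.mpr (ENNReal.mul_ne_top (by norm_num) (by simpa using hDt))
  have hεD : ε * D ≤ 2⁻¹ := by
    rw [hε, ENNReal.mul_inv (by simp) (by simp), mul_assoc]
    refine mul_le_of_le_one_right' ?_
    calc (D + 1)⁻¹ * D ≤ (D + 1)⁻¹ * (D + 1) := by gcongr; exact le_self_add
      _ ≤ 1 := ENNReal.inv_mul_le_one _
  filter_upwards [Besicovitch.ae_tendsto_measure_inter_div_of_measurableSet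
    (volume : Measure (Space d)) hB.compl] with x hx hxQ hxB
  rw [Set.indicator_of_notMem (by simpa using hxB)] at hx
  have hQ := Q.side_pos
  have hlim : Filter.Tendsto (fun k : ℕ => (d : ℝ) * (Q.side / 2 ^ k)) Filter.atTop
      (nhdsWithin 0 (Set.Ioi 0)) := by
    refine tendsto_nhdsWithin_iff.mpr ⟨?_, Filter.Eventually.of_forall fun k => ?_⟩
    · have h1 := (tendsto_pow_atTop_nhds_zero_of_lt_one (r := (1 / 2 : ℝ)) (by norm_num)
        (by norm_num)).const_mul ((d : ℝ) * Q.side)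
      rw [mul_zero] at h1
      refine h1.congr fun k => ?_
      rw [one_div, inv_pow, mul_assoc, div_eq_mul_inv]
    · have : (0 : ℝ) < d := by exact_mod_cast hd
      exact Set.mem_Ioi.mpr (by positivity)
  obtain ⟨k, hk⟩ := ((hx.comp hlim).eventually_le_const hε0).exists
  obtain ⟨P, hP, hPs, hxP⟩ := exists_mem_dyadicCubes hxQ k
  refine ⟨P, hP, hxP, ?_⟩
  simp only [Function.comp_apply, ← hPs] at hk
  have hP0 := P.side_pos
  have hPb : P.toSet ⊆ Metric.closedBall x (d * P.side) := fun y hy => by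
    rw [Metric.mem_closedBall, dist_eq_norm]
    exact Cube.norm_sub_le hy hxP
  have hball : volume (Metric.closedBall x (d * P.side)) = D * volume P.toSet := by
    rw [Measure.addHaar_closedBall _ _ (by positivity), finrank_euclideanSpace_fin, mul_pow,
      ENNReal.ofReal_mul (by positivity), volume_toSet, hD]
    ring
  have hne : volume (Metric.closedBall x (d * P.side)) ≠ 0 := fun h =>
    volume_toSet_ne_zero P (measure_mono_null hPb h)
  have h1 : volume (Bᶜ ∩ P.toSet) ≤ volume P.toSet / 2 := by
    calc volume (Bᶜ ∩ P.toSet) ≤ volume (Bᶜ ∩ Metric.closedBall x (d * P.side)) := by gcongr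
      _ ≤ ε * volume (Metric.closedBall x (d * P.side)) :=
          (ENNReal.div_le_iff hne measure_closedBall_lt_top.ne).mp hk
      _ = ε * D * volume P.toSet := by rw [hball, ← mul_assoc]
      _ ≤ 2⁻¹ * volume P.toSet := by gcongr
      _ = _ := by rw [ENNReal.div_eq_inv_mul]
  have h2 : volume P.toSet / 2 + volume P.toSet / 2 ≤
      volume (B ∩ P.toSet) + volume P.toSet / 2 := by
    rw [ENNReal.add_halves]
    calc volume P.toSet = volume (P.toSet ∩ B) + volume (P.toSet \ B) :=
          (measure_inter_add_sdiff _ hB).symm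
      _ ≤ _ := by
          rw [Set.inter_comm, Set.sdiff_eq, Set.inter_comm P.toSet]
          gcongr
  have h3 := ENNReal.le_of_add_le_add_right
    (ENNReal.div_ne_top (volume_toSet_ne_top P) (by norm_num)) h2
  calc volume P.toSet = 2 * (volume P.toSet / 2) :=
        (ENNReal.mul_div_cancel (by norm_num) (by norm_num)).symm
    _ ≤ a * volume (B ∩ P.toSet) := by gcongr

end Cube

end CancellativeSparse

/-! ### Stopping cubes and sparse families -/

namespace CancellativeSparse

variable {d : ℕ}

namespace Cube

/-- The maximal dyadic subcubes of `Q` of which a fixed proportion is contained in a small set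
`B`. -/
theorem exists_stopping_cubes (hd : 0 < d) (Q : Cube d) {B : Set (Space d)}
    (hB : MeasurableSet B) (hBQ : 8 * 2 ^ d * volume B ≤ volume Q.toSet) :
    ∃ Φ ⊆ dyadicCubes Q, Φ.PairwiseDisjoint toSet ∧
      (∀ P ∈ Φ, P.IsHalf Q ∧ volume (B ∩ P.toSet) ≤ volume P.toSet / 4) ∧
      volume (⋃ P ∈ Φ, P.toSet) ≤ volume Q.toSet / 2 ∧
      ∀ᵐ x ∂(volume : Measure (Space d)), x ∈ Q.toSet → x ∉ ⋃ P ∈ Φ, P.toSet → x ∉ B := by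
  -- `B` fills at most the proportion `1 / a` of the parent of a maximal heavy cube, hence at most
  -- `2 ^ d / a = 1 / 4` of that cube itself
  set a : ℝ≥0∞ := 4 * 2 ^ d with ha
  have ha0 : a ≠ 0 := by positivity
  have hat : a ≠ ∞ := by finiteness
  have ha2 : 2 ≤ a := by
    calc (2 : ℝ≥0∞) ≤ 4 * 1 := by norm_num
      _ ≤ a := by rw [ha]; gcongr; exact one_le_pow₀ (by norm_num)
  have hBQ' : 2 * (a * volume B) ≤ volume Q.toSet := by
    refine le_trans (le_of_eq ?_) hBQ
    rw [ha]; ring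
  set heavy : Cube d → Prop := fun P => volume P.toSet ≤ a * volume (B ∩ P.toSet) with hheavy
  set Φ : Set (Cube d) := {P | P ∈ dyadicCubes Q ∧ heavy P ∧
    ∀ P' ∈ dyadicCubes Q, heavy P' → (P.toSet ∩ P'.toSet).Nonempty → P'.side ≤ P.side}
  have hsub : Φ ⊆ dyadicCubes Q := fun P hP => hP.1
  have hdisj : Φ.PairwiseDisjoint toSet := by
    intro P hP P' hP' hne
    rw [Function.onFun, Set.disjoint_iff_inter_eq_empty]
    by_contra hcon
    obtain ⟨x, hx, hx'⟩ := Set.nonempty_iff_ne_empty.mpr hcon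
    exact hne (eq_of_mem_of_mem hP.1 hP'.1 (le_antisymm (hP'.2.2 P hP.1 hP.2.1 ⟨x, hx', hx⟩)
      (hP.2.2 P' hP'.1 hP'.2.1 ⟨x, hx, hx'⟩)) hx hx')
  have hcount : Φ.Countable := (countable_dyadicCubes Q).mono hsub
  -- every point of a heavy cube is contained in a maximal one
  have hcover : ∀ P ∈ dyadicCubes Q, heavy P → ∀ x ∈ P.toSet, x ∈ ⋃ P ∈ Φ, P.toSet := by
    intro P hP hPh x hx
    have hex : ∃ k : ℕ, ∃ P ∈ dyadicCubes Q, P.side = Q.side / 2 ^ k ∧ heavy P ∧ x ∈ P.toSet := by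
      obtain ⟨k, hk, -⟩ := id hP
      exact ⟨k, P, hP, hk, hPh, hx⟩
    classical
    obtain ⟨R, hR, hRs, hRh, hxR⟩ := Nat.find_spec hex
    refine Set.mem_biUnion (show R ∈ Φ from ⟨hR, hRh, fun P' hP' hP'h hne => ?_⟩) hxR
    by_contra! hlt
    obtain ⟨z, hzR, hzP'⟩ := hne
    obtain ⟨k', hk', -⟩ := id hP'
    refine Nat.find_min hex (m := k') ?_ ⟨P', hP', hk', hP'h,
      subset_of_mem_dyadicCubes (mem_dyadicCubes_of_mem_of_mem hR hP' hlt.le hzR hzP') hxR⟩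
    rw [hRs, hk'] at hlt
    by_contra! hle
    have h1 : (2 : ℝ) ^ Nat.find hex ≤ 2 ^ k' := pow_le_pow_right₀ (by norm_num) hle
    have := Q.side_pos
    exact absurd hlt (not_lt.mpr (by gcongr))
  refine ⟨Φ, hsub, hdisj, fun P hP => ?_, ?_, ?_⟩
  · have hPQ : P ≠ Q := by
      rintro rfl
      have h0 := volume_toSet_ne_zero P
      have ht := volume_toSet_ne_top P
      have h1 : 2 * volume P.toSet ≤ 1 * volume P.toSet := by
        rw [one_mul]
        refine le_trans ?_ hBQ'
        gcongr
        exact hP.2.1.trans (by gcongr; exact Set.inter_subset_left)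
      exact absurd ((ENNReal.mul_le_mul_iff_left h0 ht).mp h1) (by norm_num)
    refine ⟨(eq_or_isHalf hP.1).resolve_left hPQ, ?_⟩
    obtain ⟨R, hR, hRs, hPR⟩ := exists_parent hP.1 hPQ
    have hRh : ¬ heavy R := fun h => by
      obtain ⟨x, hx⟩ : P.toSet.Nonempty := by
        by_contra hne
        exact volume_toSet_ne_zero P (by rw [Set.not_nonempty_iff_eq_empty.mp hne, measure_empty])
      have h1 := hP.2.2 R hR h ⟨x, hx, hPR hx⟩
      have := P.side_pos
      linarith
    have h1 : a * volume (B ∩ P.toSet) ≤ 2 ^ d * volume P.toSet := by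
      calc _ ≤ a * volume (B ∩ R.toSet) := by gcongr
        _ ≤ volume R.toSet := (not_le.mp hRh).le
        _ = _ := by
          have := P.side_pos
          rw [volume_toSet, volume_toSet, hRs, mul_pow, ENNReal.ofReal_mul (by positivity),
            ENNReal.ofReal_pow (by norm_num)]
          simp
    rw [ENNReal.le_div_iff_mul_le (by simp) (by simp)]
    refine (ENNReal.mul_le_mul_iff_right (a := 2 ^ d) (by positivity) (by finiteness)).mp ?_
    refine le_trans (le_of_eq ?_) h1
    rw [ha]; ring
  · have h1 : volume (⋃ P ∈ Φ, P.toSet) ≤ a * volume B := by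
      rw [measure_biUnion hcount hdisj fun P _ => measurableSet_toSet P]
      calc ∑' P : Φ, volume P.1.toSet ≤ ∑' P : Φ, a * volume (B ∩ P.1.toSet) :=
            ENNReal.tsum_le_tsum fun P => P.2.2.1
        _ = a * ∑' P : Φ, volume (B ∩ P.1.toSet) := ENNReal.tsum_mul_left
        _ = a * volume (⋃ P ∈ Φ, B ∩ P.toSet) := by
            rw [measure_biUnion hcount (hdisj.mono fun P => Set.inter_subset_right)
              fun P _ => hB.inter (measurableSet_toSet P)]
        _ ≤ a * volume B := by
            gcongr
            exact Set.iUnion₂_subset fun P _ => Set.inter_subset_left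
    rw [ENNReal.le_div_iff_mul_le (by simp) (by simp), mul_comm]
    exact le_trans (by gcongr) hBQ'
  · filter_upwards [ae_exists_dyadic_measure_le hd Q hB ha2] with x hx hxQ hxn hxB
    obtain ⟨P, hP, hxP, hPh⟩ := hx hxQ hxB
    exact hxn (hcover P hP hPh x hxP)

end Cube

/-- The cubes selected after `n` steps: the `n`-fold iterate of `children`, started at `Q₀`. -/
def generation (children : Cube d → Set (Cube d)) (Q₀ : Cube d) : ℕ → Set (Cube d)
  | 0 => {Q₀}
  | n + 1 => ⋃ Q ∈ generation children Q₀ n, children Q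

section generation

variable {children : Cube d → Set (Cube d)} {Q₀ : Cube d}

theorem mem_generation_succ {n : ℕ} {P : Cube d} :
    P ∈ generation children Q₀ (n + 1) ↔ ∃ Q ∈ generation children Q₀ n, P ∈ children Q := by
  simp [generation]

theorem generation_subset (hsub : ∀ Q, children Q ⊆ dyadicCubes Q) (n : ℕ) :
    generation children Q₀ n ⊆ dyadicCubes Q₀ := by
  induction n with
  | zero => rintro _ rfl; exact Cube.mem_dyadicCubes_self _
  | succ n ih =>
    intro P hP
    obtain ⟨Q, hQ, hPQ⟩ := mem_generation_succ.mp hP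
    exact Cube.dyadicCubes_trans (hsub Q hPQ) (ih hQ)

theorem generation_pairwiseDisjoint (hsub : ∀ Q, children Q ⊆ dyadicCubes Q)
    (hdisj : ∀ Q, (children Q).PairwiseDisjoint Cube.toSet) (n : ℕ) :
    (generation children Q₀ n).PairwiseDisjoint Cube.toSet := by
  induction n with
  | zero => exact Set.pairwiseDisjoint_singleton _ _
  | succ n ih =>
    intro P hP P' hP' hne
    obtain ⟨Q, hQ, hPQ⟩ := mem_generation_succ.mp hP
    obtain ⟨Q', hQ', hPQ'⟩ := mem_generation_succ.mp hP'
    by_cases h : Q = Q'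
    · subst h; exact hdisj Q hPQ hPQ' hne
    · exact (ih hQ hQ' h).mono (Cube.subset_of_mem_dyadicCubes (hsub Q hPQ))
        (Cube.subset_of_mem_dyadicCubes (hsub Q' hPQ'))

theorem exists_generation_superset (hsub : ∀ Q, children Q ⊆ dyadicCubes Q) {n m : ℕ} (hnm : n ≤ m)
    {P : Cube d} (hP : P ∈ generation children Q₀ m) :
    ∃ Q ∈ generation children Q₀ n, P.toSet ⊆ Q.toSet := by
  induction m, hnm using Nat.le_induction generalizing P with
  | base => exact ⟨P, hP, subset_rfl⟩
  | succ m _ ih =>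
    obtain ⟨R, hR, hPR⟩ := mem_generation_succ.mp hP
    obtain ⟨Q, hQ, hRQ⟩ := ih hR
    exact ⟨Q, hQ, (Cube.subset_of_mem_dyadicCubes (hsub R hPR)).trans hRQ⟩

/-- The parts of the selected cubes that are left over after removing their children serve as the
disjoint sets in the definition of sparseness. -/
theorem pairwiseDisjoint_diff_children (hsub : ∀ Q, children Q ⊆ dyadicCubes Q)
    (hdisj : ∀ Q, (children Q).PairwiseDisjoint Cube.toSet) :
    (⋃ n, generation children Q₀ n).PairwiseDisjoint
      fun Q => Q.toSet \ ⋃ P ∈ children Q, P.toSet := by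
  have key : ∀ n m, n ≤ m → ∀ Q ∈ generation children Q₀ n, ∀ Q' ∈ generation children Q₀ m, Q ≠ Q' →
      Disjoint (Q.toSet \ ⋃ P ∈ children Q, P.toSet) (Q'.toSet \ ⋃ P ∈ children Q', P.toSet) := by
    intro n m hnm Q hQ Q' hQ' hne
    rcases hnm.eq_or_lt with rfl | hlt
    · exact (generation_pairwiseDisjoint hsub hdisj n hQ hQ' hne).mono Set.sdiff_subset
        Set.sdiff_subset
    · obtain ⟨P, hP, hQP⟩ := exists_generation_superset hsub (Nat.succ_le_of_lt hlt) hQ'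
      obtain ⟨R, hR, hPR⟩ := mem_generation_succ.mp hP
      by_cases h : R = Q
      · subst h
        refine Set.disjoint_left.mpr fun x hx hx' => hx.2 ?_
        exact Set.mem_biUnion hPR (hQP hx'.1)
      · exact (generation_pairwiseDisjoint hsub hdisj n hQ hR (Ne.symm h)).mono Set.sdiff_subset
          (Set.sdiff_subset.trans (hQP.trans (Cube.subset_of_mem_dyadicCubes (hsub R hPR))))
  intro Q hQ Q' hQ' hne
  obtain ⟨n, hn⟩ := Set.mem_iUnion.mp hQ
  obtain ⟨m, hm⟩ := Set.mem_iUnion.mp hQ'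
  rcases le_total n m with h | h
  · exact key n m h Q hn Q' hm hne
  · exact (key m n h Q' hm Q hn (Ne.symm hne)).symm

theorem volume_iUnion_generation_le (hsub : ∀ Q, children Q ⊆ dyadicCubes Q)
    (hdisj : ∀ Q, (children Q).PairwiseDisjoint Cube.toSet)
    (hvol : ∀ Q ∈ dyadicCubes Q₀, volume (⋃ P ∈ children Q, P.toSet) ≤ volume Q.toSet / 2) (n : ℕ) :
    volume (⋃ Q ∈ generation children Q₀ n, Q.toSet) ≤ 2⁻¹ ^ n * volume Q₀.toSet := by
  induction n with
  | zero => simp [generation]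
  | succ n ih =>
    have hc : (generation children Q₀ n).Countable :=
      (Cube.countable_dyadicCubes Q₀).mono (generation_subset hsub n)
    calc volume (⋃ Q ∈ generation children Q₀ (n + 1), Q.toSet)
        ≤ volume (⋃ Q ∈ generation children Q₀ n, ⋃ P ∈ children Q, P.toSet) := by
          refine measure_mono (Set.iUnion₂_subset fun P hP => ?_)
          obtain ⟨Q, hQ, hPQ⟩ := mem_generation_succ.mp hP
          exact fun x hx => Set.mem_biUnion hQ (Set.mem_biUnion hPQ hx)
      _ ≤ ∑' Q : generation children Q₀ n, volume (⋃ P ∈ children Q.1, P.toSet) := measure_biUnion_le _ hc _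
      _ ≤ ∑' Q : generation children Q₀ n, 2⁻¹ * volume Q.1.toSet :=
          ENNReal.tsum_le_tsum fun Q => by
            rw [← ENNReal.div_eq_inv_mul]; exact hvol Q.1 (generation_subset hsub n Q.2)
      _ = 2⁻¹ * volume (⋃ Q ∈ generation children Q₀ n, Q.toSet) := by
          rw [ENNReal.tsum_mul_left, measure_biUnion hc (generation_pairwiseDisjoint hsub hdisj n)
            fun Q _ => Q.measurableSet_toSet]
      _ ≤ 2⁻¹ * (2⁻¹ ^ n * volume Q₀.toSet) := by gcongr
      _ = _ := by rw [pow_succ]; ring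

/-- Iterating the pointwise estimate along the chain of selected cubes that contain `x`. Their side
lengths decrease strictly, so that no cube is counted twice. -/
theorem le_tsum_of_chain {u : Cube d → Space d → ℝ≥0∞} {g : Cube d → ℝ≥0∞} {x : Space d}
    (hhalf : ∀ Q ∈ dyadicCubes Q₀, ∀ P ∈ children Q, P.IsHalf Q) (hsub : ∀ Q, children Q ⊆ dyadicCubes Q)
    (hx : x ∈ Q₀.toSet) (hfin : ∃ n, x ∉ ⋃ Q ∈ generation children Q₀ n, Q.toSet)
    (hend : ∀ Q ∈ dyadicCubes Q₀, x ∈ Q.toSet → x ∉ ⋃ P ∈ children Q, P.toSet → u Q x ≤ g Q)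
    (hstep : ∀ Q ∈ dyadicCubes Q₀, ∀ P ∈ children Q, x ∈ P.toSet → u Q x ≤ g Q + u P x) :
    u Q₀ x ≤ ∑' Q : (⋃ n, generation children Q₀ n : Set (Cube d)),
      Q.1.toSet.indicator (fun _ => g Q.1) x := by
  classical
  set S : Set (Cube d) := ⋃ n, generation children Q₀ n with hS
  have hsum : ∀ Φ : Finset (Cube d), (∀ R ∈ Φ, R ∈ S ∧ x ∈ R.toSet) →
      ∑ R ∈ Φ, g R ≤ ∑' Q : S, Q.1.toSet.indicator (fun _ => g Q.1) x := by
    intro Φ hΦ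
    calc ∑ R ∈ Φ, g R = ∑ R ∈ Φ.subtype (· ∈ S), R.1.toSet.indicator (fun _ => g R.1) x := by
          rw [Finset.sum_subtype_of_mem (fun R => R.toSet.indicator (fun _ => g R) x)
            fun R hR => (hΦ R hR).1]
          exact Finset.sum_congr rfl fun R hR => (Set.indicator_of_mem (hΦ R hR).2 fun _ => g R).symm
      _ ≤ _ := ENNReal.sum_le_tsum _
  by_contra hcon
  have key : ∀ n, ∃ Q ∈ generation children Q₀ n, x ∈ Q.toSet ∧ ∃ Φ : Finset (Cube d),
      (∀ R ∈ Φ, R ∈ S ∧ x ∈ R.toSet ∧ Q.side < R.side) ∧ u Q₀ x ≤ (∑ R ∈ Φ, g R) + u Q x := by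
    intro n
    induction n with
    | zero => exact ⟨Q₀, rfl, hx, ∅, by simp, by simp⟩
    | succ n ih =>
      obtain ⟨Q, hQ, hxQ, Φ, hΦ, hu⟩ := ih
      have hQd := generation_subset hsub n hQ
      have hQΦ : Q ∉ Φ := fun h => lt_irrefl _ (hΦ Q h).2.2
      have hQS : Q ∈ S := Set.mem_iUnion.mpr ⟨n, hQ⟩
      by_cases hchild : x ∈ ⋃ P ∈ children Q, P.toSet
      · obtain ⟨P, hP, hxP⟩ := Set.mem_iUnion₂.mp hchild
        have hlt : P.side < Q.side := by
          have := (hhalf Q hQd P hP).side_le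
          have := Q.side_pos
          linarith
        refine ⟨P, mem_generation_succ.mpr ⟨Q, hQ, hP⟩, hxP, insert Q Φ, fun R hR => ?_, ?_⟩
        · rcases Finset.mem_insert.mp hR with rfl | hR
          · exact ⟨hQS, hxQ, hlt⟩
          · exact ⟨(hΦ R hR).1, (hΦ R hR).2.1, hlt.trans (hΦ R hR).2.2⟩
        · rw [Finset.sum_insert hQΦ]
          calc _ ≤ (∑ R ∈ Φ, g R) + u Q x := hu
            _ ≤ (∑ R ∈ Φ, g R) + (g Q + u P x) := by gcongr; exact hstep Q hQd P hP hxP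
            _ = _ := by ring
      · refine absurd ?_ hcon
        refine le_trans ?_ (hsum (insert Q Φ) fun R hR => ?_)
        · rw [Finset.sum_insert hQΦ, add_comm (g Q)]
          exact hu.trans (by gcongr; exact hend Q hQd hxQ hchild)
        · rcases Finset.mem_insert.mp hR with rfl | hR
          · exact ⟨hQS, hxQ⟩
          · exact ⟨(hΦ R hR).1, (hΦ R hR).2.1⟩
  obtain ⟨n, hn⟩ := hfin
  obtain ⟨Q, hQ, hxQ, -⟩ := key n
  exact hn (Set.mem_biUnion hQ hxQ)

end generation

/-- **Iteration of the stopping-time argument**, for functions `u Q` that are controlled by numbers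
`g Q` outside small exceptional sets. Both `u Q` and `g Q` may be infinite. -/
theorem exists_sparse_of_exceptional_sets (hd : 0 < d) (Q₀ : Cube d)
    (u : Cube d → Space d → ℝ≥0∞) (g : Cube d → ℝ≥0∞)
    (h : ∀ Q : Cube d, ∃ B : Set (Space d), MeasurableSet B ∧
      8 * 2 ^ d * volume B ≤ volume Q.toSet ∧
      (∀ᵐ x ∂(volume : Measure (Space d)), x ∈ Q.toSet → x ∉ B → u Q x ≤ g Q) ∧
      ∀ P : Cube d, P.IsHalf Q → volume (B ∩ P.toSet) ≤ volume P.toSet / 4 →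
        ∀ᵐ x ∂(volume : Measure (Space d)), x ∈ P.toSet → u Q x ≤ g Q + u P x) :
    ∃ S : Set (Cube d), S ⊆ dyadicCubes Q₀ ∧ IsSparse (1 / 2) S ∧
      ∀ᵐ x ∂(volume : Measure (Space d)), x ∈ Q₀.toSet →
        u Q₀ x ≤ ∑' Q : S, Q.1.toSet.indicator (fun _ => g Q.1) x := by
  choose B hBm hBv hend hstep using h
  choose children hsub hdisj hP hvol hae using fun Q => Cube.exists_stopping_cubes hd Q (hBm Q) (hBv Q)
  have hcount : ∀ Q, (children Q).Countable := fun Q =>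
    (Cube.countable_dyadicCubes Q).mono (hsub Q)
  have hum : ∀ Q, MeasurableSet (⋃ P ∈ children Q, P.toSet) := fun Q =>
    MeasurableSet.biUnion (hcount Q) fun P _ => P.measurableSet_toSet
  refine ⟨⋃ n, generation children Q₀ n, Set.iUnion_subset (generation_subset hsub),
    ⟨fun Q => Q.toSet \ ⋃ P ∈ children Q, P.toSet, fun Q _ => ⟨Q.measurableSet_toSet.diff (hum Q),
      Set.sdiff_subset, ?_⟩, pairwiseDisjoint_diff_children hsub hdisj⟩, ?_⟩
  · refine le_trans ?_ (le_measure_sdiff)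
    refine ENNReal.le_sub_of_add_le_right (ne_top_of_le_ne_top
      (ENNReal.div_ne_top Q.volume_toSet_ne_top (by norm_num)) (hvol Q)) ?_
    have e : ENNReal.ofReal (1 / 2) = 2⁻¹ := by
      rw [one_div, ENNReal.ofReal_inv_of_pos (by norm_num)]; simp
    calc _ ≤ 2⁻¹ * volume Q.toSet + volume Q.toSet / 2 := by rw [e]; gcongr; exact hvol Q
      _ = _ := by rw [← ENNReal.div_eq_inv_mul, ENNReal.add_halves]
  · have hfin : ∀ᵐ x ∂(volume : Measure (Space d)),
        ∃ n, x ∉ ⋃ Q ∈ generation children Q₀ n, Q.toSet := by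
      have hz : volume (⋂ n, ⋃ Q ∈ generation children Q₀ n, Q.toSet) = 0 := by
        refine le_antisymm ?_ zero_le
        have hlim : Filter.Tendsto (fun n : ℕ => (2⁻¹ : ℝ≥0∞) ^ n * volume Q₀.toSet)
            Filter.atTop (nhds (0 * volume Q₀.toSet)) :=
          ENNReal.Tendsto.mul_const (ENNReal.tendsto_pow_atTop_nhds_zero_of_lt_one (by norm_num))
            (Or.inr Q₀.volume_toSet_ne_top)
        rw [zero_mul] at hlim
        exact ge_of_tendsto' hlim fun n => (measure_mono (Set.iInter_subset _ n)).trans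
          (volume_iUnion_generation_le hsub hdisj (fun Q _ => hvol Q) n)
      rw [ae_iff]
      refine measure_mono_null (fun x hx => ?_) hz
      simpa using hx
    have hend' : ∀ᵐ x ∂(volume : Measure (Space d)), ∀ Q ∈ dyadicCubes Q₀, x ∈ Q.toSet →
        x ∉ ⋃ P ∈ children Q, P.toSet → u Q x ≤ g Q := by
      refine (ae_ball_iff (Cube.countable_dyadicCubes Q₀)).mpr fun Q _ => ?_
      filter_upwards [hend Q, hae Q] with x h1 h2 hxQ hxs using h1 hxQ (h2 hxQ hxs)
    have hstep' : ∀ᵐ x ∂(volume : Measure (Space d)), ∀ Q ∈ dyadicCubes Q₀, ∀ P ∈ children Q,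
        x ∈ P.toSet → u Q x ≤ g Q + u P x := by
      refine (ae_ball_iff (Cube.countable_dyadicCubes Q₀)).mpr fun Q _ =>
        (ae_ball_iff (hcount Q)).mpr fun P hPs => ?_
      exact hstep Q P (hP Q P hPs).1 (hP Q P hPs).2
    filter_upwards [hfin, hend', hstep'] with x h1 h2 h3 hx
    exact le_tsum_of_chain (fun Q _ P hPs => (hP Q P hPs).1) hsub hx h1 h2 h3

/-! ### The sparse bound -/

/-- The infimum in the definition of the percentile is attained, by continuity from below of the
(outer) measure; no measurability of `g` is needed. -/
theorem measure_percentile_lt_le {r : ℝ} {Ω : Set (Space d)} {g : Space d → ℝ≥0∞} :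
    volume {x | x ∈ Ω ∧ percentile r Ω g < g x} ≤ ENNReal.ofReal r * volume Ω := by
  set A : Set ℝ≥0∞ := {t | volume {x | x ∈ Ω ∧ t < g x} ≤ ENNReal.ofReal r * volume Ω} with hA
  have hne : A.Nonempty := ⟨∞, by simp [hA]⟩
  obtain ⟨u, hanti, hlim, hu⟩ := exists_seq_tendsto_sInf hne (OrderBot.bddBelow A)
  have e : {x | x ∈ Ω ∧ percentile r Ω g < g x} = ⋃ n, {x | x ∈ Ω ∧ u n < g x} := by
    ext x
    simp only [Set.mem_ofPred_eq, Set.mem_iUnion]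
    constructor
    · rintro ⟨hx, hlt⟩
      obtain ⟨n, hn⟩ := (hlim.eventually_lt_const hlt).exists
      exact ⟨n, hx, hn⟩
    · rintro ⟨n, hx, hlt⟩
      exact ⟨hx, (sInf_le (hu n)).trans_lt hlt⟩
  have hmono : Monotone fun n => {x | x ∈ Ω ∧ u n < g x} := fun n m hnm x hx =>
    ⟨hx.1, (hanti hnm).trans_lt hx.2⟩
  rw [e, hmono.measure_iUnion]
  exact iSup_le fun n => hu n

end CancellativeSparse

theorem theoremD (d : ℕ) (hd : 0 < d) :
    ∃ r : ℝ, 0 < r ∧ r < 1 ∧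
      ∀ (s : ℝ), 0 < s → ∀ (T : L2 d →L[ℝ] L2 d), IsSmoothCZO s T →
        ∃ C : ℝ≥0, ∀ (Q₀ : Cube d) (f : Space d → ℝ) (hf : IsLinftyC f),
          (∀ᵐ x ∂(volume : Measure (Space d)), x ∉ Q₀.toSet → f x = 0) →
          ∃ S : Set (Cube d), S ⊆ dyadicCubes Q₀ ∧ IsSparse (1 / 2) S ∧
            ∀ᵐ x ∂(volume : Measure (Space d)), x ∈ Q₀.toSet →
              ‖T (hf.memLp_two.toLp f) x‖ₑ ≤
                C * ∑' Q : S, Q.1.toSet.indicator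
                  (fun _ => percentile r Q.1.toSet (smoothMaximal s Q.1.triple f)) x := by
  -- with this value the exceptional set fills at most the proportion `3 κ = 1 / (8 * 2 ^ d)`
  set κ : ℝ≥0 := 1 / (24 * 2 ^ d) with hκ
  have h2d : (1 : ℝ≥0) ≤ 2 ^ d := one_le_pow₀ (by norm_num)
  have hκ0 : 0 < κ := by positivity
  have hκ4 : κ ≤ 1 / 4 := by
    rw [hκ]
    gcongr
    calc (4 : ℝ≥0) ≤ 24 * 1 := by norm_num
      _ ≤ 24 * 2 ^ d := by gcongr
  refine ⟨κ, by exact_mod_cast hκ0, ?_, fun s hs T hT => ?_⟩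
  · have : (κ : ℝ) ≤ 1 / 4 := by exact_mod_cast hκ4
    linarith
  obtain ⟨K, CK, hCK, hK, hrep⟩ := hT
  obtain ⟨C, hC, hstep⟩ := Cube.exists_exceptional_set hs hd hCK hK hrep hκ0 hκ4
  refine ⟨C, fun Q₀ f hf hfQ => ?_⟩
  set p : Cube d → ℝ≥0∞ := fun Q => percentile κ Q.toSet (smoothMaximal s Q.triple f) with hp
  obtain ⟨S, hS, hsp, hdom⟩ := exists_sparse_of_exceptional_sets hd Q₀
    (fun Q x => ‖applyOp T (fun y => f y * Q.cutoff y) x‖ₑ) (fun Q => C * p Q) fun Q => by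
      by_cases htop : p Q = ∞
      · -- the bound is trivial, because `C` is positive
        have e : (C : ℝ≥0∞) * p Q = ∞ := by
          rw [htop]; exact ENNReal.mul_top (by exact_mod_cast hC.ne')
        exact ⟨∅, MeasurableSet.empty, by simp, by simp [e], by simp [e]⟩
      · have hμ := measure_percentile_lt_le (r := κ) (Ω := Q.toSet)
          (g := smoothMaximal s Q.triple f)
        obtain ⟨B, hB, hBv, h1, h2⟩ := hstep Q f hf (p Q).toNNReal (by
          rw [ENNReal.coe_toNNReal htop]
          rwa [ENNReal.ofReal_coe_nnreal] at hμ)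
        rw [ENNReal.coe_toNNReal htop] at h1 h2
        refine ⟨B, hB, ?_, h1, h2⟩
        have hk : (8 * 2 ^ d * (3 * κ) : ℝ≥0) = 1 := by
          rw [hκ]; field_simp; norm_num
        calc 8 * 2 ^ d * volume B ≤ 8 * 2 ^ d * (3 * κ * volume Q.toSet) := by gcongr
          _ = ((8 * 2 ^ d * (3 * κ) : ℝ≥0) : ℝ≥0∞) * volume Q.toSet := by push_cast; ring
          _ = _ := by rw [hk, ENNReal.coe_one, one_mul]
  refine ⟨S, hS, hsp, ?_⟩
  have hcut : (fun y => f y * Q₀.cutoff y) =ᵐ[volume] f := by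
    filter_upwards [hfQ] with y hy
    by_cases hyQ : y ∈ Q₀.toSet
    · have h1 : Q₀.cutoff y = 1 := Cube.cutoff_eq_one fun i => by
        have := hyQ i
        have := Q₀.side_pos
        constructor <;> linarith
      rw [h1, mul_one]
    · rw [hy hyQ, zero_mul]
  filter_upwards [hdom] with x hx hxQ
  have h1 := hx hxQ
  rw [applyOp_congr hcut, applyOp_eq hf.memLp_two] at h1
  refine h1.trans (le_of_eq ?_)
  rw [← ENNReal.tsum_mul_left]
  refine tsum_congr fun Q => ?_
  by_cases hxS : x ∈ Q.1.toSet
  · simp only [Set.indicator_of_mem hxS, hp]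
  · simp only [Set.indicator_of_notMem hxS, mul_zero]
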